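/- **Theorem.** Let $n\ge 2$ and $a\in\mathbb C$ with $|a|=1$, where $\operatorname{Re}a\ge 0$ if $n$ is even and $\operatorname{Re}a=0$ (that is, $a=\pm i$) if $n$ is odd. Put $\omega(\xi)=a\xi^n$, $\varphi=\arg a\in[-\frac{\pi}{2},\frac{\pi}{2}]$ and $\rho=e^{2\pi i/n}$. The set $\{\operatorname{Re}(a\xi^n)<0\}$ is the union of the $n$ open sectors $D_k$, $k=1,\dots,n$, bounded by the rays of arguments $$\vartheta_k^1=\frac{\pi}{2n}-\frac{\varphi-2(k-1)\pi}{n},\qquad \vartheta_k^2=\frac{3\pi}{2n}-\frac{\varphi-2(k-1)\pi}{n}.$$ Let $N$ be the number of these sectors that lie in the open lower half-plane (so $N=\frac n2$ for $n$ even, $N=\frac{n-1}2$ for $n$ odd and $a=i$, $N=\frac{n+1}2$ for $n$ odd and $a=-i$). The sectors in the upper half-plane are $D_k^+=D_k$, $1\le k\le n-N$. Let $\partial D_k^+$ be the counterclockwise boundary: outwards along the ray $\vartheta^1_k$ and inwards along the ray $\vartheta_k^2$. Integrals over $\partial D_k^+$ are improper integrals, convergent along each of the two rays. Let $\{u_1,\dots,u_{n-N}\}\cup\{v_1,\dots,v_N\}=\{0,1,\dots,n-1\}$.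 For $\zeta\in\mathbb C$ let $V(\zeta)$ be the $N\times N$ matrix with entries $V(\zeta)_{pj}=(\zeta\rho^{\,p-1})^{\,n-1-v_j}$ (in particular $V(\rho)_{pj}=\rho^{\,p(n-1-v_j)}$), let $V_{jp}(\zeta)$ be $V(\zeta)$ with its $p$-th row and $j$-th column removed (an empty determinant is $1$), and let $V^{jl}(\zeta)$ be $V(\zeta)$ with its $j$-th column replaced by $\big((\zeta\rho^{\,p-1})^{\,n-1-u_l}\big)_{1\le p\le N}$. Let $T>0$ and let $q(t,x)$ be a classical solution of $$q_t+a(-i\partial_x)^nq=0,\qquad 0<t<T,\quad 0<x<\infty,$$ in the following sense: $q(t,\cdot)\in C^n[0,\infty)$ and $q(t,\cdot)\in L^1(0,\infty)$ for all $t\in[0,T]$; $\partial_x^mq$ is continuous on $[0,T]\times[0,\infty)$ and tends to $0$ as $x\to\infty$, uniformly in $t\in[0,T]$, for each $m<n$; $\partial_x^nq$ is continuous on $(0,T)\times(0,\infty)$, where $q$ is differentiable in $t$ and the equation holds pointwise. Let $$q(0,x)=q_o(x)\quad(0<x<\infty),\qquad \partial_x^{u_l}q(t,0)=g_l(t)\quad(0<t<T,\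 1\le l\le n-N),$$ where $q_o\in C^{n+1}[0,\infty)$ with $q_o^{(m)}\in L^1(0,\infty)$ for $0\le m\le n+1$, and $g_l\in C^1[0,T]$. Write $\widehat q_o(\xi)=\int_0^\infty e^{-ix\xi}q_o(x)\,dx$ for $\operatorname{Im}\xi\le0$. Then for every $j\in\{1,\dots,N\}$ and $0<t<T$ all the contour integrals below converge, and $$\begin{aligned} 2\pi\,\partial_x^{v_j}q(t,0)={}&-\frac1{n-N}\sum_{k=1}^{n-N}\int_{\partial D_k^+}\sum_{p=1}^N(-1)^{p+j}\left(\frac{\det V_{jp}}{\det V}\right)(\rho^{\,n-N+1-k})\;n\,\widehat q_o(\rho^{\,n-N+p-k}\xi)\,(i\xi)^{v_j}e^{-\omega(\xi)t}\,d\xi\\ &+\frac1{n-N}\sum_{k=1}^{n-N}\int_{\partial D_k^+}\sum_{l:\,u_l<v_j}\left(\frac{\det V^{jl}}{\det V}\right)(\rho^{\,n-N+1-k})\;n\,q_o^{(u_l)}(0)\,(i\xi)^{v_j-u_l-1}e^{-\omega(\xi)t}\,d\xi\\ &+\sum_{l:\,v_j<u_l}i^{\,v_j-u_l+1}\Lambda_{jl}\,\Gamma\!\left(\frac{v_j-u_l+n}{n}\right)\int_0^t\frac{g_l(\tau)\,d\tau}{(t-\tau)^{(v_j-u_l+n)/n}}\\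 &-\sum_{l:\,u_l<v_j}i^{\,v_j-u_l+1}\Lambda_{jl}\,\Gamma\!\left(\frac{v_j-u_l}{n}\right)\int_0^t\frac{\dot g_l(\tau)\,d\tau}{(t-\tau)^{(v_j-u_l)/n}}, \end{aligned}$$ where $i$ is the imaginary unit and $$\Lambda_{jl}=\left(\frac{\det V^{jl}}{\det V}\right)(\rho^{\,n-N})\,e^{\,i(v_j-u_l)\left(\vartheta_1^1-\frac{\pi}{2n}\right)}-\left(\frac{\det V^{jl}}{\det V}\right)(\rho)\,e^{\,i(v_j-u_l)\left(\vartheta_{n-N}^2+\frac{\pi}{2n}\right)}.$$ -/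

import Mathlib

open Set Filter Topology MeasureTheory

noncomputable section

namespace HalfLine

/-- The symbol `ω(ξ) = a ξⁿ`. -/
def symbol (n : ℕ) (a ξ : ℂ) : ℂ := a * ξ ^ n

/-- The `m`-th derivative of a function on `[0, ∞)` (one-sided at `0`). -/
def dx (m : ℕ) (f : ℝ → ℂ) (x : ℝ) : ℂ := iteratedDerivWithin m f (Ici 0) x

/-- `q` is a classical solution of `q_t + a (-i ∂ₓ)ⁿ q = 0` on `(0,T) × (0,∞)` whose `x`-derivatives
of order `< n` are continuous up to the boundary and decay as `x → ∞`.
The first argument of `q` is time, the second one is space. -/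
structure IsSolution (n : ℕ) (a : ℂ) (T : ℝ) (q : ℝ → ℝ → ℂ) : Prop where
  contDiffOn : ∀ t ∈ Icc 0 T, ContDiffOn ℝ n (q t) (Ici 0)
  continuousOn : ∀ m < n,
    ContinuousOn (fun p : ℝ × ℝ => dx m (q p.1) p.2) (Icc 0 T ×ˢ Ici 0)
  continuousOn_top :
    ContinuousOn (fun p : ℝ × ℝ => dx n (q p.1) p.2) (Ioo 0 T ×ˢ Ioi 0)
  differentiableAt : ∀ t ∈ Ioo 0 T, ∀ x ∈ Ioi (0 : ℝ), DifferentiableAt ℝ (fun s => q s x) t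
  pde : ∀ t ∈ Ioo 0 T, ∀ x ∈ Ioi (0 : ℝ),
    deriv (fun s => q s x) t + a * ((-Complex.I) ^ n * dx n (q t) x) = 0
  decay : ∀ m < n, TendstoUniformlyOn (fun x t => dx m (q t) x) (fun _ => 0) atTop (Icc 0 T)
  integrable : ∀ t ∈ Icc 0 T, IntegrableOn (q t) (Ioi 0)

/-- An admissible initial datum: `C^{n+1}` on `[0, ∞)`, all derivatives of order `≤ n + 1` being
integrable. -/
structure IsInitialDatum (n : ℕ) (qo : ℝ → ℂ) : Prop where
  contDiffOn : ContDiffOn ℝ (n + 1) qo (Ici 0)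
  integrable : ∀ m ≤ n + 1, IntegrableOn (dx m qo) (Ioi 0)

/-- The half-line Fourier transform `∫₀^∞ e^{-i x ξ} f(x) dx`. -/
def halfLineTransform (f : ℝ → ℂ) (ξ : ℂ) : ℂ :=
  ∫ x in Ioi (0 : ℝ), Complex.exp (-(Complex.I * x * ξ)) * f x

/-- The argument of the first (clockwise) boundary ray of the `k`-th sector of
`{Re (a ξⁿ) < 0}`, `k = 0, …, n - 1`. -/
def rayOne (n : ℕ) (a : ℂ) (k : ℕ) : ℝ :=
  Real.pi / (2 * n) - (Complex.arg a - 2 * k * Real.pi) / n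

/-- The argument of the second boundary ray of the `k`-th sector. -/
def rayTwo (n : ℕ) (a : ℂ) (k : ℕ) : ℝ :=
  3 * Real.pi / (2 * n) - (Complex.arg a - 2 * k * Real.pi) / n

/-- The `k`-th sector of `{Re (a ξⁿ) < 0}`. -/
def sector (n : ℕ) (a : ℂ) (k : ℕ) : Set ℂ :=
  {ξ | ∃ r θ : ℝ, 0 < r ∧ rayOne n a k < θ ∧ θ < rayTwo n a k ∧
    ξ = r * Complex.exp (θ * Complex.I)}

/-- The sectors make up the domain `{Re (a ξⁿ) < 0}`. -/
theorem setOf_re_symbol_neg (n : ℕ) (hn : 0 < n) (a : ℂ) (ha : ‖a‖ = 1) :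
    {ξ : ℂ | (symbol n a ξ).re < 0} = ⋃ k : Fin n, sector n a k := by
  have hn' : (0 : ℝ) < n := by exact_mod_cast hn
  have hpi := Real.pi_pos
  have ha' : a = Complex.exp (Complex.arg a * Complex.I) := by
    have := Complex.norm_mul_exp_arg_mul_I a
    rw [ha] at this
    simpa using this.symm
  have hre : ∀ r θ : ℝ, (symbol n a (r * Complex.exp (θ * Complex.I))).re =
      r ^ n * Real.cos (Complex.arg a + n * θ) := by
    intro r θ
    have : symbol n a (r * Complex.exp (θ * Complex.I)) =
        ((r ^ n : ℝ) : ℂ) * Complex.exp (((Complex.arg a + n * θ : ℝ) : ℂ) * Complex.I) := by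
      unfold symbol
      conv_lhs => rw [ha']
      rw [mul_pow, ← Complex.exp_nat_mul, mul_left_comm, ← Complex.exp_add]
      push_cast
      ring_nf
    rw [this, Complex.re_ofReal_mul, Complex.exp_ofReal_mul_I_re]
  have e1 : ∀ k, rayOne n a k = (Real.pi / 2 - Complex.arg a + 2 * k * Real.pi) / n := by
    intro k; unfold rayOne; field_simp; ring
  have e2 : ∀ k, rayTwo n a k = (3 * Real.pi / 2 - Complex.arg a + 2 * k * Real.pi) / n := by
    intro k; unfold rayTwo; field_simp; ring
  ext ξ
  simp only [mem_ofPred_eq, mem_iUnion]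
  constructor
  · intro h
    have h0 : ξ ≠ 0 := by
      rintro rfl
      simp [symbol, hn.ne'] at h
    have hr : 0 < ‖ξ‖ := norm_pos_iff.mpr h0
    rw [← Complex.norm_mul_exp_arg_mul_I ξ, hre] at h
    have hcos : Real.cos (Complex.arg a + n * Complex.arg ξ) < 0 := by
      by_contra hc
      have := mul_nonneg (pow_pos hr n).le (not_lt.mp hc)
      linarith
    set x := Complex.arg a + n * Complex.arg ξ with hx
    set m : ℤ := ⌊(x - Real.pi / 2) / (2 * Real.pi)⌋ with hm
    have hm1 : (m : ℝ) * (2 * Real.pi) ≤ x - Real.pi / 2 := by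
      rw [← le_div_iff₀ (by positivity)]; exact Int.floor_le _
    have hm2 : x - Real.pi / 2 < (m + 1) * (2 * Real.pi) := by
      rw [← div_lt_iff₀ (by positivity)]; exact Int.lt_floor_add_one _
    set y := x - m * (2 * Real.pi) with hy
    have hcy : Real.cos y < 0 := by rw [hy, Real.cos_sub_int_mul_two_pi]; exact hcos
    have hy1 : Real.pi / 2 < y := by
      rcases lt_or_eq_of_le (show Real.pi / 2 ≤ y by linarith) with h' | h'
      · exact h'
      · rw [← h', Real.cos_pi_div_two] at hcy; exact absurd hcy (lt_irrefl _)
    have hy2 : y < 3 * Real.pi / 2 := by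
      by_contra hc
      have : 0 ≤ Real.cos (y - 2 * Real.pi) :=
        Real.cos_nonneg_of_neg_pi_div_two_le_of_le (by linarith) (by linarith)
      rw [Real.cos_sub_two_pi] at this
      linarith
    have hnz : (n : ℤ) ≠ 0 := by exact_mod_cast hn.ne'
    have hk0 := Int.emod_nonneg m hnz
    have hk1 := Int.emod_lt_of_pos m (by exact_mod_cast hn : (0 : ℤ) < n)
    have hdiv := Int.emod_add_mul_ediv m n
    obtain ⟨k, hk⟩ := Int.eq_ofNat_of_zero_le hk0
    have hkm : (m : ℝ) = k + n * ((m / n : ℤ) : ℝ) := by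
      rw [hk] at hdiv
      exact_mod_cast hdiv.symm
    refine ⟨⟨k, by omega⟩, ‖ξ‖, Complex.arg ξ - (m / n : ℤ) * (2 * Real.pi), hr, ?_, ?_, ?_⟩
    · rw [e1, div_lt_iff₀ hn']
      rw [hy, hx, hkm] at hy1
      simp only
      linarith
    · rw [e2, lt_div_iff₀ hn']
      rw [hy, hx, hkm] at hy2
      simp only
      linarith
    · conv_lhs => rw [← Complex.norm_mul_exp_arg_mul_I ξ]
      congr 1
      push_cast
      rw [sub_mul, Complex.exp_sub]
      have : Complex.exp (((m / n : ℤ) : ℂ) * (2 * Real.pi) * Complex.I) = 1 := by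
        rw [mul_assoc]; exact Complex.exp_int_mul_two_pi_mul_I _
      rw [this, div_one]
  · rintro ⟨k, r, θ, hr, h1, h2, rfl⟩
    rw [e1, div_lt_iff₀ hn'] at h1
    rw [e2, lt_div_iff₀ hn'] at h2
    rw [hre]
    apply mul_neg_of_pos_of_neg (pow_pos hr n)
    rw [← Real.cos_sub_nat_mul_two_pi _ (k : ℕ)]
    apply Real.cos_neg_of_pi_div_two_lt_of_lt <;> linarith

/-- The number of the sectors that lie in the open lower half-plane. -/
def lowerCount (n : ℕ) (a : ℂ) : ℕ :=
  {k : Fin n | sector n a k ⊆ {ξ : ℂ | ξ.im < 0}}.ncard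

theorem lowerCount_eq_of (n : ℕ) (hn : 0 < n) (a : ℂ) (K : ℕ)
    (h1 : ∀ k < K, 0 < Real.pi - Complex.arg a + 2 * k * Real.pi ∧
      Real.pi - Complex.arg a + 2 * k * Real.pi < n * Real.pi)
    (h2 : ∀ k, K ≤ k → k < n → n * Real.pi ≤ Real.pi / 2 - Complex.arg a + 2 * k * Real.pi ∧
      3 * Real.pi / 2 - Complex.arg a + 2 * k * Real.pi ≤ n * (2 * Real.pi)) :
    lowerCount n a = n - K := by
  have hn' : (0 : ℝ) < n := by exact_mod_cast hn
  have e1 : ∀ k, rayOne n a k = (Real.pi / 2 - Complex.arg a + 2 * k * Real.pi) / n := by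
    intro k; unfold rayOne; field_simp; ring
  have e2 : ∀ k, rayTwo n a k = (3 * Real.pi / 2 - Complex.arg a + 2 * k * Real.pi) / n := by
    intro k; unfold rayTwo; field_simp; ring
  have im_eq : ∀ r θ : ℝ, ((r : ℂ) * Complex.exp (θ * Complex.I)).im = r * Real.sin θ := by
    intro r θ
    rw [Complex.im_ofReal_mul, Complex.exp_ofReal_mul_I_im]
  have key : {k : Fin n | sector n a k ⊆ {ξ : ℂ | ξ.im < 0}} = {k : Fin n | K ≤ (k : ℕ)} := by
    ext k
    simp only [mem_ofPred_eq]
    constructor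
    · intro h
      by_contra hk
      obtain ⟨ha, hb⟩ := h1 k (not_le.mp hk)
      have hmem : ((1 : ℝ) : ℂ) * Complex.exp
          ((((Real.pi - Complex.arg a + 2 * (k : ℕ) * Real.pi) / n : ℝ) : ℂ) * Complex.I) ∈
          sector n a k := by
        refine ⟨1, _, one_pos, ?_, ?_, rfl⟩
        · rw [e1]
          apply div_lt_div_of_pos_right _ hn'
          linarith [Real.pi_pos]
        · rw [e2]
          apply div_lt_div_of_pos_right _ hn'
          linarith [Real.pi_pos]
      have := h hmem
      simp only [mem_ofPred_eq] at this
      rw [im_eq] at this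
      have hpos := Real.sin_pos_of_pos_of_lt_pi
        (x := (Real.pi - Complex.arg a + 2 * (k : ℕ) * Real.pi) / n) (by positivity)
        (by rw [div_lt_iff₀ hn']; linarith)
      linarith
    · rintro hk ξ ⟨r, θ, hr, hθ1, hθ2, rfl⟩
      obtain ⟨ha, hb⟩ := h2 k hk k.2
      simp only [mem_ofPred_eq]
      rw [im_eq]
      have l1 : Real.pi < θ := by
        refine lt_of_le_of_lt ?_ hθ1
        rw [e1, le_div_iff₀ hn']; linarith
      have l2 : θ < 2 * Real.pi := by
        refine lt_of_lt_of_le hθ2 ?_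
        rw [e2, div_le_iff₀ hn']; linarith
      have hs : Real.sin θ < 0 := by
        have := Real.sin_neg_of_neg_of_neg_pi_lt (x := θ - 2 * Real.pi) (by linarith)
          (by linarith)
        rwa [Real.sin_sub_two_pi] at this
      exact mul_neg_of_pos_of_neg hr hs
  unfold lowerCount
  rw [key]
  have : {k : Fin n | K ≤ (k : ℕ)} =
      ((Finset.univ.filter fun k : Fin n => K ≤ (k : ℕ) : Finset (Fin n)) : Set (Fin n)) := by
    ext; simp
  rw [this, Set.ncard_coe_finset]
  have hc : (Finset.univ.filter fun k : Fin n => K ≤ (k : ℕ)).card = (Finset.Ico K n).card := by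
    rw [← Finset.card_map Fin.valEmbedding]
    congr 1
    ext m
    simp only [Finset.mem_map, Finset.mem_filter, Finset.mem_univ, true_and,
      Fin.valEmbedding_apply, Finset.mem_Ico]
    constructor
    · rintro ⟨k, hk, rfl⟩
      exact ⟨hk, k.2⟩
    · rintro ⟨h, h'⟩
      exact ⟨⟨m, h'⟩, h, rfl⟩
  rw [hc, Nat.card_Ico]

theorem lowerCount_even (m : ℕ) (hm : 0 < m) (a : ℂ) (ha : 0 ≤ a.re) :
    lowerCount (2 * m) a = m := by
  have h := abs_le.mp (Complex.abs_arg_le_pi_div_two_iff.mpr ha)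
  have hpi := Real.pi_pos
  rw [lowerCount_eq_of (2 * m) (by omega) a m]
  · omega
  · intro k hk
    have hk' : (k : ℝ) + 1 ≤ m := by exact_mod_cast hk
    have := mul_le_mul_of_nonneg_right hk' hpi.le
    have := mul_nonneg (Nat.cast_nonneg (α := ℝ) k) hpi.le
    push_cast
    constructor <;> nlinarith
  · intro k hk hk2
    have hk' : (m : ℝ) ≤ k := by exact_mod_cast hk
    have hk3 : (k : ℝ) + 1 ≤ 2 * m := by exact_mod_cast hk2
    have := mul_le_mul_of_nonneg_right hk' hpi.le
    have := mul_le_mul_of_nonneg_right hk3 hpi.le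
    push_cast
    constructor <;> nlinarith

theorem lowerCount_odd_I (m : ℕ) : lowerCount (2 * m + 1) Complex.I = m := by
  have hpi := Real.pi_pos
  rw [lowerCount_eq_of (2 * m + 1) (by omega) Complex.I (m + 1)]
  · omega
  · intro k hk
    have hk' : (k : ℝ) ≤ m := by exact_mod_cast Nat.lt_succ_iff.mp hk
    have := mul_le_mul_of_nonneg_right hk' hpi.le
    have := mul_nonneg (Nat.cast_nonneg (α := ℝ) k) hpi.le
    rw [Complex.arg_I]
    push_cast
    constructor <;> nlinarith
  · intro k hk hk2
    have hk' : (m : ℝ) + 1 ≤ k := by exact_mod_cast hk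
    have hk3 : (k : ℝ) ≤ 2 * m := by exact_mod_cast Nat.lt_succ_iff.mp hk2
    have := mul_le_mul_of_nonneg_right hk' hpi.le
    have := mul_le_mul_of_nonneg_right hk3 hpi.le
    rw [Complex.arg_I]
    push_cast
    constructor <;> nlinarith

theorem lowerCount_odd_neg_I (m : ℕ) : lowerCount (2 * m + 1) (-Complex.I) = m + 1 := by
  have hpi := Real.pi_pos
  rw [lowerCount_eq_of (2 * m + 1) (by omega) (-Complex.I) m]
  · omega
  · intro k hk
    have hk' : (k : ℝ) + 1 ≤ m := by exact_mod_cast hk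
    have := mul_le_mul_of_nonneg_right hk' hpi.le
    have := mul_nonneg (Nat.cast_nonneg (α := ℝ) k) hpi.le
    rw [Complex.arg_neg_I]
    push_cast
    constructor <;> nlinarith
  · intro k hk hk2
    have hk' : (m : ℝ) ≤ k := by exact_mod_cast hk
    have hk3 : (k : ℝ) ≤ 2 * m := by exact_mod_cast Nat.lt_succ_iff.mp hk2
    have := mul_le_mul_of_nonneg_right hk' hpi.le
    have := mul_le_mul_of_nonneg_right hk3 hpi.le
    rw [Complex.arg_neg_I]
    push_cast
    constructor <;> nlinarith

/-- `∫ f(ξ) dξ` along the ray of argument `θ`, from the origin to infinity, exists as an improper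
integral and equals `I`. -/
def HasRayIntegral (θ : ℝ) (f : ℂ → ℂ) (I : ℂ) : Prop :=
  Tendsto (fun R : ℝ => ∫ r in (0 : ℝ)..R,
    f (r * Complex.exp (θ * Complex.I)) * Complex.exp (θ * Complex.I)) atTop (𝓝 I)

/-- The contour integral of `f` over the counterclockwise boundary of the `k`-th sector exists and
equals `I`: the first ray is directed away from the origin, the second one towards it. -/
def HasContourIntegral (n : ℕ) (a : ℂ) (k : ℕ) (f : ℂ → ℂ) (I : ℂ) : Prop :=
  ∃ I₁ I₂ : ℂ, HasRayIntegral (rayOne n a k) f I₁ ∧ HasRayIntegral (rayTwo n a k) f I₂ ∧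
    I = I₁ - I₂

/-- `ρ = e^{2πi/n}`. -/
def rho (n : ℕ) : ℂ := Complex.exp (2 * Real.pi * Complex.I / n)

/-- The generalized Vandermonde matrix with rows given by the nodes `ζ, ζρ, …, ζρ^{N-1}` and
columns given by the exponents `n - 1 - v_j`. At `ζ = ρ` its entries are `ρ^{i (n - 1 - v_j)}`,
where `i = 1, …, N`. -/
def vand (n : ℕ) {N : ℕ} (v : Fin N → ℕ) (ζ : ℂ) : Matrix (Fin N) (Fin N) ℂ :=
  Matrix.of fun i j => (ζ * rho n ^ (i : ℕ)) ^ (n - 1 - v j)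

/-- The matrix `vand` with its `j`-th column replaced by the one with exponent `n - 1 - u`. -/
def vandReplace (n : ℕ) {N : ℕ} (v : Fin N → ℕ) (j : Fin N) (u : ℕ) (ζ : ℂ) :
    Matrix (Fin N) (Fin N) ℂ :=
  (vand n v ζ).updateCol j fun i => (ζ * rho n ^ (i : ℕ)) ^ (n - 1 - u)

/-- The determinant of a matrix with its `i`-th row and `j`-th column removed. -/
def minorDet : {N : ℕ} → Matrix (Fin N) (Fin N) ℂ → Fin N → Fin N → ℂ
  | 0, _, i, _ => i.elim0
  | _ + 1, A, i, j => (A.submatrix i.succAbove j.succAbove).det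

/-- The quotient `det V_{ji} / det V` at `ζ`. -/
def minorQuot (n : ℕ) {N : ℕ} (v : Fin N → ℕ) (j i : Fin N) (ζ : ℂ) : ℂ :=
  minorDet (vand n v ζ) i j / (vand n v ζ).det

/-- The quotient `det V^{jl} / det V` at `ζ`, where `u = u_l`. -/
def replaceQuot (n : ℕ) {N : ℕ} (v : Fin N → ℕ) (j : Fin N) (u : ℕ) (ζ : ℂ) : ℂ :=
  (vandReplace n v j u ζ).det / (vand n v ζ).det

/-- The constant `Λ_{jl}`, where `u = u_l`. -/
def Lam (n : ℕ) (a : ℂ) {N : ℕ} (v : Fin N → ℕ) (j : Fin N) (u : ℕ) : ℂ :=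
  replaceQuot n v j u (rho n ^ (n - N)) *
      Complex.exp (Complex.I * ((v j : ℂ) - u) * (rayOne n a 0 - Real.pi / (2 * n) : ℝ)) -
    replaceQuot n v j u (rho n) *
      Complex.exp (Complex.I * ((v j : ℂ) - u) *
        (rayTwo n a (n - N - 1) + Real.pi / (2 * n) : ℝ))

/-- The contribution of the initial datum to the integrand over the boundary of the `k`-th sector
(`k` and `i` are counted from `0`). -/
def datumIntegrand (n : ℕ) (a : ℂ) {N : ℕ} (v : Fin N → ℕ) (qo : ℝ → ℂ) (t : ℝ) (j : Fin N)
    (k : ℕ) (ξ : ℂ) : ℂ :=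
  (∑ i : Fin N, (-1) ^ ((i : ℕ) + (j : ℕ)) * minorQuot n v j i (rho n ^ (n - N - k)) * n *
    halfLineTransform qo (rho n ^ (n - N - k + i) * ξ)) *
      (Complex.I * ξ) ^ v j * Complex.exp (-(symbol n a ξ * t))

/-- The contribution of the corner values `qo^{(u_l)}(0)` to the integrand over the boundary of the
`k`-th sector. -/
def cornerIntegrand (n : ℕ) (a : ℂ) {N M : ℕ} (v : Fin N → ℕ) (u : Fin M → ℕ) (qo : ℝ → ℂ)
    (t : ℝ) (j : Fin N) (k : ℕ) (ξ : ℂ) : ℂ :=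
  (∑ l : Fin M with u l < v j, replaceQuot n v j (u l) (rho n ^ (n - N - k)) * n *
    dx (u l) qo 0 * (Complex.I * ξ) ^ (v j - u l - 1)) * Complex.exp (-(symbol n a ξ * t))

/-- The Abel-type fractional integral `∫₀ᵗ f(τ) (t - τ)^{-α} dτ`. -/
def abel (α : ℝ) (f : ℝ → ℂ) (t : ℝ) : ℂ :=
  ∫ τ in (0 : ℝ)..t, f τ / (((t - τ) ^ α : ℝ) : ℂ)

end HalfLine

end

noncomputable section

namespace HalfLine

/-! The proof computes Laplace transforms in time of both sides, truncated to an interval `(0, t)`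
inside `(0, T)` and known only up to an error `O(e^{-st})`. Such errors are harmless: a continuous
integrable function on `(0, t)` whose truncated transform is `O(e^{-st})` is zero
(`eq_zero_of_laplace_le`). Neither a solution beyond time `T` nor an inversion integral is needed.

Fix `s ≥ 1` and let `ξ` be the point on the bisector of the first sector with `ω(ξ) = -s` (`pole`).
Its rotations by `ρ^{n-N}, …, ρ^{n-1}` lie in the lower half-plane and have the same `ω`. Green's
formula for the equation (`IsSolution.global_relation`) at these `N` points gives `N` linear
equations for the transforms of the boundary values of orders `0, …, n-1`. In them `q(t, ·)` carries
the factor `e^{-st}` and joins the error. The matrix of the unknown orders `v_l` is a generalized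
Vandermonde matrix at roots of unity, hence invertible; a row of its inverse (`weight`) isolates the
order `v_j` and leaves `det V^{jl} / det V` in front of the known orders `u_l`
(`sum_weight_mul_transform`).

Each term of this solved equation is the transform of a term of the formula. For the contour
integrals, the transform of `e^{-ω(ξ)t}` is `1 / (s + ω(ξ))` up to the error, and Cauchy's formula
in the sector leaves the residue at `ξ` (`sector_integral_sub`,
`SectorAdmissible.exists_contourIntegral`). An Abel integral is a convolution, so its transform is
`Γ(1-α) s^{α-1}` times that of the density (`laplace_abel`); the reflection formula for `Γ` matches
the constants with `Λ` (`abel_coeff_of_lt`, `abel_coeff_of_gt`). For `u_l < v_j` the density is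
`ġ_l`, and the resulting `g_l(0)` is cancelled by the corner integral. Finally, the substitution `ξ
↦ ρ^k ξ` shows that all upper sectors contribute equally, so the average over `k` is the
contribution of the first sector.

The integrals along the rays converge only by oscillation. They are controlled by integration by
parts, with the amplitudes expanded in powers of `r` up to `O(r^{-2})`; this is where `n + 1`
derivatives of the datum enter. -/

/-! ### Oscillatory improper integrals along a ray -/

/-- The oscillating factor `e^{i c rⁿ τ}`. -/
def phase (n : ℕ) (c τ r : ℝ) : ℂ := Complex.exp (((c * r ^ n * τ : ℝ) : ℂ) * Complex.I)

theorem norm_phase (n : ℕ) (c τ r : ℝ) : ‖phase n c τ r‖ = 1 :=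
  Complex.norm_exp_ofReal_mul_I _

theorem continuous_phase (n : ℕ) (c : ℝ) : Continuous fun p : ℝ × ℝ => phase n c p.1 p.2 := by
  unfold phase; fun_prop

theorem continuous_phase_right (n : ℕ) (c τ : ℝ) : Continuous fun r => phase n c τ r := by
  unfold phase; fun_prop

theorem hasDerivAt_phase (n : ℕ) (c τ r : ℝ) :
    HasDerivAt (phase n c τ) (phase n c τ r * ((c * (n * r ^ (n - 1)) * τ : ℝ) * Complex.I)) r := by
  unfold phase
  have h : HasDerivAt (fun r : ℝ => c * r ^ n * τ) (c * (n * r ^ (n - 1)) * τ) r :=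
    ((hasDerivAt_pow n r).const_mul c).mul_const τ
  exact (h.ofReal_comp.mul_const Complex.I).cexp

/-- The first-derivative (van der Corput) bound for `∫ r^{n-1-k} e^{i c rⁿ τ} dr`. -/
theorem norm_integral_monomial_mul_phase_le {n : ℕ} (hn : 1 ≤ n) {k : ℕ} (hk : 1 ≤ k) {c : ℝ}
    (hc : |c| = 1) {τ : ℝ} (hτ : 0 < τ) {A R : ℝ} (hA : 1 ≤ A) (hAR : A ≤ R) :
    ‖∫ r in A..R, ((r ^ (n - 1) * (r ^ k)⁻¹ : ℝ) : ℂ) * phase n c τ r‖ ≤ 2 / (τ * A) := by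
  have hA0 : 0 < A := by linarith
  have hpos : ∀ r ∈ uIcc A R, 0 < r := by
    intro r hr; rw [uIcc_of_le hAR] at hr; linarith [hr.1]
  have hc0 : c ≠ 0 := by rintro rfl; simp at hc
  have hn0 : (n : ℝ) ≠ 0 := by positivity
  -- Since `D r^{n-1}` times the phase is the derivative of the phase, the parts integrated are
  -- `r^{n-1} e^{i c rⁿ τ}`, and only the decreasing weight `r^{-k}` is differentiated. Its total
  -- variation is at most `A^{-k} ≤ A^{-1}`.
  set D : ℂ := ((c * n * τ : ℝ) : ℂ) * Complex.I with hD
  have hDn : ‖D‖ = n * τ := by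
    rw [hD, norm_mul, Complex.norm_I, Complex.norm_real, Real.norm_eq_abs, abs_mul, abs_mul, hc,
      abs_of_pos hτ, Nat.abs_cast]; ring
  have hD0 : D ≠ 0 := by
    rw [← norm_pos_iff, hDn]; positivity
  let w' : ℝ → ℝ := fun r => -(k * r ^ (k - 1)) / (r ^ k) ^ 2
  have hw : ∀ r ∈ uIcc A R, HasDerivAt (fun r : ℝ => (r ^ k)⁻¹) (w' r) r := by
    intro r hr
    exact (hasDerivAt_pow k r).inv (pow_pos (hpos r hr) k).ne'
  have hw'c : ContinuousOn w' (uIcc A R) := by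
    apply ContinuousOn.div (by fun_prop) (by fun_prop)
    intro r hr; have := hpos r hr; positivity
  have hG : ∀ r ∈ uIcc A R, HasDerivAt (fun r : ℝ => ((r ^ k)⁻¹ : ℝ) * phase n c τ r)
      ((w' r : ℂ) * phase n c τ r +
        D * (((r ^ (n - 1) * (r ^ k)⁻¹ : ℝ) : ℂ) * phase n c τ r)) r := by
    intro r hr
    refine ((hw r hr).ofReal_comp.mul (hasDerivAt_phase n c τ r)).congr_deriv ?_
    rw [hD]; push_cast; ring
  have hwi : IntervalIntegrable (fun r => (w' r : ℂ) * phase n c τ r) volume A R := by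
    apply ContinuousOn.intervalIntegrable
    exact (Complex.continuous_ofReal.comp_continuousOn hw'c).mul
      (continuous_phase_right n c τ).continuousOn
  have hmi : IntervalIntegrable (fun r : ℝ => ((r ^ (n - 1) * (r ^ k)⁻¹ : ℝ) : ℂ) * phase n c τ r)
      volume A R := by
    apply ContinuousOn.intervalIntegrable
    refine (Complex.continuous_ofReal.comp_continuousOn ?_).mul
      (continuous_phase_right n c τ).continuousOn
    apply ContinuousOn.mul (by fun_prop)
    apply ContinuousOn.inv₀ (by fun_prop)
    intro r hr; have := hpos r hr; positivity
  have hFTC := intervalIntegral.integral_eq_sub_of_hasDerivAt hG (hwi.add (hmi.const_mul D))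
  rw [intervalIntegral.integral_add hwi (hmi.const_mul D),
    intervalIntegral.integral_const_mul] at hFTC
  have hwint : ∫ r in A..R, -w' r = (A ^ k)⁻¹ - (R ^ k)⁻¹ := by
    rw [intervalIntegral.integral_neg,
      intervalIntegral.integral_eq_sub_of_hasDerivAt hw hw'c.intervalIntegrable]; ring
  have hb : ‖∫ r in A..R, (w' r : ℂ) * phase n c τ r‖ ≤ (A ^ k)⁻¹ - (R ^ k)⁻¹ := by
    rw [← hwint]
    apply intervalIntegral.norm_integral_le_of_norm_le hAR _ hw'c.neg.intervalIntegrable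
    refine Eventually.of_forall fun r hr => ?_
    have hr0 : 0 < r := by linarith [hr.1]
    have hneg : w' r ≤ 0 := div_nonpos_of_nonpos_of_nonneg
      (neg_nonpos.mpr (by positivity)) (by positivity)
    rw [norm_mul, norm_phase, mul_one, Complex.norm_real, Real.norm_eq_abs, abs_of_nonpos hneg]
    exact le_rfl
  have hR0 : 0 < R := by linarith
  have e : (D * ∫ r in A..R, ((r ^ (n - 1) * (r ^ k)⁻¹ : ℝ) : ℂ) * phase n c τ r) =
      ((R ^ k)⁻¹ : ℝ) * phase n c τ R - ((A ^ k)⁻¹ : ℝ) * phase n c τ A -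
        ∫ r in A..R, (w' r : ℂ) * phase n c τ r := by
    rw [← hFTC]; ring
  have hn1 : (1 : ℝ) ≤ n := by exact_mod_cast hn
  have hbound : n * τ * ‖∫ r in A..R, ((r ^ (n - 1) * (r ^ k)⁻¹ : ℝ) : ℂ) * phase n c τ r‖ ≤
      2 * (A ^ k)⁻¹ := by
    rw [← hDn, ← norm_mul, e]
    have e1 : ‖(((R ^ k)⁻¹ : ℝ) : ℂ) * phase n c τ R‖ = (R ^ k)⁻¹ := by
      rw [norm_mul, norm_phase, mul_one, Complex.norm_real, Real.norm_of_nonneg (by positivity)]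
    have e2 : ‖(((A ^ k)⁻¹ : ℝ) : ℂ) * phase n c τ A‖ = (A ^ k)⁻¹ := by
      rw [norm_mul, norm_phase, mul_one, Complex.norm_real, Real.norm_of_nonneg (by positivity)]
    have t1 := norm_sub_le ((((R ^ k)⁻¹ : ℝ) : ℂ) * phase n c τ R - ((A ^ k)⁻¹ : ℝ) * phase n c τ A)
      (∫ r in A..R, (w' r : ℂ) * phase n c τ r)
    have t2 := norm_sub_le ((((R ^ k)⁻¹ : ℝ) : ℂ) * phase n c τ R) (((A ^ k)⁻¹ : ℝ) * phase n c τ A)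
    linarith
  have hAk : (A ^ k)⁻¹ ≤ A⁻¹ := by
    apply inv_anti₀ hA0
    calc A = A ^ 1 := (pow_one A).symm
      _ ≤ A ^ k := pow_le_pow_right₀ hA hk
  rw [le_div_iff₀ (by positivity)]
  set X := ‖∫ r in A..R, ((r ^ (n - 1) * (r ^ k)⁻¹ : ℝ) : ℂ) * phase n c τ r‖
  have hX : 0 ≤ X := norm_nonneg _
  have h1 : τ * X ≤ 2 * A⁻¹ := by
    have : 1 * (τ * X) ≤ n * (τ * X) := mul_le_mul_of_nonneg_right hn1 (by positivity)
    linarith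
  calc X * (τ * A) = (τ * X) * A := by ring
    _ ≤ 2 * A⁻¹ * A := by gcongr
    _ = 2 := by field_simp

/-- Functions on a ray for which the improper integrals `∫₀^∞ f(r) e^{± i rⁿ τ} dr` can be
controlled. -/
structure Admissible (n : ℕ) (f : ℝ → ℂ) : Prop where
  continuousOn : ContinuousOn f (Ici 0)
  growth : ∃ C, ∀ r, 0 ≤ r → ‖f r‖ ≤ C * (1 + r) ^ (n - 2)
  osc : ∃ C, ∀ c : ℝ, |c| = 1 → ∀ τ, 0 < τ → ∀ A R, 1 ≤ A → A ≤ R →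
    ‖∫ r in A..R, f r * phase n c τ r‖ ≤ C * ((1 + 1 / τ) / A)

theorem Admissible.intervalIntegrable {n : ℕ} {f : ℝ → ℂ} (hf : Admissible n f) (c τ : ℝ) {A R : ℝ}
    (hA : 0 ≤ A) (hR : 0 ≤ R) : IntervalIntegrable (fun r => f r * phase n c τ r) volume A R := by
  apply ContinuousOn.intervalIntegrable
  refine ContinuousOn.mul (hf.continuousOn.mono ?_) (continuous_phase_right n c τ).continuousOn
  intro x hx
  exact le_trans (le_min hA hR) hx.1

theorem Admissible.add {n : ℕ} {f g : ℝ → ℂ} (hf : Admissible n f) (hg : Admissible n g) :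
    Admissible n fun r => f r + g r := by
  obtain ⟨C1, h1⟩ := hf.growth
  obtain ⟨C2, h2⟩ := hg.growth
  obtain ⟨D1, k1⟩ := hf.osc
  obtain ⟨D2, k2⟩ := hg.osc
  refine ⟨hf.continuousOn.add hg.continuousOn, ⟨C1 + C2, fun r hr => ?_⟩,
    ⟨D1 + D2, fun c hc τ hτ A R hA hR => ?_⟩⟩
  · have := norm_add_le (f r) (g r)
    have := h1 r hr
    have := h2 r hr
    rw [add_mul]; linarith
  · simp_rw [add_mul]
    rw [intervalIntegral.integral_add (hf.intervalIntegrable c τ (by linarith) (by linarith))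
      (hg.intervalIntegrable c τ (by linarith) (by linarith))]
    refine (norm_add_le _ _).trans (add_le_add (k1 c hc τ hτ A R hA hR) (k2 c hc τ hτ A R hA hR))

theorem Admissible.const_mul {n : ℕ} {f : ℝ → ℂ} (hf : Admissible n f) (b : ℂ) :
    Admissible n fun r => b * f r := by
  obtain ⟨C1, h1⟩ := hf.growth
  obtain ⟨D1, k1⟩ := hf.osc
  refine ⟨hf.continuousOn.const_mul b, ⟨‖b‖ * C1, fun r hr => ?_⟩,
    ⟨‖b‖ * D1, fun c hc τ hτ A R hA hR => ?_⟩⟩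
  · rw [norm_mul, mul_assoc]
    exact mul_le_mul_of_nonneg_left (h1 r hr) (norm_nonneg b)
  · simp_rw [mul_assoc]
    rw [intervalIntegral.integral_const_mul, norm_mul]
    exact mul_le_mul_of_nonneg_left (k1 c hc τ hτ A R hA hR) (norm_nonneg b)

theorem admissible_zero (n : ℕ) : Admissible n fun _ => 0 :=
  ⟨continuousOn_const, ⟨0, by simp⟩, ⟨0, by simp⟩⟩

theorem Admissible.sum {n : ℕ} {ι : Type*} (s : Finset ι) {f : ι → ℝ → ℂ}
    (hf : ∀ i ∈ s, Admissible n (f i)) : Admissible n fun r => ∑ i ∈ s, f i r := by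
  classical
  induction s using Finset.induction_on with
  | empty => simpa using admissible_zero n
  | insert i s hi ih =>
    simp_rw [Finset.sum_insert hi]
    exact (hf i (Finset.mem_insert_self i s)).add
      (ih fun k hk => hf k (Finset.mem_insert_of_mem hk))

theorem Admissible.osc_nonneg {n : ℕ} {f : ℝ → ℂ} (hf : Admissible n f) :
    ∃ C, 0 ≤ C ∧ ∀ c : ℝ, |c| = 1 → ∀ τ, 0 < τ → ∀ A R, 1 ≤ A → A ≤ R →
      ‖∫ r in A..R, f r * phase n c τ r‖ ≤ C * ((1 + 1 / τ) / A) := by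
  obtain ⟨C, h⟩ := hf.osc
  refine ⟨max C 0, le_max_right _ _, fun c hc τ hτ A R hA hR => ?_⟩
  refine (h c hc τ hτ A R hA hR).trans (mul_le_mul_of_nonneg_right (le_max_left _ _) ?_)
  positivity

theorem Admissible.growth_nonneg {n : ℕ} {f : ℝ → ℂ} (hf : Admissible n f) :
    ∃ C, 0 ≤ C ∧ ∀ r, 0 ≤ r → ‖f r‖ ≤ C * (1 + r) ^ (n - 2) := by
  obtain ⟨C, h⟩ := hf.growth
  refine ⟨max C 0, le_max_right _ _, fun r hr => ?_⟩
  exact (h r hr).trans (mul_le_mul_of_nonneg_right (le_max_left _ _) (by positivity))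

/-- The truncated integral `∫₀^R f(r) e^{i c rⁿ τ} dr`. -/
def truncInt (n : ℕ) (c : ℝ) (f : ℝ → ℂ) (τ R : ℝ) : ℂ := ∫ r in (0 : ℝ)..R, f r * phase n c τ r

/-- The improper integral `∫₀^∞ f(r) e^{i c rⁿ τ} dr`. -/
def improperInt (n : ℕ) (c : ℝ) (f : ℝ → ℂ) (τ : ℝ) : ℂ := limUnder atTop (truncInt n c f τ)

theorem Admissible.norm_truncInt_sub_le {n : ℕ} {f : ℝ → ℂ} (hf : Admissible n f) :
    ∃ C, 0 ≤ C ∧ ∀ c : ℝ, |c| = 1 → ∀ τ, 0 < τ → ∀ A R, 1 ≤ A → A ≤ R →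
      ‖truncInt n c f τ R - truncInt n c f τ A‖ ≤ C * ((1 + 1 / τ) / A) := by
  obtain ⟨C, hC, h⟩ := hf.osc_nonneg
  refine ⟨C, hC, fun c hc τ hτ A R hA hR => ?_⟩
  unfold truncInt
  rw [intervalIntegral.integral_interval_sub_left (hf.intervalIntegrable c τ le_rfl (by linarith))
    (hf.intervalIntegrable c τ le_rfl (by linarith))]
  exact h c hc τ hτ A R hA hR

/-- Absolute convergence is not available; the `osc` bound makes the truncations a Cauchy family. -/
theorem Admissible.tendsto_truncInt {n : ℕ} {f : ℝ → ℂ} (hf : Admissible n f) {c : ℝ}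
    (hc : |c| = 1) {τ : ℝ} (hτ : 0 < τ) :
    Tendsto (truncInt n c f τ) atTop (𝓝 (improperInt n c f τ)) := by
  obtain ⟨C, hC, h⟩ := hf.norm_truncInt_sub_le
  refine tendsto_nhds_limUnder (cauchySeq_tendsto_of_complete ?_)
  have hlim : Tendsto (fun A : ℝ => C * ((1 + 1 / τ) / A)) atTop (𝓝 0) := by
    simpa using (tendsto_const_nhds.div_atTop tendsto_id : Tendsto (fun A : ℝ => (1 + 1 / τ) / A)
      atTop (𝓝 0)).const_mul C
  refine Metric.cauchySeq_iff'.mpr fun ε hε => ?_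
  obtain ⟨A, hA1, hA2⟩ := ((eventually_ge_atTop (1 : ℝ)).and
    (hlim.eventually (gt_mem_nhds hε))).exists
  refine ⟨A, fun R hR => ?_⟩
  rw [dist_eq_norm]
  exact (h c hc τ hτ A R hA1 hR).trans_lt hA2

theorem Admissible.norm_improperInt_sub_le {n : ℕ} {f : ℝ → ℂ} (hf : Admissible n f) :
    ∃ C, 0 ≤ C ∧ ∀ c : ℝ, |c| = 1 → ∀ τ, 0 < τ → ∀ A, 1 ≤ A →
      ‖improperInt n c f τ - truncInt n c f τ A‖ ≤ C * ((1 + 1 / τ) / A) := by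
  obtain ⟨C, hC, h⟩ := hf.norm_truncInt_sub_le
  refine ⟨C, hC, fun c hc τ hτ A hA => ?_⟩
  have := ((hf.tendsto_truncInt hc hτ).sub_const (truncInt n c f τ A)).norm
  refine le_of_tendsto this ?_
  filter_upwards [eventually_ge_atTop A] with R hR
  exact h c hc τ hτ A R hA hR

theorem Admissible.continuous_truncInt {n : ℕ} {f : ℝ → ℂ} (hf : Admissible n f) (c : ℝ) {R : ℝ}
    (hR : 0 ≤ R) : Continuous fun τ => truncInt n c f τ R := by
  -- Since `f` is continuous on `[0, ∞)` only, `r` is replaced by `max r 0`, which changes nothing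
  -- on `[0, R]` and makes the integrand continuous on the plane.
  have e : (fun τ => truncInt n c f τ R) =
      fun τ => ∫ r in (0 : ℝ)..R, f (max r 0) * phase n c τ r := by
    funext τ
    unfold truncInt
    apply intervalIntegral.integral_congr
    intro r hr
    rw [uIcc_of_le hR] at hr
    simp only [max_eq_left hr.1]
  rw [e]
  apply intervalIntegral.continuous_parametric_intervalIntegral_of_continuous'
  refine Continuous.mul ?_ (continuous_phase n c)
  exact (hf.continuousOn.comp_continuous (f := fun p : ℝ × ℝ => max p.2 0) (by fun_prop)
    fun x => mem_Ici.mpr (le_max_right _ _))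

/-- The tail bound contains `1 / τ`, so the truncations converge uniformly on each half-line `τ > x
/ 2`, but not up to `τ = 0`. -/
theorem Admissible.continuousOn_improperInt {n : ℕ} {f : ℝ → ℂ} (hf : Admissible n f) {c : ℝ}
    (hc : |c| = 1) : ContinuousOn (improperInt n c f) (Ioi 0) := by
  obtain ⟨C, hC, h⟩ := hf.norm_improperInt_sub_le
  have hloc : TendstoLocallyUniformlyOn (fun R τ => truncInt n c f τ R) (improperInt n c f) atTop
      (Ioi 0) := by
    rw [Metric.tendstoLocallyUniformlyOn_iff]
    intro ε hε x hx
    have hx : 0 < x := hx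
    refine ⟨Ioi (x / 2), mem_nhdsWithin_of_mem_nhds (Ioi_mem_nhds (by linarith)), ?_⟩
    have hlim : Tendsto (fun A : ℝ => C * ((1 + 1 / (x / 2)) / A)) atTop (𝓝 0) := by
      simpa using (tendsto_const_nhds.div_atTop tendsto_id :
        Tendsto (fun A : ℝ => (1 + 1 / (x / 2)) / A) atTop (𝓝 0)).const_mul C
    filter_upwards [eventually_ge_atTop (1 : ℝ), hlim.eventually (gt_mem_nhds hε)] with A hA hA2 y hy
    have hy : x / 2 < y := hy
    rw [dist_eq_norm]
    refine (h c hc y (by linarith) A hA).trans_lt (lt_of_le_of_lt ?_ hA2)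
    have : 1 / y ≤ 1 / (x / 2) := one_div_le_one_div_of_le (by linarith) hy.le
    gcongr
  refine hloc.continuousOn (Eventually.frequently ?_)
  filter_upwards [eventually_ge_atTop (0 : ℝ)] with R hR
  exact (hf.continuous_truncInt c hR).continuousOn

/-- A bound for the truncated integrals which is uniform in the truncation and integrable at
`τ = 0`. -/
theorem Admissible.norm_truncInt_le {n : ℕ} (hn : 2 ≤ n) {f : ℝ → ℂ} (hf : Admissible n f) :
    ∃ C, 0 ≤ C ∧ ∀ c : ℝ, |c| = 1 → ∀ τ, 0 < τ → ∀ R, 0 ≤ R →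
      ‖truncInt n c f τ R‖ ≤ C * (1 + τ ^ (1 / (n : ℝ) - 1)) := by
  obtain ⟨C, hC, hg⟩ := hf.growth_nonneg
  obtain ⟨D, hD, ho⟩ := hf.norm_truncInt_sub_le
  have hn0 : (0 : ℝ) < n := by positivity
  have triv : ∀ c τ B R : ℝ, 0 ≤ R → R ≤ B → 1 ≤ B →
      ‖truncInt n c f τ R‖ ≤ C * 2 ^ (n - 2) * B ^ (n - 1) := by
    intro c τ B R hR hRB hB
    unfold truncInt
    have : ∀ r ∈ uIoc 0 R, ‖f r * phase n c τ r‖ ≤ C * 2 ^ (n - 2) * B ^ (n - 2) := by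
      intro r hr
      rw [uIoc_of_le hR] at hr
      rw [norm_mul, norm_phase, mul_one]
      refine (hg r hr.1.le).trans ?_
      rw [mul_assoc, ← mul_pow]
      have := hr.1
      have : 1 + r ≤ 2 * B := by linarith [hr.2]
      gcongr
    refine (intervalIntegral.norm_integral_le_of_norm_le_const this).trans ?_
    rw [sub_zero, abs_of_nonneg hR]
    have e : n - 1 = (n - 2) + 1 := by omega
    rw [e, pow_succ, ← mul_assoc]
    gcongr
  refine ⟨C * 2 ^ (n - 2) + 2 * D, by positivity, fun c hc τ hτ R hR => ?_⟩
  have hP : 0 < τ ^ (1 / (n : ℝ) - 1) := Real.rpow_pos_of_pos hτ _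
  set P := τ ^ (1 / (n : ℝ) - 1)
  rcases le_or_gt 1 τ with h1 | h1
  · have hle : 1 + 1 / τ ≤ 2 := by
      have : 1 / τ ≤ 1 := by rw [div_le_one hτ]; exact h1
      linarith
    have key : ‖truncInt n c f τ R‖ ≤ C * 2 ^ (n - 2) + 2 * D := by
      rcases le_or_gt R 1 with hR1 | hR1
      · have := triv c τ 1 R hR hR1 le_rfl
        rw [one_pow, mul_one] at this
        linarith
      · have a1 := ho c hc τ hτ 1 R le_rfl hR1.le
        have a2 := triv c τ 1 1 zero_le_one le_rfl le_rfl
        rw [one_pow, mul_one] at a2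
        rw [div_one] at a1
        have a3 := norm_add_le (truncInt n c f τ R - truncInt n c f τ 1) (truncInt n c f τ 1)
        rw [sub_add_cancel] at a3
        nlinarith
    refine key.trans ?_
    have : 0 ≤ C * 2 ^ (n - 2) + 2 * D := by positivity
    nlinarith
  -- The cut is made where the phase `rⁿ τ` has size one. Below `B` absolute values give `B^{n-1} =
  -- τ^{1/n-1}`; beyond `B` the oscillation gives `(1 + 1/τ) / B`, of the same order for `τ < 1`.
  · set B := τ ^ (-(1 / (n : ℝ))) with hB
    have hBpos : 0 < B := Real.rpow_pos_of_pos hτ _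
    have hB1 : 1 ≤ B := by
      apply Real.one_le_rpow_of_pos_of_le_one_of_nonpos hτ h1.le
      have : 0 < 1 / (n : ℝ) := by positivity
      linarith
    have hBP : B ^ (n - 1) = P := by
      rw [hB, ← Real.rpow_natCast, ← Real.rpow_mul hτ.le]
      congr 1
      rw [Nat.cast_sub (by omega)]
      field_simp
      push_cast
      ring
    have hτB : (1 + 1 / τ) / B ≤ 2 * P := by
      have e1 : P = 1 / τ / B := by
        rw [hB, Real.rpow_neg hτ.le, div_inv_eq_mul]
        simp only [P]
        rw [Real.rpow_sub hτ, Real.rpow_one]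
        ring
      have : 1 ≤ 1 / τ := by rw [le_div_iff₀ hτ]; linarith
      rw [e1, ← mul_div_assoc]
      gcongr
      linarith
    have key : ‖truncInt n c f τ R‖ ≤ C * 2 ^ (n - 2) * P + 2 * D * P := by
      rcases le_or_gt R B with hR1 | hR1
      · have := triv c τ B R hR hR1 hB1
        rw [hBP] at this
        have : 0 ≤ 2 * D * P := by positivity
        linarith
      · have a1 := ho c hc τ hτ B R hB1 hR1.le
        have a2 := triv c τ B B hBpos.le le_rfl hB1
        rw [hBP] at a2
        have a3 := norm_add_le (truncInt n c f τ R - truncInt n c f τ B) (truncInt n c f τ B)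
        rw [sub_add_cancel] at a3
        have := mul_le_mul_of_nonneg_left hτB hD
        linarith
    refine key.trans ?_
    have : 0 ≤ C * 2 ^ (n - 2) + 2 * D := by positivity
    nlinarith

/-! ### Laplace transforms of the oscillatory integrals -/

theorem intervalIntegral_swap_of_continuous {f : ℝ → ℝ → ℂ}
    (hf : Continuous (Function.uncurry f)) {a b c d : ℝ} (hab : a ≤ b) (hcd : c ≤ d) :
    ∫ x in a..b, ∫ y in c..d, f x y = ∫ y in c..d, ∫ x in a..b, f x y := by
  simp_rw [intervalIntegral.integral_of_le hab, intervalIntegral.integral_of_le hcd]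
  apply integral_integral_swap
  rw [Measure.prod_restrict]
  exact (hf.continuousOn.integrableOn_compact (isCompact_Icc.prod isCompact_Icc)).mono_set
    (prod_mono Ioc_subset_Icc_self Ioc_subset_Icc_self)

/-- The real part of the resolvent denominator is `s ≥ 1` and its imaginary part has modulus `rⁿ`;
the constant `2ⁿ` comes from `1 + r ≤ 2 max(1, r)`. -/
theorem one_add_pow_le_norm_resolvent {c : ℝ} (hc : |c| = 1) (n : ℕ) {s r : ℝ} (hs : 1 ≤ s)
    (hr : 0 ≤ r) : (1 + r) ^ n ≤ 2 ^ n * ‖(s : ℂ) - ((c * r ^ n : ℝ) : ℂ) * Complex.I‖ := by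
  have h1 := Complex.abs_re_le_norm ((s : ℂ) - ((c * r ^ n : ℝ) : ℂ) * Complex.I)
  have h2 := Complex.abs_im_le_norm ((s : ℂ) - ((c * r ^ n : ℝ) : ℂ) * Complex.I)
  rw [Complex.sub_re, Complex.re_ofReal_mul, Complex.I_re, mul_zero, sub_zero, Complex.ofReal_re,
    abs_of_nonneg (by linarith)] at h1
  rw [Complex.sub_im, Complex.im_ofReal_mul, Complex.I_im, mul_one, Complex.ofReal_im, zero_sub,
    abs_neg, abs_mul, hc, one_mul, abs_of_nonneg (by positivity)] at h2
  rcases le_total r 1 with h | h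
  · calc (1 + r) ^ n ≤ 2 ^ n := by gcongr; linarith
      _ = 2 ^ n * 1 := (mul_one _).symm
      _ ≤ _ := by gcongr; linarith
  · calc (1 + r) ^ n ≤ (2 * r) ^ n := by gcongr; linarith
      _ = 2 ^ n * r ^ n := mul_pow _ _ _
      _ ≤ _ := by gcongr

theorem resolvent_ne_zero (c : ℝ) (n : ℕ) {s : ℝ} (r : ℝ) (hs : 1 ≤ s) :
    (s : ℂ) - ((c * r ^ n : ℝ) : ℂ) * Complex.I ≠ 0 := by
  intro h
  have := congrArg Complex.re h
  rw [Complex.sub_re, Complex.re_ofReal_mul, Complex.I_re, mul_zero, sub_zero, Complex.ofReal_re,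
    Complex.zero_re] at this
  linarith

/-- Growth of order `n - 2` against a denominator of order `n` leaves an integrable `(1 + r²)⁻¹`:
after the Laplace transform the ray integrals converge absolutely. -/
theorem norm_div_resolvent_le {n : ℕ} (hn : 2 ≤ n) {c : ℝ} (hc : |c| = 1) {s r C : ℝ} (hs : 1 ≤ s)
    (hr : 0 ≤ r) {z : ℂ} (hz : ‖z‖ ≤ C * (1 + r) ^ (n - 2)) :
    ‖z / ((s : ℂ) - ((c * r ^ n : ℝ) : ℂ) * Complex.I)‖ ≤ C * 2 ^ n * (1 + r ^ 2)⁻¹ := by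
  have h := one_add_pow_le_norm_resolvent hc n hs hr
  have hpos := norm_pos_iff.mpr (resolvent_ne_zero c n r hs)
  have hC : 0 ≤ C := by
    by_contra hC
    have : C * (1 + r) ^ (n - 2) < 0 := mul_neg_of_neg_of_pos (not_le.mp hC) (by positivity)
    linarith [norm_nonneg z]
  rw [norm_div, div_le_iff₀ hpos]
  set D := ‖(s : ℂ) - ((c * r ^ n : ℝ) : ℂ) * Complex.I‖
  have e : (1 + r) ^ n = (1 + r) ^ (n - 2) * (1 + r) ^ 2 := by
    rw [← pow_add]; congr 1; omega
  have e3 : (1 + r) ^ (n - 2) * (1 + r ^ 2) ≤ 2 ^ n * D := by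
    refine le_trans ?_ h
    rw [e]
    gcongr
    nlinarith
  refine hz.trans ?_
  rw [mul_assoc, mul_assoc]
  gcongr
  rw [mul_left_comm, ← div_eq_inv_mul, le_div_iff₀ (by positivity)]
  exact e3

theorem Admissible.integrableOn_div_resolvent {n : ℕ} (hn : 2 ≤ n) {f : ℝ → ℂ}
    (hf : ContinuousOn f (Ici 0)) {C : ℝ} (hg : ∀ r, 0 ≤ r → ‖f r‖ ≤ C * (1 + r) ^ (n - 2)) {c : ℝ}
    (hc : |c| = 1) {s : ℝ} (hs : 1 ≤ s) :
    IntegrableOn (fun r => f r / ((s : ℂ) - ((c * r ^ n : ℝ) : ℂ) * Complex.I)) (Ioi 0) := by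
  refine Integrable.mono' ((integrable_inv_one_add_sq.const_mul (C * 2 ^ n)).integrableOn) ?_ ?_
  · refine ContinuousOn.aestronglyMeasurable ?_ measurableSet_Ioi
    exact (hf.mono Ioi_subset_Ici_self).div (by fun_prop) fun r _ => resolvent_ne_zero c n r hs
  · refine (ae_restrict_iff' measurableSet_Ioi).mpr (Eventually.of_forall fun r hr => ?_)
    exact norm_div_resolvent_le hn hc hs (le_of_lt hr) (hg r (le_of_lt hr))

theorem exp_mul_phase_eq (n : ℕ) (c s τ r : ℝ) :
    (Real.exp (-(s * τ)) : ℂ) * phase n c τ r =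
      Complex.exp (-((s : ℂ) - ((c * r ^ n : ℝ) : ℂ) * Complex.I) * τ) := by
  unfold phase
  rw [Complex.ofReal_exp, ← Complex.exp_add]
  congr 1
  push_cast
  ring

theorem integral_exp_mul_phase (n : ℕ) (c : ℝ) {s : ℝ} (hs : 1 ≤ s) (r t : ℝ) :
    ∫ τ in (0 : ℝ)..t, (Real.exp (-(s * τ)) : ℂ) * phase n c τ r =
      (1 - Real.exp (-(s * t)) * phase n c t r) /
        ((s : ℂ) - ((c * r ^ n : ℝ) : ℂ) * Complex.I) := by
  have h0 := resolvent_ne_zero c n r hs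
  simp_rw [exp_mul_phase_eq]
  rw [integral_exp_mul_complex (neg_ne_zero.mpr h0), Complex.ofReal_zero, mul_zero,
    Complex.exp_zero, div_neg, ← neg_div, neg_sub]

/-- Fubini on a compact rectangle. The time integral of the exponential is explicit, and its
endpoint `τ = t` produces the term with `e^{-st}`. -/
theorem Admissible.integral_exp_mul_truncInt {n : ℕ} {f : ℝ → ℂ} (hf : Admissible n f) (c : ℝ)
    {s : ℝ} (hs : 1 ≤ s) {t R : ℝ} (ht : 0 ≤ t) (hR : 0 ≤ R) :
    ∫ τ in (0 : ℝ)..t, (Real.exp (-(s * τ)) : ℂ) * truncInt n c f τ R =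
      ∫ r in (0 : ℝ)..R, (f r - Real.exp (-(s * t)) * (f r * phase n c t r)) /
        ((s : ℂ) - ((c * r ^ n : ℝ) : ℂ) * Complex.I) := by
  have e1 : ∀ τ : ℝ, (Real.exp (-(s * τ)) : ℂ) * truncInt n c f τ R =
      ∫ r in (0 : ℝ)..R, f (max r 0) * ((Real.exp (-(s * τ)) : ℂ) * phase n c τ r) := by
    intro τ
    unfold truncInt
    rw [← intervalIntegral.integral_const_mul]
    apply intervalIntegral.integral_congr
    intro r hr
    rw [uIcc_of_le hR] at hr
    simp only [max_eq_left hr.1]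
    ring
  simp_rw [e1]
  rw [intervalIntegral_swap_of_continuous _ ht hR]
  · apply intervalIntegral.integral_congr
    intro r hr
    rw [uIcc_of_le hR] at hr
    simp only [max_eq_left hr.1]
    rw [intervalIntegral.integral_const_mul, integral_exp_mul_phase n c hs]
    ring
  · have h1 : Continuous fun p : ℝ × ℝ => f (max p.2 0) :=
      hf.continuousOn.comp_continuous (by fun_prop) fun x => mem_Ici.mpr (le_max_right _ _)
    have h2 := continuous_phase n c
    have h3 : Continuous fun p : ℝ × ℝ => (Real.exp (-(s * p.1)) : ℂ) := by fun_prop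
    exact h1.mul (h3.mul h2)

theorem intervalIntegrable_laplace_bound {n : ℕ} (hn : 2 ≤ n) (C t : ℝ) :
    IntervalIntegrable (fun τ : ℝ => C * (1 + τ ^ (1 / (n : ℝ) - 1))) volume 0 t := by
  refine (IntervalIntegrable.add (intervalIntegrable_const) ?_).const_mul C
  apply intervalIntegral.intervalIntegrable_rpow'
  have : 0 < 1 / (n : ℝ) := by positivity
  linarith

theorem Admissible.norm_improperInt_le {n : ℕ} (hn : 2 ≤ n) {f : ℝ → ℂ} (hf : Admissible n f) :
    ∃ C, 0 ≤ C ∧ ∀ c : ℝ, |c| = 1 → ∀ τ, 0 < τ →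
      ‖improperInt n c f τ‖ ≤ C * (1 + τ ^ (1 / (n : ℝ) - 1)) := by
  obtain ⟨C, hC, h⟩ := hf.norm_truncInt_le hn
  refine ⟨C, hC, fun c hc τ hτ => ?_⟩
  refine le_of_tendsto (hf.tendsto_truncInt hc hτ).norm ?_
  filter_upwards [eventually_ge_atTop (0 : ℝ)] with R hR
  exact h c hc τ hτ R hR

theorem Admissible.intervalIntegrable_improperInt {n : ℕ} (hn : 2 ≤ n) {f : ℝ → ℂ}
    (hf : Admissible n f) {c : ℝ} (hc : |c| = 1) {t : ℝ} (ht : 0 ≤ t) :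
    IntervalIntegrable (improperInt n c f) volume 0 t := by
  obtain ⟨C, hC, h⟩ := hf.norm_improperInt_le hn
  refine (intervalIntegrable_laplace_bound hn C t).mono_fun' ?_ ?_
  · rw [uIoc_of_le ht]
    exact ((hf.continuousOn_improperInt hc).mono fun x hx => hx.1).aestronglyMeasurable
      measurableSet_Ioc
  · rw [uIoc_of_le ht]
    exact (ae_restrict_iff' measurableSet_Ioc).mpr (Eventually.of_forall fun τ hτ => h c hc τ hτ.1)

/-- Dominated convergence: the majorant `1 + τ^{1/n-1}` does not depend on the truncation and is
integrable at `0`. -/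
theorem Admissible.tendsto_integral_exp_mul_truncInt {n : ℕ} (hn : 2 ≤ n) {f : ℝ → ℂ}
    (hf : Admissible n f) {c : ℝ} (hc : |c| = 1) {s : ℝ} (hs : 1 ≤ s) {t : ℝ} (ht : 0 ≤ t) :
    Tendsto (fun R => ∫ τ in (0 : ℝ)..t, (Real.exp (-(s * τ)) : ℂ) * truncInt n c f τ R) atTop
      (𝓝 (∫ τ in (0 : ℝ)..t, (Real.exp (-(s * τ)) : ℂ) * improperInt n c f τ)) := by
  obtain ⟨C, hC, h⟩ := hf.norm_truncInt_le hn
  apply intervalIntegral.tendsto_integral_filter_of_dominated_convergence _ _ _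
    (intervalIntegrable_laplace_bound hn C t)
  · refine Eventually.of_forall fun τ hτ => ?_
    rw [uIoc_of_le ht] at hτ
    exact (hf.tendsto_truncInt hc hτ.1).const_mul _
  · filter_upwards [eventually_ge_atTop (0 : ℝ)] with R hR
    exact (Continuous.mul (by fun_prop) (hf.continuous_truncInt c hR)).aestronglyMeasurable
  · filter_upwards [eventually_ge_atTop (0 : ℝ)] with R hR
    refine Eventually.of_forall fun τ hτ => ?_
    rw [uIoc_of_le ht] at hτ
    rw [norm_mul, Complex.norm_real, Real.norm_of_nonneg (Real.exp_pos _).le]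
    have h1 : Real.exp (-(s * τ)) ≤ 1 := by
      rw [Real.exp_le_one_iff]
      have := hτ.1
      have : 0 ≤ s * τ := by positivity
      linarith
    calc _ ≤ 1 * ‖truncInt n c f τ R‖ := by gcongr
      _ ≤ _ := by rw [one_mul]; exact h c hc τ hτ.1 R hR

/-- The truncated Laplace transform of the improper integral, up to an error `O(e^{-st})`. -/
theorem Admissible.laplace_improperInt {n : ℕ} (hn : 2 ≤ n) {f : ℝ → ℂ} (hf : Admissible n f)
    {c : ℝ} (hc : |c| = 1) {t : ℝ} (ht : 0 ≤ t) :
    ∃ K, ∀ s : ℝ, 1 ≤ s →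
      ‖(∫ τ in (0 : ℝ)..t, (Real.exp (-(s * τ)) : ℂ) * improperInt n c f τ) -
        ∫ r in Ioi (0 : ℝ), f r / ((s : ℂ) - ((c * r ^ n : ℝ) : ℂ) * Complex.I)‖ ≤
        K * Real.exp (-(s * t)) := by
  obtain ⟨C, hC, hg⟩ := hf.growth_nonneg
  have hg' : ∀ r, 0 ≤ r → ‖f r * phase n c t r‖ ≤ C * (1 + r) ^ (n - 2) := by
    intro r hr
    rw [norm_mul, norm_phase, mul_one]
    exact hg r hr
  have hcont' : ContinuousOn (fun r => f r * phase n c t r) (Ici 0) :=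
    hf.continuousOn.mul (continuous_phase_right n c t).continuousOn
  refine ⟨∫ r in Ioi (0 : ℝ), C * 2 ^ n * (1 + r ^ 2)⁻¹, fun s hs => ?_⟩
  have i1 := Admissible.integrableOn_div_resolvent hn hf.continuousOn hg hc hs
  have i2 := (Admissible.integrableOn_div_resolvent hn hcont' hg' hc hs).const_mul
    (Real.exp (-(s * t)) : ℂ)
  have hlim := hf.tendsto_integral_exp_mul_truncInt hn hc hs ht
  have hlim2 := intervalIntegral_tendsto_integral_Ioi 0 (i1.sub i2) tendsto_id
  have heq := tendsto_nhds_unique hlim (hlim2.congr' (by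
    filter_upwards [eventually_ge_atTop (0 : ℝ)] with R hR
    rw [hf.integral_exp_mul_truncInt c hs ht hR]
    apply intervalIntegral.integral_congr
    intro r _
    simp only [Pi.sub_apply]
    ring))
  rw [heq]
  simp only [Pi.sub_apply]
  -- The difference is exactly the endpoint term `e^{-st} ∫ f(r) e^{i c rⁿ t} / (s - i c rⁿ) dr`,
  -- whose integral is bounded uniformly in `s ≥ 1`.
  rw [integral_sub i1 i2, sub_sub_cancel_left, norm_neg, integral_const_mul, norm_mul,
    Complex.norm_real, Real.norm_of_nonneg (Real.exp_pos _).le, mul_comm]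
  gcongr
  refine norm_integral_le_of_norm_le (integrable_inv_one_add_sq.const_mul _).integrableOn ?_
  refine (ae_restrict_iff' measurableSet_Ioi).mpr (Eventually.of_forall fun r hr => ?_)
  exact norm_div_resolvent_le hn hc hs (le_of_lt hr) (hg' r (le_of_lt hr))

/-! ### Cauchy's formula in a strip and in a sector -/

theorem integrable_exp_neg_mul_abs {δ : ℝ} (hδ : 0 < δ) :
    Integrable fun x : ℝ => Real.exp (-(δ * |x|)) := by
  have h1 : IntegrableOn (fun x : ℝ => Real.exp (-(δ * |x|))) (Ioi 0) := by
    refine (integrableOn_exp_mul_Ioi (neg_lt_zero.mpr hδ) 0).congr_fun (fun x hx => ?_)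
      measurableSet_Ioi
    simp only [abs_of_pos (mem_Ioi.mp hx), neg_mul]
  have h2 : IntegrableOn (fun x : ℝ => Real.exp (-(δ * |x|))) (Iic 0) := by
    refine (integrableOn_exp_mul_Iic hδ 0).congr_fun (fun x hx => ?_) measurableSet_Iic
    simp only [abs_of_nonpos (mem_Iic.mp hx)]
    congr 1; ring
  rw [← integrableOn_univ, ← Iic_union_Ioi (a := (0 : ℝ))]
  exact h2.union h1

/-- The closed strip `|Im w| ≤ π / 2`. -/
def closedStrip : Set ℂ := {w | w.im ∈ Icc (-(Real.pi / 2)) (Real.pi / 2)}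

/-- The open strip `|Im w| < π / 2`. -/
def openStrip : Set ℂ := {w | w.im ∈ Ioo (-(Real.pi / 2)) (Real.pi / 2)}

theorem isOpen_openStrip : IsOpen openStrip := isOpen_Ioo.preimage Complex.continuous_im

theorem openStrip_subset_closedStrip : openStrip ⊆ closedStrip :=
  fun _ hw => Ioo_subset_Icc_self hw

theorem zero_mem_openStrip : (0 : ℂ) ∈ openStrip := by
  have := Real.pi_pos
  simp only [openStrip, mem_ofPred_eq, Complex.zero_im, mem_Ioo]
  constructor <;> linarith

/-- The solutions of `e^w = 1` are spaced by `2πi`, while the strip has half-height `π / 2`. Thus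
`0` is the only pole of `1 / (1 - e^w)` there. -/
theorem exp_ne_one_of_mem_closedStrip {w : ℂ} (hw : w ∈ closedStrip) (h0 : w ≠ 0) :
    Complex.exp w ≠ 1 := by
  intro h
  obtain ⟨k, hk⟩ := Complex.exp_eq_one_iff.mp h
  have him : w.im = k * (2 * Real.pi) := by
    rw [hk]; simp
  have hpi := Real.pi_pos
  have h1 : -(Real.pi / 2) ≤ w.im := hw.1
  have h2 : w.im ≤ Real.pi / 2 := hw.2
  rw [him] at h1 h2
  have hk0 : k = 0 := by
    have l1 : (-1 : ℝ) < k := by nlinarith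
    have l2 : (k : ℝ) < 1 := by nlinarith
    have l1' : (-1 : ℤ) < k := by exact_mod_cast l1
    have l2' : k < (1 : ℤ) := by exact_mod_cast l2
    omega
  apply h0
  rw [hk, hk0]; simp

theorem dslope_exp_zero_ne_zero {w : ℂ} (hw : w ∈ closedStrip) : dslope Complex.exp 0 w ≠ 0 := by
  rcases eq_or_ne w 0 with rfl | h0
  · rw [dslope_same, Complex.deriv_exp, Complex.exp_zero]; exact one_ne_zero
  · rw [dslope_of_ne _ h0, slope_def_field, Complex.exp_zero, sub_zero]
    exact div_ne_zero (sub_ne_zero.mpr (exp_ne_one_of_mem_closedStrip hw h0)) h0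

/-- On the edges of the strip `e^w` is purely imaginary, so the real and imaginary parts of `1 -
e^w` have moduli `1` and `e^{Re w}`. -/
theorem max_one_exp_le_norm_of_abs_im {w : ℂ} (hw : |w.im| = Real.pi / 2) :
    max 1 (Real.exp w.re) ≤ ‖1 - Complex.exp w‖ := by
  have hcos : Real.cos w.im = 0 := by rw [← Real.cos_abs, hw, Real.cos_pi_div_two]
  have hsin : |Real.sin w.im| = 1 := by
    have := Real.sin_sq_add_cos_sq w.im
    rw [hcos] at this
    have h2 : Real.sin w.im ^ 2 = 1 := by linarith
    rwa [← sq_abs, pow_eq_one_iff_of_nonneg (abs_nonneg _) two_ne_zero] at h2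
  have h1 := Complex.abs_re_le_norm (1 - Complex.exp w)
  have h2 := Complex.abs_im_le_norm (1 - Complex.exp w)
  rw [Complex.sub_re, Complex.exp_re, hcos, mul_zero, sub_zero, Complex.one_re, abs_one] at h1
  rw [Complex.sub_im, Complex.exp_im, Complex.one_im, zero_sub, abs_neg, abs_mul, hsin, mul_one,
    abs_of_pos (Real.exp_pos _)] at h2
  exact max_le h1 h2

/-- Used on the vertical sides of the rectangles: at distance one from the imaginary axis `|e^w|` is
at most `1/2` or at least `2`. -/
theorem max_one_exp_le_norm_of_abs_re {w : ℂ} (hw : 1 ≤ |w.re|) :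
    max 1 (Real.exp w.re) ≤ 2 * ‖1 - Complex.exp w‖ := by
  have h := abs_norm_sub_norm_le (1 : ℂ) (Complex.exp w)
  rw [norm_one, Complex.norm_exp] at h
  have he : 2 ≤ Real.exp 1 := by linarith [Real.add_one_le_exp (1 : ℝ)]
  rcases le_abs'.mp hw with h1 | h1
  · have h2 : Real.exp w.re ≤ 1 / 2 := by
      have : Real.exp w.re ≤ Real.exp (-1) := Real.exp_le_exp.mpr h1
      rw [Real.exp_neg] at this
      refine this.trans ?_
      rw [one_div]
      exact inv_anti₀ (by norm_num) he
    have h3 := le_abs_self (1 - Real.exp w.re)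
    apply max_le <;> linarith
  · have h2 : 2 ≤ Real.exp w.re := he.trans (Real.exp_le_exp.mpr h1)
    have h3 := neg_le_abs (1 - Real.exp w.re)
    apply max_le <;> linarith

/-- The growth condition in the strip under which `f / (1 - e^w)` decays exponentially. -/
def StripBound (f : ℂ → ℂ) (C δ : ℝ) : Prop :=
  ∀ w ∈ closedStrip, ‖f w‖ ≤ C * Real.exp (-(δ * |w.re|)) * max 1 (Real.exp w.re)

theorem mem_closedStrip_line {σ : ℝ} (hσ : |σ| = 1) (x : ℝ) :
    (x : ℂ) + ((σ * (Real.pi / 2) : ℝ) : ℂ) * Complex.I ∈ closedStrip := by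
  have hpi := Real.pi_pos
  simp only [closedStrip, mem_ofPred_eq, Complex.add_im, Complex.ofReal_im,
    Complex.im_ofReal_mul, Complex.I_im, mul_one, zero_add]
  rcases eq_or_eq_neg_of_abs_eq hσ with rfl | rfl <;> constructor <;> linarith

theorem StripBound.norm_div_line_le {f : ℂ → ℂ} {C δ : ℝ} (hb : StripBound f C δ) {σ : ℝ}
    (hσ : |σ| = 1) (x : ℝ) :
    ‖f (x + ((σ * (Real.pi / 2) : ℝ) : ℂ) * Complex.I) /
      (1 - Complex.exp (x + ((σ * (Real.pi / 2) : ℝ) : ℂ) * Complex.I))‖ ≤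
      C * Real.exp (-(δ * |x|)) := by
  set w : ℂ := x + ((σ * (Real.pi / 2) : ℝ) : ℂ) * Complex.I with hw
  have hre : w.re = x := by simp [hw]
  have him : w.im = σ * (Real.pi / 2) := by simp [hw]
  have hmem : w ∈ closedStrip := mem_closedStrip_line hσ x
  have h1 := hb w hmem
  have h2 := max_one_exp_le_norm_of_abs_im (w := w)
    (by rw [him, abs_mul, hσ, one_mul, abs_of_pos (by positivity)])
  have hm : 0 < max 1 (Real.exp w.re) := lt_of_lt_of_le one_pos (le_max_left _ _)
  rw [norm_div, div_le_iff₀ (by linarith)]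
  rw [hre] at *
  have hC : 0 ≤ C * Real.exp (-(δ * |x|)) := by
    by_contra hneg
    have := mul_neg_of_neg_of_pos (not_le.mp hneg) hm
    linarith [norm_nonneg (f w)]
  exact h1.trans (mul_le_mul_of_nonneg_left h2 hC)

theorem StripBound.integrable_line {f : ℂ → ℂ} {C δ : ℝ} (hδ : 0 < δ)
    (hc : ContinuousOn f closedStrip) (hb : StripBound f C δ) {σ : ℝ} (hσ : |σ| = 1) :
    Integrable fun x : ℝ => f (x + ((σ * (Real.pi / 2) : ℝ) : ℂ) * Complex.I) /
      (1 - Complex.exp (x + ((σ * (Real.pi / 2) : ℝ) : ℂ) * Complex.I)) := by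
  refine ((integrable_exp_neg_mul_abs hδ).const_mul C).mono' (Continuous.aestronglyMeasurable ?_)
    (Eventually.of_forall fun x => hb.norm_div_line_le hσ x)
  refine Continuous.div ?_ (by fun_prop) fun x => ?_
  · exact hc.comp_continuous (by fun_prop) (mem_closedStrip_line hσ)
  · rw [sub_ne_zero]
    refine (exp_ne_one_of_mem_closedStrip (mem_closedStrip_line hσ x) ?_).symm
    intro h0
    have := congrArg Complex.im h0
    have hpi := Real.pi_pos
    rcases eq_or_eq_neg_of_abs_eq hσ with rfl | rfl <;> simp at this

theorem StripBound.norm_div_vertical_le {f : ℂ → ℂ} {C δ : ℝ} (hb : StripBound f C δ) {w : ℂ}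
    (hw : w ∈ closedStrip) (hre : 1 ≤ |w.re|) :
    ‖f w / (1 - Complex.exp w)‖ ≤ 2 * C * Real.exp (-(δ * |w.re|)) := by
  have h1 := hb w hw
  have h2 := max_one_exp_le_norm_of_abs_re hre
  have hm : 0 < max 1 (Real.exp w.re) := lt_of_lt_of_le one_pos (le_max_left _ _)
  have hC : 0 ≤ C * Real.exp (-(δ * |w.re|)) := by
    by_contra hneg
    have := mul_neg_of_neg_of_pos (not_le.mp hneg) hm
    linarith [norm_nonneg (f w)]
  rw [norm_div, div_le_iff₀ (by linarith)]
  have := mul_le_mul_of_nonneg_left h2 hC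
  linarith

/-- Cauchy's theorem for `f(w) / (1 - e^w)` in the strip, when `f` vanishes at the pole. -/
theorem strip_integral_eq_of_apply_zero {f : ℂ → ℂ} {C δ : ℝ} (hδ : 0 < δ)
    (hc : ContinuousOn f closedStrip) (hd : DifferentiableOn ℂ f openStrip)
    (hb : StripBound f C δ) (h0 : f 0 = 0) :
    ∫ x : ℝ, f (x + ((-1 * (Real.pi / 2) : ℝ) : ℂ) * Complex.I) /
        (1 - Complex.exp (x + ((-1 * (Real.pi / 2) : ℝ) : ℂ) * Complex.I)) =
      ∫ x : ℝ, f (x + ((1 * (Real.pi / 2) : ℝ) : ℂ) * Complex.I) /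
        (1 - Complex.exp (x + ((1 * (Real.pi / 2) : ℝ) : ℂ) * Complex.I)) := by
  have hpi := Real.pi_pos
  -- Since `f 0 = 0`, dividing numerator and denominator by `w` removes the singularity: `G` is
  -- continuous on the closed strip, holomorphic inside, and equals `f / (1 - e^w)` away from `0`.
  set G : ℂ → ℂ := fun w => -(dslope f 0 w / dslope Complex.exp 0 w) with hG
  have hGeq : ∀ w, w ≠ 0 → G w = f w / (1 - Complex.exp w) := by
    intro w hw
    simp only [hG]
    rw [dslope_of_ne _ hw, dslope_of_ne _ hw, slope_def_field, slope_def_field, h0,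
      Complex.exp_zero, sub_zero, sub_zero, div_div_div_cancel_right₀ hw, ← div_neg, neg_sub]
  have hnhds : closedStrip ∈ 𝓝 (0 : ℂ) :=
    mem_of_superset (isOpen_openStrip.mem_nhds zero_mem_openStrip) openStrip_subset_closedStrip
  have hGc : ContinuousOn G closedStrip := by
    refine (ContinuousOn.div ?_ ?_ fun w hw => dslope_exp_zero_ne_zero hw).neg
    · exact (continuousOn_dslope hnhds).mpr
        ⟨hc, hd.differentiableAt (isOpen_openStrip.mem_nhds zero_mem_openStrip)⟩
    · exact (continuousOn_dslope hnhds).mpr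
        ⟨Complex.continuous_exp.continuousOn, Complex.differentiable_exp.differentiableAt⟩
  have hGd : DifferentiableOn ℂ G openStrip := by
    have hn := isOpen_openStrip.mem_nhds zero_mem_openStrip
    refine (DifferentiableOn.div ?_ ?_ fun w hw =>
      dslope_exp_zero_ne_zero (openStrip_subset_closedStrip hw)).neg
    · exact (Complex.differentiableOn_dslope hn).mpr hd
    · exact (Complex.differentiableOn_dslope hn).mpr Complex.differentiable_exp.differentiableOn
  have hrect : ∀ X : ℝ, 0 ≤ X →
      (∫ x : ℝ in (-X)..X, G (x + ((-1 * (Real.pi / 2) : ℝ) : ℂ) * Complex.I)) -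
        (∫ x : ℝ in (-X)..X, G (x + ((1 * (Real.pi / 2) : ℝ) : ℂ) * Complex.I)) +
      Complex.I • (∫ y : ℝ in (-1 * (Real.pi / 2))..(1 * (Real.pi / 2)), G (X + y * Complex.I)) -
      Complex.I • (∫ y : ℝ in (-1 * (Real.pi / 2))..(1 * (Real.pi / 2)),
        G ((-X : ℝ) + y * Complex.I)) = 0 := by
    intro X hX
    have := Complex.integral_boundary_rect_eq_zero_of_continuousOn_of_differentiableOn G
      ⟨-X, -1 * (Real.pi / 2)⟩ ⟨X, 1 * (Real.pi / 2)⟩ (hGc.mono ?_) (hGd.mono ?_)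
    · exact this
    · rintro w ⟨-, hw⟩
      simp only [mem_preimage] at hw
      rw [uIcc_of_le (by linarith)] at hw
      simpa [closedStrip] using hw
    · rintro w ⟨-, hw⟩
      simp only [mem_preimage] at hw
      rw [min_eq_left (by linarith), max_eq_right (by linarith)] at hw
      simpa [openStrip] using hw
  have hline : ∀ σ : ℝ, |σ| = 1 → Tendsto (fun X : ℝ => ∫ x : ℝ in (-X)..X,
      G (x + ((σ * (Real.pi / 2) : ℝ) : ℂ) * Complex.I)) atTop
      (𝓝 (∫ x : ℝ, f (x + ((σ * (Real.pi / 2) : ℝ) : ℂ) * Complex.I) /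
        (1 - Complex.exp (x + ((σ * (Real.pi / 2) : ℝ) : ℂ) * Complex.I)))) := by
    intro σ hσ
    have := intervalIntegral_tendsto_integral (hb.integrable_line hδ hc hσ) tendsto_neg_atTop_atBot
      tendsto_id
    refine this.congr fun X => ?_
    apply intervalIntegral.integral_congr
    intro x _
    refine (hGeq _ ?_).symm
    intro h0
    have := congrArg Complex.im h0
    rcases eq_or_eq_neg_of_abs_eq hσ with rfl | rfl <;> simp at this
  have hC : 0 ≤ C := by
    have := hb 0 (openStrip_subset_closedStrip zero_mem_openStrip)
    rw [h0, norm_zero] at this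
    simpa using this
  have hvert : ∀ σ : ℝ, |σ| = 1 → Tendsto (fun X : ℝ => Complex.I •
      ∫ y : ℝ in (-1 * (Real.pi / 2))..(1 * (Real.pi / 2)), G ((σ * X : ℝ) + y * Complex.I)) atTop
      (𝓝 0) := by
    intro σ hσ
    have hlim : Tendsto (fun X : ℝ => 2 * C * Real.exp (-(δ * X)) * Real.pi) atTop (𝓝 0) := by
      have : Tendsto (fun X : ℝ => Real.exp (-(δ * X))) atTop (𝓝 0) :=
        Real.tendsto_exp_neg_atTop_nhds_zero.comp (tendsto_id.const_mul_atTop hδ)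
      simpa using (this.const_mul (2 * C)).mul_const Real.pi
    refine squeeze_zero_norm' ?_ hlim
    filter_upwards [eventually_ge_atTop (1 : ℝ)] with X hX
    rw [norm_smul, Complex.norm_I, one_mul]
    have habs : |σ * X| = X := by rw [abs_mul, hσ, one_mul, abs_of_pos (by linarith)]
    have hbd : ∀ y ∈ uIoc (-1 * (Real.pi / 2)) (1 * (Real.pi / 2)),
        ‖G ((σ * X : ℝ) + y * Complex.I)‖ ≤ 2 * C * Real.exp (-(δ * X)) := by
      intro y hy
      rw [uIoc_of_le (by linarith)] at hy
      have hre : (((σ * X : ℝ) : ℂ) + y * Complex.I).re = σ * X := by simp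
      have him : (((σ * X : ℝ) : ℂ) + y * Complex.I).im = y := by simp
      have hmem : (((σ * X : ℝ) : ℂ) + y * Complex.I) ∈ closedStrip := by
        simp only [closedStrip, mem_ofPred_eq, him]
        exact ⟨by linarith [hy.1], by linarith [hy.2]⟩
      rw [hGeq]
      · have := hb.norm_div_vertical_le hmem (by rw [hre, habs]; exact hX)
        rwa [hre, habs] at this
      · intro h
        rw [h, Complex.zero_re] at hre
        rw [← hre, abs_zero] at habs
        linarith
    refine (intervalIntegral.norm_integral_le_of_norm_le_const hbd).trans (le_of_eq ?_)
    congr 1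
    rw [abs_of_pos (by linarith)]
    ring
  have v1 := hvert 1 (by simp)
  have v2 := hvert (-1) (by simp)
  have htot := (((hline (-1) (by simp)).sub (hline 1 (by simp))).add v1).sub v2
  have hz : Tendsto (fun _ : ℝ => (0 : ℂ)) atTop (𝓝 0) := tendsto_const_nhds
  have := tendsto_nhds_unique (htot.congr' (f₂ := fun _ : ℝ => (0 : ℂ)) (by
    filter_upwards [eventually_ge_atTop (0 : ℝ)] with X hX
    have := hrect X hX
    rw [← this]
    simp only [one_mul, neg_mul])) hz
  rw [add_zero, sub_zero] at this
  exact sub_eq_zero.mp this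

/-- The function `2 e^w / (1 + e^w)`. -/
def poleCorrection (w : ℂ) : ℂ := 2 * Complex.exp w / (1 + Complex.exp w)

theorem re_exp_nonneg_of_mem_closedStrip {w : ℂ} (hw : w ∈ closedStrip) :
    0 ≤ (Complex.exp w).re := by
  rw [Complex.exp_re]
  exact mul_nonneg (Real.exp_pos _).le (Real.cos_nonneg_of_mem_Icc hw)

/-- In the closed strip `Re e^w ≥ 0`, so adding `1` to `e^w` gives a number of modulus at least both
`1` and `|e^w|`. -/
theorem max_one_exp_le_norm_one_add {w : ℂ} (hw : w ∈ closedStrip) :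
    max 1 (Real.exp w.re) ≤ ‖1 + Complex.exp w‖ := by
  have hre := re_exp_nonneg_of_mem_closedStrip hw
  apply max_le
  · have := Complex.re_le_norm (1 + Complex.exp w)
    rw [Complex.add_re, Complex.one_re] at this
    linarith
  · rw [← Complex.norm_exp]
    rw [← sq_le_sq₀ (norm_nonneg _) (norm_nonneg _), Complex.sq_norm, Complex.sq_norm,
      Complex.normSq_apply, Complex.normSq_apply]
    simp only [Complex.add_re, Complex.one_re, Complex.add_im, Complex.one_im, zero_add]
    nlinarith

theorem one_add_exp_ne_zero {w : ℂ} (hw : w ∈ closedStrip) : 1 + Complex.exp w ≠ 0 := by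
  have := max_one_exp_le_norm_one_add hw
  rw [← norm_pos_iff]
  exact lt_of_lt_of_le (lt_of_lt_of_le one_pos (le_max_left _ _)) this

/-- `poleCorrection` equals `1` at `0`, decays well enough, and has explicit edge integrals.
Subtracting `f 0` times it reduces Cauchy's formula to the case without a pole. -/
theorem stripBound_poleCorrection : StripBound poleCorrection 2 1 := by
  intro w hw
  have h := max_one_exp_le_norm_one_add hw
  have hm : 0 < max 1 (Real.exp w.re) := lt_of_lt_of_le one_pos (le_max_left _ _)
  unfold poleCorrection
  rw [norm_div, norm_mul, Complex.norm_exp, div_le_iff₀ (by linarith), one_mul]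
  have h2 : (2 : ℝ) * Real.exp w.re ≤
      2 * Real.exp (-|w.re|) * max 1 (Real.exp w.re) * max 1 (Real.exp w.re) := by
    rcases le_total 0 w.re with h0 | h0
    · rw [abs_of_nonneg h0, max_eq_right (Real.one_le_exp h0), mul_assoc 2, ← Real.exp_add]
      simp
    · rw [abs_of_nonpos h0, max_eq_left (Real.exp_le_one_iff.mpr h0)]
      simp
  rw [Complex.norm_two]
  exact h2.trans (by gcongr)

theorem continuousOn_poleCorrection : ContinuousOn poleCorrection closedStrip := by
  unfold poleCorrection
  exact ContinuousOn.div (by fun_prop) (by fun_prop) fun w hw => one_add_exp_ne_zero hw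

theorem differentiableOn_poleCorrection : DifferentiableOn ℂ poleCorrection openStrip := by
  unfold poleCorrection
  exact DifferentiableOn.div (by fun_prop) (by fun_prop)
    fun w hw => one_add_exp_ne_zero (openStrip_subset_closedStrip hw)

theorem exp_line {σ : ℝ} (hσ : |σ| = 1) (x : ℝ) :
    Complex.exp (x + ((σ * (Real.pi / 2) : ℝ) : ℂ) * Complex.I) =
      ((σ * Real.exp x : ℝ) : ℂ) * Complex.I := by
  rw [Complex.exp_add, ← Complex.ofReal_exp, Complex.exp_mul_I]
  rcases eq_or_eq_neg_of_abs_eq hσ with rfl | rfl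
  · rw [one_mul, one_mul, ← Complex.ofReal_cos, ← Complex.ofReal_sin, Real.cos_pi_div_two,
      Real.sin_pi_div_two]; simp
  · rw [neg_one_mul, ← Complex.ofReal_cos, ← Complex.ofReal_sin, Real.cos_neg, Real.sin_neg,
      Real.cos_pi_div_two, Real.sin_pi_div_two]; simp

/-- The quotient is `2 e^w / (1 - e^{2w})`, and `e^{2w} = -e^{2x}` on the edges. What appears is the
derivative of `arctan(e^x)`. -/
theorem poleCorrection_line {σ : ℝ} (hσ : |σ| = 1) (x : ℝ) :
    poleCorrection (x + ((σ * (Real.pi / 2) : ℝ) : ℂ) * Complex.I) /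
        (1 - Complex.exp (x + ((σ * (Real.pi / 2) : ℝ) : ℂ) * Complex.I)) =
      2 * σ * Complex.I * ((1 / (1 + Real.exp x ^ 2) * Real.exp x : ℝ) : ℂ) := by
  have hσ2 : (σ : ℂ) ^ 2 = 1 := by
    have : σ ^ 2 = 1 := by rw [← sq_abs, hσ, one_pow]
    exact_mod_cast this
  unfold poleCorrection
  rw [exp_line hσ, div_div]
  have e : (1 + ((σ * Real.exp x : ℝ) : ℂ) * Complex.I) * (1 - ((σ * Real.exp x : ℝ) : ℂ) * Complex.I)
      = ((1 + Real.exp x ^ 2 : ℝ) : ℂ) := by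
    push_cast
    linear_combination (-(σ : ℂ) ^ 2 * (Complex.exp x) ^ 2) * Complex.I_sq +
      (Complex.exp x) ^ 2 * hσ2
  rw [e]
  push_cast
  ring

theorem integral_poleCorrection_line {σ : ℝ} (hσ : |σ| = 1) :
    ∫ x : ℝ, poleCorrection (x + ((σ * (Real.pi / 2) : ℝ) : ℂ) * Complex.I) /
        (1 - Complex.exp (x + ((σ * (Real.pi / 2) : ℝ) : ℂ) * Complex.I)) =
      σ * Real.pi * Complex.I := by
  have hint := stripBound_poleCorrection.integrable_line one_pos continuousOn_poleCorrection hσ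
  simp_rw [poleCorrection_line hσ] at hint ⊢
  have hσ0 : (σ : ℂ) ≠ 0 := by
    intro h
    rw [Complex.ofReal_eq_zero] at h
    rw [h, abs_zero] at hσ
    exact zero_ne_one hσ
  have hint' : Integrable fun x : ℝ => 1 / (1 + Real.exp x ^ 2) * Real.exp x := by
    have h2 := (hint.const_mul (2 * (σ : ℂ) * Complex.I)⁻¹).re
    refine h2.congr (Eventually.of_forall fun x => ?_)
    simp only
    rw [inv_mul_cancel_left₀ (by simp [hσ0])]
    exact Complex.ofReal_re _
  rw [integral_const_mul, integral_complex_ofReal,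
    integral_of_hasDerivAt_of_tendsto (fun x => (Real.hasDerivAt_exp x).arctan) hint'
      (m := 0) (n := Real.pi / 2)]
  · push_cast; ring
  · have := (Real.continuous_arctan.tendsto 0).comp Real.tendsto_exp_atBot
    rwa [Real.arctan_zero] at this
  · exact (tendsto_nhds_of_tendsto_nhdsWithin Real.tendsto_arctan_atTop).comp
      Real.tendsto_exp_atTop

/-- Cauchy's formula for `f(w) / (1 - e^w)` in the strip. -/
theorem strip_integral_sub {f : ℂ → ℂ} {C δ : ℝ} (hδ : 0 < δ) (hδ1 : δ ≤ 1)
    (hc : ContinuousOn f closedStrip) (hd : DifferentiableOn ℂ f openStrip)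
    (hb : StripBound f C δ) :
    (∫ x : ℝ, f (x + ((-1 * (Real.pi / 2) : ℝ) : ℂ) * Complex.I) /
        (1 - Complex.exp (x + ((-1 * (Real.pi / 2) : ℝ) : ℂ) * Complex.I))) -
      ∫ x : ℝ, f (x + ((1 * (Real.pi / 2) : ℝ) : ℂ) * Complex.I) /
        (1 - Complex.exp (x + ((1 * (Real.pi / 2) : ℝ) : ℂ) * Complex.I)) =
      -(2 * Real.pi * Complex.I) * f 0 := by
  set g : ℂ → ℂ := fun w => f w - f 0 * poleCorrection w with hg
  have hgb : StripBound g (C + ‖f 0‖ * 2) δ := by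
    intro w hw
    have h1 := hb w hw
    have h2 := stripBound_poleCorrection w hw
    have h3 : Real.exp (-(1 * |w.re|)) ≤ Real.exp (-(δ * |w.re|)) := by
      apply Real.exp_le_exp.mpr
      have := mul_le_mul_of_nonneg_right hδ1 (abs_nonneg w.re)
      linarith
    have h4 : ‖poleCorrection w‖ ≤ 2 * Real.exp (-(δ * |w.re|)) * max 1 (Real.exp w.re) :=
      h2.trans (by gcongr)
    calc ‖g w‖ ≤ ‖f w‖ + ‖f 0 * poleCorrection w‖ := norm_sub_le _ _
      _ ≤ _ := by
        rw [norm_mul]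
        have := mul_le_mul_of_nonneg_left h4 (norm_nonneg (f 0))
        linarith
  have hg0 : g 0 = 0 := by
    simp only [hg, poleCorrection, Complex.exp_zero]; norm_num
  have key := strip_integral_eq_of_apply_zero (f := g) hδ
    (hc.sub (continuousOn_const.mul continuousOn_poleCorrection))
    (hd.sub (differentiableOn_poleCorrection.const_mul _)) hgb hg0
  have split : ∀ σ : ℝ, |σ| = 1 →
      ∫ x : ℝ, g (x + ((σ * (Real.pi / 2) : ℝ) : ℂ) * Complex.I) /
        (1 - Complex.exp (x + ((σ * (Real.pi / 2) : ℝ) : ℂ) * Complex.I)) =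
      (∫ x : ℝ, f (x + ((σ * (Real.pi / 2) : ℝ) : ℂ) * Complex.I) /
        (1 - Complex.exp (x + ((σ * (Real.pi / 2) : ℝ) : ℂ) * Complex.I))) -
        f 0 * (σ * Real.pi * Complex.I) := by
    intro σ hσ
    rw [← integral_poleCorrection_line hσ, ← integral_const_mul, ← integral_sub
      (hb.integrable_line hδ hc hσ)
      ((stripBound_poleCorrection.integrable_line one_pos continuousOn_poleCorrection hσ).const_mul
        _)]
    congr 1
    funext x
    simp only [hg]
    ring
  rw [split (-1) (by simp), split 1 (by simp)] at key
  push_cast at key ⊢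
  linear_combination key

/-- The substitution `r = e^{(x+L)/n}`. With `L = log s` one has `rⁿ = s e^x`, which turns `s ± i
rⁿ` into `s (1 ± i e^x)`. -/
theorem integral_Ioi_eq_integral_exp (n : ℕ) (hn : 0 < n) (L : ℝ) (φ : ℝ → ℂ) :
    ∫ r in Ioi (0 : ℝ), φ r =
      ∫ x : ℝ, ((Real.exp ((x + L) / n) / n : ℝ) : ℂ) * φ (Real.exp ((x + L) / n)) := by
  have hn' : (0 : ℝ) < n := by exact_mod_cast hn
  have himg : (fun x : ℝ => Real.exp ((x + L) / n)) '' univ = Ioi 0 := by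
    ext r
    simp only [mem_image, mem_univ, true_and, mem_Ioi]
    constructor
    · rintro ⟨x, rfl⟩; exact Real.exp_pos _
    · intro hr
      refine ⟨n * Real.log r - L, ?_⟩
      rw [sub_add_cancel, mul_div_cancel_left₀ _ hn'.ne', Real.exp_log hr]
  have hder : ∀ x ∈ univ, HasDerivWithinAt (fun x : ℝ => Real.exp ((x + L) / n))
      (Real.exp ((x + L) / n) * (1 / n)) univ x := fun x _ =>
    ((((hasDerivAt_id x).add_const L).div_const (n : ℝ)).exp).hasDerivWithinAt
  have hinj : InjOn (fun x : ℝ => Real.exp ((x + L) / n)) univ := by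
    intro x _ y _ h
    have := Real.exp_injective h
    field_simp at this
    linarith
  rw [← himg, integral_image_eq_integral_abs_deriv_smul MeasurableSet.univ hder hinj,
    setIntegral_univ]
  congr 1
  funext x
  rw [abs_of_pos (by positivity), Complex.real_smul, mul_one_div]

/-- Cauchy's formula for `h(ξ) / (s + ω(ξ))` in a sector of opening `π / n` about the argument
`θ`, in which `ω(ξ) = -s` at `ξ = s^{1/n} e^{iθ}` only. -/
theorem sector_integral_sub {n : ℕ} (hn : 2 ≤ n) (θ : ℝ) {h : ℂ → ℂ}
    (hc : ContinuousOn (fun w => h (Complex.exp w))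
      {w | w.im ∈ Icc (θ - Real.pi / (2 * n)) (θ + Real.pi / (2 * n))})
    (hd : DifferentiableOn ℂ (fun w => h (Complex.exp w))
      {w | w.im ∈ Ioo (θ - Real.pi / (2 * n)) (θ + Real.pi / (2 * n))})
    {C : ℝ} (hb : ∀ w : ℂ, w.im ∈ Icc (θ - Real.pi / (2 * n)) (θ + Real.pi / (2 * n)) →
      ‖h (Complex.exp w)‖ ≤ C * (1 + Real.exp w.re) ^ (n - 2)) {s : ℝ} (hs : 0 < s) :
    (∫ r in Ioi (0 : ℝ), h (r * Complex.exp ((θ - Real.pi / (2 * n) : ℝ) * Complex.I)) *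
        Complex.exp ((θ - Real.pi / (2 * n) : ℝ) * Complex.I) /
          (s - ((-1 * r ^ n : ℝ) : ℂ) * Complex.I)) -
      ∫ r in Ioi (0 : ℝ), h (r * Complex.exp ((θ + Real.pi / (2 * n) : ℝ) * Complex.I)) *
        Complex.exp ((θ + Real.pi / (2 * n) : ℝ) * Complex.I) /
          (s - ((1 * r ^ n : ℝ) : ℂ) * Complex.I) =
      -(2 * Real.pi * Complex.I) * (h (Complex.exp ((Real.log s / n : ℝ) + θ * Complex.I)) *
        Complex.exp ((Real.log s / n : ℝ) + θ * Complex.I) / (n * s)) := by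
  have hn' : (0 : ℝ) < n := by positivity
  have hnC : (n : ℂ) ≠ 0 := by exact_mod_cast hn'.ne'
  have hsC : (s : ℂ) ≠ 0 := by exact_mod_cast hs.ne'
  have hpi := Real.pi_pos
  set L := Real.log s with hL
  set m : ℂ → ℂ := fun w => (L / n : ℝ) + θ * Complex.I + w / n with hm
  have hmim : ∀ w, (m w).im = θ + w.im / n := by
    intro w
    simp only [hm, Complex.add_im, Complex.ofReal_im, Complex.im_ofReal_mul, Complex.I_im,
      Complex.div_natCast_im]
    ring
  have hmre : ∀ w, (m w).re = L / n + w.re / n := by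
    intro w
    simp only [hm, Complex.add_re, Complex.ofReal_re, Complex.re_ofReal_mul, Complex.I_re,
      Complex.div_natCast_re]
    ring
  have hmd : Differentiable ℂ m := by simp only [hm]; fun_prop
  have e2 : Real.pi / (2 * n) = Real.pi / 2 / n := by rw [div_div]
  have hmaps : MapsTo m closedStrip
      {w | w.im ∈ Icc (θ - Real.pi / (2 * n)) (θ + Real.pi / (2 * n))} := by
    intro w hw
    simp only [mem_ofPred_eq, hmim, e2]
    have h1 : -(Real.pi / 2) ≤ w.im := hw.1
    have h2 : w.im ≤ Real.pi / 2 := hw.2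
    have h1' := div_le_div_of_nonneg_right h1 hn'.le
    have h2' := div_le_div_of_nonneg_right h2 hn'.le
    rw [neg_div] at h1'
    constructor <;> linarith
  have hmaps' : MapsTo m openStrip
      {w | w.im ∈ Ioo (θ - Real.pi / (2 * n)) (θ + Real.pi / (2 * n))} := by
    intro w hw
    simp only [mem_ofPred_eq, hmim, e2]
    have h1 : -(Real.pi / 2) < w.im := hw.1
    have h2 : w.im < Real.pi / 2 := hw.2
    have h1' := div_lt_div_of_pos_right h1 hn'
    have h2' := div_lt_div_of_pos_right h2 hn'
    rw [neg_div] at h1'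
    constructor <;> linarith
  set f : ℂ → ℂ := fun w => h (Complex.exp (m w)) * Complex.exp (m w) / (n * s) with hf
  have fc : ContinuousOn f closedStrip :=
    ((hc.comp hmd.continuous.continuousOn hmaps).mul
      (Complex.continuous_exp.comp hmd.continuous).continuousOn).div_const _
  have fd : DifferentiableOn ℂ f openStrip :=
    ((hd.comp hmd.differentiableOn hmaps').mul hmd.cexp.differentiableOn).div_const _
  have hC : 0 ≤ C := by
    by_contra hneg
    have h1 := hb (m 0) (hmaps (openStrip_subset_closedStrip zero_mem_openStrip))
    have h2 : C * (1 + Real.exp (m 0).re) ^ (n - 2) < 0 :=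
      mul_neg_of_neg_of_pos (not_le.mp hneg) (by positivity)
    linarith [norm_nonneg (h (Complex.exp (m 0)))]
  set b := Real.exp (L / n) with hbdef
  have hb0 : 0 < b := Real.exp_pos _
  have fb : StripBound f (C * (1 + b) ^ (n - 2) * b / (n * s)) (1 / n) := by
    intro w hw
    have h1 := hb (m w) (hmaps hw)
    set y := Real.exp (w.re / n) with hy
    have hy0 : 0 < y := Real.exp_pos _
    have hby : Real.exp (m w).re = b * y := by rw [hmre, Real.exp_add]
    rw [hby] at h1
    have hle : 1 + b * y ≤ (1 + b) * max 1 y := by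
      have := le_max_left 1 y
      have := mul_le_mul_of_nonneg_left (le_max_right 1 y) hb0.le
      nlinarith
    -- The rate `1 / n` is read off here: to the left `y = e^{-|Re w|/n}`, and to the right `y^{n-1}
    -- = e^{Re w} e^{-Re w/n}`.
    have hkey : max 1 y ^ (n - 2) * y ≤
        Real.exp (-(1 / (n : ℝ) * |w.re|)) * max 1 (Real.exp w.re) := by
      rcases le_total w.re 0 with h0 | h0
      · have hy1 : y ≤ 1 := Real.exp_le_one_iff.mpr (div_nonpos_of_nonpos_of_nonneg h0 hn'.le)
        rw [max_eq_left hy1, one_pow, one_mul, abs_of_nonpos h0,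
          max_eq_left (Real.exp_le_one_iff.mpr h0), mul_one, hy]
        apply Real.exp_le_exp.mpr
        rw [mul_neg, neg_neg, one_div_mul_eq_div]
      · have hy1 : 1 ≤ y := Real.one_le_exp (div_nonneg h0 hn'.le)
        rw [max_eq_right hy1, max_eq_right (Real.one_le_exp h0), ← pow_succ, abs_of_nonneg h0,
          ← Real.exp_add, hy, ← Real.exp_nat_mul]
        apply Real.exp_le_exp.mpr
        have : ((n - 2 + 1 : ℕ) : ℝ) = n - 1 := by
          rw [show n - 2 + 1 = n - 1 by omega, Nat.cast_sub (by omega), Nat.cast_one]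
        rw [this]
        apply le_of_eq
        field_simp
        ring
    have hns : 0 < (n : ℝ) * s := by positivity
    simp only [hf]
    rw [norm_div, norm_mul, norm_mul, Complex.norm_exp, hby, Complex.norm_natCast,
      Complex.norm_real, Real.norm_of_nonneg hs.le, div_mul_eq_mul_div, div_mul_eq_mul_div]
    apply div_le_div_of_nonneg_right _ hns.le
    calc ‖h (Complex.exp (m w))‖ * (b * y)
        ≤ C * ((1 + b) * max 1 y) ^ (n - 2) * (b * y) := by
          gcongr
          exact h1.trans (by gcongr)
      _ = C * (1 + b) ^ (n - 2) * b * (max 1 y ^ (n - 2) * y) := by rw [mul_pow]; ring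
      _ ≤ C * (1 + b) ^ (n - 2) * b *
          (Real.exp (-(1 / (n : ℝ) * |w.re|)) * max 1 (Real.exp w.re)) := by gcongr
      _ = _ := by ring
  have hδ1 : 1 / (n : ℝ) ≤ 1 := by
    rw [div_le_one hn']; exact_mod_cast (by omega : 1 ≤ n)
  have key := strip_integral_sub (by positivity) hδ1 fc fd fb
  have ray : ∀ σ : ℝ, |σ| = 1 →
      ∫ r in Ioi (0 : ℝ), h (r * Complex.exp ((θ + σ * (Real.pi / 2) / n : ℝ) * Complex.I)) *
        Complex.exp ((θ + σ * (Real.pi / 2) / n : ℝ) * Complex.I) /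
          (s - ((σ * r ^ n : ℝ) : ℂ) * Complex.I) =
      ∫ x : ℝ, f (x + ((σ * (Real.pi / 2) : ℝ) : ℂ) * Complex.I) /
        (1 - Complex.exp (x + ((σ * (Real.pi / 2) : ℝ) : ℂ) * Complex.I)) := by
    intro σ hσ
    rw [integral_Ioi_eq_integral_exp n (by omega) L]
    congr 1
    funext x
    have hpow : Real.exp ((x + L) / n) ^ n = s * Real.exp x := by
      rw [← Real.exp_nat_mul, mul_div_cancel₀ _ hn'.ne', Real.exp_add, hL, Real.exp_log hs,
        mul_comm]
    have hexp : Complex.exp (m (x + ((σ * (Real.pi / 2) : ℝ) : ℂ) * Complex.I)) =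
        (Real.exp ((x + L) / n) : ℂ) *
          Complex.exp ((θ + σ * (Real.pi / 2) / n : ℝ) * Complex.I) := by
      rw [Complex.ofReal_exp, ← Complex.exp_add]
      congr 1
      simp only [hm]
      push_cast
      field_simp
      ring
    simp only [hf]
    rw [hexp, exp_line hσ, hpow]
    have h1 : (s : ℂ) - ((σ * (s * Real.exp x) : ℝ) : ℂ) * Complex.I =
        s * (1 - ((σ * Real.exp x : ℝ) : ℂ) * Complex.I) := by
      push_cast; ring
    rw [h1]
    set E := (1 - ((σ * Real.exp x : ℝ) : ℂ) * Complex.I)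
    push_cast
    rw [div_div, ← mul_div_assoc]
    field_simp
  have r1 := ray (-1) (by simp)
  have r2 := ray 1 (by simp)
  have a1 : θ + -1 * (Real.pi / 2) / n = θ - Real.pi / (2 * n) := by rw [e2]; ring
  have a2 : θ + 1 * (Real.pi / 2) / n = θ + Real.pi / (2 * n) := by rw [e2]; ring
  rw [a1] at r1
  rw [a2] at r2
  rw [r1, r2, key]
  simp only [hf, hm, zero_div, add_zero]

/-! ### Uniqueness for truncated Laplace transforms -/

/-- The `(k+1)`-st power of `e^{x(c-τ)}` is a constant times the Laplace kernel at `s = (k+1) x`, so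
the hypothesis is used at the multiples of `x` only. -/
theorem norm_integral_exp_pow_mul_le {f : ℝ → ℂ} {t K : ℝ}
    (hK : ∀ s : ℝ, 1 ≤ s →
      ‖∫ τ in (0 : ℝ)..t, (Real.exp (-(s * τ)) : ℂ) * f τ‖ ≤ K * Real.exp (-(s * t)))
    {x : ℝ} (hx : 1 ≤ x) (c : ℝ) (k : ℕ) :
    ‖∫ τ in (0 : ℝ)..t, (Real.exp (x * (c - τ)) : ℂ) ^ (k + 1) * f τ‖ ≤
      K * Real.exp (-(x * (t - c))) ^ (k + 1) := by
  set s : ℝ := (k + 1 : ℕ) * x with hs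
  have hs1 : 1 ≤ s := by
    rw [hs]
    have : (1 : ℝ) ≤ (k + 1 : ℕ) := by exact_mod_cast Nat.le_add_left 1 k
    nlinarith
  have e : ∀ τ : ℝ, (Real.exp (x * (c - τ)) : ℂ) ^ (k + 1) * f τ =
      (Real.exp (s * c) : ℂ) * ((Real.exp (-(s * τ)) : ℂ) * f τ) := by
    intro τ
    rw [← mul_assoc, ← Complex.ofReal_pow, ← Complex.ofReal_mul, ← Real.exp_nat_mul,
      ← Real.exp_add]
    congr 3
    rw [hs]; ring
  simp_rw [e]
  rw [intervalIntegral.integral_const_mul, norm_mul, Complex.norm_real,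
    Real.norm_of_nonneg (Real.exp_pos _).le]
  refine (mul_le_mul_of_nonneg_left (hK s hs1) (Real.exp_pos _).le).trans (le_of_eq ?_)
  rw [mul_left_comm, ← Real.exp_add, ← Real.exp_nat_mul]
  congr 2
  rw [hs]; ring

theorem hasSum_one_sub_exp_neg (z : ℂ) :
    HasSum (fun k : ℕ => -((-1) ^ (k + 1) / ((k + 1).factorial : ℂ) * z ^ (k + 1)))
      (1 - Complex.exp (-z)) := by
  have h := NormedSpace.expSeries_div_hasSum_exp (-z)
  rw [← Complex.exp_eq_exp_ℂ] at h
  have h1 := ((hasSum_nat_add_iff' 1).mpr h).neg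
  simp only [Finset.sum_range_one, pow_zero, Nat.factorial_zero, Nat.cast_one, div_one,
    neg_sub] at h1
  have e : (fun k : ℕ => -((-1) ^ (k + 1) / ((k + 1).factorial : ℂ) * z ^ (k + 1))) =
      fun k : ℕ => -((-z) ^ (k + 1) / ((k + 1).factorial : ℂ)) := by
    funext k
    rw [neg_pow z]; ring
  rw [e]
  exact h1

/-- Phragmén's device: the kernel `1 - exp(-e^{x(c-τ)})` is a power series in `e^{x(c-τ)}` without
constant term, so each term is controlled by the hypothesis. With `q = e^{-x(t-c)}` the bounds `K
q^{k+1} / (k+1)!`, weakened to `K q^{k+1} / k!`, add up to `K q e^q`. -/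
theorem norm_integral_one_sub_exp_mul_le {f : ℝ → ℂ} {t K : ℝ} (ht : 0 ≤ t)
    (hf : IntervalIntegrable f volume 0 t)
    (hK : ∀ s : ℝ, 1 ≤ s →
      ‖∫ τ in (0 : ℝ)..t, (Real.exp (-(s * τ)) : ℂ) * f τ‖ ≤ K * Real.exp (-(s * t)))
    {x : ℝ} (hx : 1 ≤ x) (c : ℝ) :
    ‖∫ τ in (0 : ℝ)..t, (1 - Complex.exp (-(Real.exp (x * (c - τ)) : ℂ))) * f τ‖ ≤
      K * (Real.exp (-(x * (t - c))) * Real.exp (Real.exp (-(x * (t - c))))) := by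
  have hK0 : 0 ≤ K := by
    have := (norm_nonneg _).trans (hK 1 le_rfl)
    exact nonneg_of_mul_nonneg_left this (Real.exp_pos _)
  set q := Real.exp (-(x * (t - c))) with hq
  have hq0 : 0 < q := Real.exp_pos _
  set B := Real.exp (x * c) with hB
  have hB0 : 0 < B := Real.exp_pos _
  have hsum : HasSum (fun k : ℕ => ∫ τ in (0 : ℝ)..t,
      -((-1) ^ (k + 1) / ((k + 1).factorial : ℂ) * (Real.exp (x * (c - τ)) : ℂ) ^ (k + 1)) * f τ)
      (∫ τ in (0 : ℝ)..t, (1 - Complex.exp (-(Real.exp (x * (c - τ)) : ℂ))) * f τ) := by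
    have hsb : Summable fun k : ℕ => B ^ (k + 1) / ((k + 1).factorial : ℝ) :=
      (summable_nat_add_iff 1).mpr (Real.summable_pow_div_factorial B)
    apply intervalIntegral.hasSum_integral_of_dominated_convergence
      (fun k τ => B ^ (k + 1) / ((k + 1).factorial : ℝ) * ‖f τ‖)
    · intro k
      refine AEStronglyMeasurable.mul (Continuous.aestronglyMeasurable (by fun_prop)) ?_
      rw [uIoc_of_le ht]
      exact hf.1.aestronglyMeasurable
    · intro k
      refine Eventually.of_forall fun τ hτ => ?_
      rw [uIoc_of_le ht] at hτ
      rw [norm_mul, norm_neg, norm_mul, norm_div, norm_pow, norm_neg, norm_one, one_pow, norm_pow,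
        Complex.norm_real, Real.norm_of_nonneg (Real.exp_pos _).le, Complex.norm_natCast,
        one_div_mul_eq_div]
      have : Real.exp (x * (c - τ)) ≤ B := by
        apply Real.exp_le_exp.mpr
        have := mul_nonneg (zero_le_one.trans hx) hτ.1.le
        linarith
      gcongr
    · exact Eventually.of_forall fun τ _ => hsb.mul_right _
    · simp_rw [tsum_mul_right]
      exact hf.norm.const_mul _
    · exact Eventually.of_forall fun τ _ => (hasSum_one_sub_exp_neg _).mul_right _
  have hsq : HasSum (fun k : ℕ => K * (q * (q ^ k / (k.factorial : ℝ)))) (K * (q * Real.exp q)) := by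
    have := NormedSpace.expSeries_div_hasSum_exp q
    rw [← Real.exp_eq_exp_ℝ] at this
    exact (this.mul_left q).mul_left K
  refine hsum.norm_le_of_bounded hsq fun k => ?_
  have e : ∀ τ : ℝ, -((-1) ^ (k + 1) / ((k + 1).factorial : ℂ) *
      (Real.exp (x * (c - τ)) : ℂ) ^ (k + 1)) * f τ =
      -((-1) ^ (k + 1) / ((k + 1).factorial : ℂ)) *
        ((Real.exp (x * (c - τ)) : ℂ) ^ (k + 1) * f τ) := fun τ => by ring
  simp_rw [e]
  rw [intervalIntegral.integral_const_mul, norm_mul, norm_neg, norm_div, norm_pow, norm_neg,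
    norm_one, one_pow, Complex.norm_natCast]
  have h1 := norm_integral_exp_pow_mul_le hK hx c k
  have h2 : (k.factorial : ℝ) ≤ (k + 1).factorial := by
    exact_mod_cast Nat.factorial_le (Nat.le_succ k)
  have h3 : 0 < (k.factorial : ℝ) := by exact_mod_cast k.factorial_pos
  calc _ ≤ 1 / (k.factorial : ℝ) * (K * q ^ (k + 1)) := by gcongr
    _ = _ := by rw [pow_succ]; ring

/-- A function whose Laplace transform on `(0, t)` is `O(e^{-st})` has vanishing primitive. -/
theorem integral_eq_zero_of_laplace_le {f : ℝ → ℂ} {t K : ℝ}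
    (hf : IntervalIntegrable f volume 0 t)
    (hK : ∀ s : ℝ, 1 ≤ s →
      ‖∫ τ in (0 : ℝ)..t, (Real.exp (-(s * τ)) : ℂ) * f τ‖ ≤ K * Real.exp (-(s * t)))
    {c : ℝ} (hc : c ∈ Ioo 0 t) : ∫ τ in (0 : ℝ)..c, f τ = 0 := by
  have ht : 0 ≤ t := (hc.1.trans hc.2).le
  have hct : 0 < t - c := by linarith [hc.2]
  have hq : Tendsto (fun x : ℝ => Real.exp (-(x * (t - c)))) atTop (𝓝 0) :=
    Real.tendsto_exp_neg_atTop_nhds_zero.comp (tendsto_id.atTop_mul_const hct)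
  -- Since `c < t`, the quantity `q = e^{-x(t-c)}` tends to `0`, and so does the integral against
  -- the kernel.
  have hlim0 : Tendsto (fun x : ℝ => ∫ τ in (0 : ℝ)..t,
      (1 - Complex.exp (-(Real.exp (x * (c - τ)) : ℂ))) * f τ) atTop (𝓝 0) := by
    have hb : Tendsto (fun x : ℝ => K * (Real.exp (-(x * (t - c))) *
        Real.exp (Real.exp (-(x * (t - c)))))) atTop (𝓝 0) := by
      have := (hq.mul ((Real.continuous_exp.tendsto 0).comp hq)).const_mul K
      simpa using this
    refine squeeze_zero_norm' ?_ hb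
    filter_upwards [eventually_ge_atTop (1 : ℝ)] with x hx
    exact norm_integral_one_sub_exp_mul_le ht hf hK hx c
  -- The same kernel tends to `1` for `τ < c` and to `0` for `τ > c`, and it stays between `0` and
  -- `1`; the limit is therefore the primitive of `f` at `c`.
  have hlim1 : Tendsto (fun x : ℝ => ∫ τ in (0 : ℝ)..t,
      (1 - Complex.exp (-(Real.exp (x * (c - τ)) : ℂ))) * f τ) atTop
      (𝓝 (∫ τ in (0 : ℝ)..t, indicator {y | y ≤ c} f τ)) := by
    apply intervalIntegral.tendsto_integral_filter_of_dominated_convergence (fun τ => ‖f τ‖)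
    · refine Eventually.of_forall fun x =>
        AEStronglyMeasurable.mul (Continuous.aestronglyMeasurable (by fun_prop)) ?_
      rw [uIoc_of_le ht]
      exact hf.1.aestronglyMeasurable
    · refine Eventually.of_forall fun x => Eventually.of_forall fun τ _ => ?_
      rw [norm_mul]
      have e : (1 : ℂ) - Complex.exp (-(Real.exp (x * (c - τ)) : ℂ)) =
          ((1 - Real.exp (-Real.exp (x * (c - τ))) : ℝ) : ℂ) := by push_cast; rfl
      rw [e, Complex.norm_real]
      have h1 : Real.exp (-Real.exp (x * (c - τ))) ≤ 1 :=
        Real.exp_le_one_iff.mpr (neg_nonpos.mpr (Real.exp_pos _).le)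
      have h2 := Real.exp_pos (-Real.exp (x * (c - τ)))
      rw [Real.norm_of_nonneg (by linarith)]
      have := norm_nonneg (f τ)
      nlinarith
    · exact hf.norm
    · have hne : ∀ᵐ τ : ℝ, τ ≠ c := by simp [ae_iff]
      filter_upwards [hne] with τ hτ _
      rcases lt_or_gt_of_ne hτ with h | h
      · rw [indicator_of_mem (by exact h.le)]
        have h1 : Tendsto (fun x : ℝ => Real.exp (-Real.exp (x * (c - τ)))) atTop (𝓝 0) :=
          Real.tendsto_exp_neg_atTop_nhds_zero.comp
            (Real.tendsto_exp_atTop.comp (tendsto_id.atTop_mul_const (by linarith)))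
        have h2 : Tendsto (fun x : ℝ => Complex.exp (-(Real.exp (x * (c - τ)) : ℂ))) atTop
            (𝓝 0) := by
          have := (Complex.continuous_ofReal.tendsto 0).comp h1
          rw [Complex.ofReal_zero] at this
          refine this.congr fun x => ?_
          simp only [Function.comp_apply]
          push_cast
          rfl
        simpa using (h2.const_sub 1).mul_const (f τ)
      · rw [indicator_of_notMem (by exact not_le.mpr h)]
        have h1 : Tendsto (fun x : ℝ => Real.exp (x * (c - τ))) atTop (𝓝 0) :=
          Real.tendsto_exp_atBot.comp (tendsto_id.atTop_mul_const_of_neg (by linarith))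
        have h2 : Tendsto (fun x : ℝ => Complex.exp (-(Real.exp (x * (c - τ)) : ℂ))) atTop
            (𝓝 1) := by
          have := (Complex.continuous_exp.tendsto _).comp
            ((Complex.continuous_ofReal.tendsto 0).comp h1).neg
          simpa using! this
        simpa using (h2.const_sub 1).mul_const (f τ)
  have := tendsto_nhds_unique hlim1 hlim0
  rwa [intervalIntegral.integral_indicator ⟨hc.1.le, hc.2.le⟩] at this

/-- A continuous function on `(0, t)` whose Laplace transform is `O(e^{-st})` vanishes. -/
theorem eq_zero_of_laplace_le {f : ℝ → ℂ} {t K : ℝ}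
    (hf : IntervalIntegrable f volume 0 t) (hcont : ContinuousOn f (Ioo 0 t))
    (hK : ∀ s : ℝ, 1 ≤ s →
      ‖∫ τ in (0 : ℝ)..t, (Real.exp (-(s * τ)) : ℂ) * f τ‖ ≤ K * Real.exp (-(s * t)))
    {c : ℝ} (hc : c ∈ Ioo 0 t) : f c = 0 := by
  have hnhds : Ioo 0 t ∈ 𝓝 c := isOpen_Ioo.mem_nhds hc
  have hd : HasDerivAt (fun y => ∫ τ in (0 : ℝ)..y, f τ) (f c) c := by
    apply intervalIntegral.integral_hasDerivAt_right
    · exact hf.mono_set (by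
        rw [uIcc_of_le hc.1.le, uIcc_of_le (hc.1.trans hc.2).le]
        exact Icc_subset_Icc le_rfl hc.2.le)
    · exact hcont.stronglyMeasurableAtFilter isOpen_Ioo c hc
    · exact hcont.continuousAt hnhds
  have hz : HasDerivAt (fun y => ∫ τ in (0 : ℝ)..y, f τ) 0 c := by
    refine (hasDerivAt_const c (0 : ℂ)).congr_of_eventuallyEq ?_
    filter_upwards [hnhds] with y hy
    exact integral_eq_zero_of_laplace_le hf hK hy
  exact hd.unique hz

/-! ### Abel integrals and their Laplace transforms -/

theorem abel_congr {f g : ℝ → ℂ} {t : ℝ} (ht : 0 ≤ t) (h : ∀ τ ∈ Ioo 0 t, f τ = g τ) (α : ℝ) :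
    abel α f t = abel α g t := by
  unfold abel
  apply intervalIntegral.integral_congr_ae
  have hne : ∀ᵐ τ : ℝ, τ ≠ t := by simp [ae_iff]
  filter_upwards [hne] with τ hτ hm
  rw [uIoc_of_le ht] at hm
  rw [h τ ⟨hm.1, lt_of_le_of_ne hm.2 hτ⟩]

/-- The substitution `τ = t z` moves the singularity to the fixed point `z = 1`; continuity in `t`
then follows by dominated convergence on `[0, 1]`. -/
theorem abel_eq_scaled (α : ℝ) (f : ℝ → ℂ) {t : ℝ} (ht : 0 < t) :
    abel α f t = ((t ^ (1 - α) : ℝ) : ℂ) *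
      ∫ z in (0 : ℝ)..1, f (t * z) / (((1 - z) ^ α : ℝ) : ℂ) := by
  have h := intervalIntegral.integral_comp_mul_left (a := 0) (b := 1)
    (fun τ => f τ / (((t - τ) ^ α : ℝ) : ℂ)) ht.ne'
  rw [mul_zero, mul_one] at h
  have h2 : abel α f t = (t : ℂ) * ∫ z in (0 : ℝ)..1, f (t * z) / (((t - t * z) ^ α : ℝ) : ℂ) := by
    unfold abel
    rw [h, Complex.real_smul, ← mul_assoc, ← Complex.ofReal_mul, mul_inv_cancel₀ ht.ne',
      Complex.ofReal_one, one_mul]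
  rw [h2, ← intervalIntegral.integral_const_mul, ← intervalIntegral.integral_const_mul]
  apply intervalIntegral.integral_congr
  intro z hz
  rw [uIcc_of_le zero_le_one] at hz
  have e : t - t * z = t * (1 - z) := by ring
  simp only
  rw [e, Real.mul_rpow ht.le (by linarith [hz.2]), Real.rpow_sub ht, Real.rpow_one]
  push_cast
  have : ((t ^ α : ℝ) : ℂ) ≠ 0 := by
    exact_mod_cast (Real.rpow_pos_of_pos ht α).ne'
  field_simp

theorem intervalIntegrable_one_sub_rpow {α : ℝ} (hα : α < 1) (b : ℝ) :
    IntervalIntegrable (fun z : ℝ => (b - z) ^ (-α)) volume 0 b := by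
  have h : IntervalIntegrable (fun z : ℝ => z ^ (-α)) volume 0 b :=
    intervalIntegral.intervalIntegrable_rpow' (by linarith)
  have := h.comp_sub_left b
  rw [sub_zero, sub_self] at this
  exact this.symm

theorem continuous_abel_scaled {α : ℝ} (hα : α < 1) {f : ℝ → ℂ} (hf : Continuous f) {M : ℝ}
    (hM : ∀ x, ‖f x‖ ≤ M) :
    Continuous fun t : ℝ => ∫ z in (0 : ℝ)..1, f (t * z) / (((1 - z) ^ α : ℝ) : ℂ) := by
  apply intervalIntegral.continuous_of_dominated_interval
    (bound := fun z => M * (1 - z) ^ (-α))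
  · intro t
    have : Measurable fun z : ℝ => (((1 - z) ^ α : ℝ) : ℂ) :=
      Complex.measurable_ofReal.comp ((measurable_const.sub measurable_id).pow_const α)
    exact ((hf.comp (by fun_prop)).measurable.div this).aestronglyMeasurable
  · intro t
    refine Eventually.of_forall fun z hz => ?_
    rw [uIoc_of_le zero_le_one] at hz
    have h0 : 0 ≤ 1 - z := by linarith [hz.2]
    rw [norm_div, Complex.norm_real, Real.norm_of_nonneg (Real.rpow_nonneg h0 _),
      Real.rpow_neg h0, div_eq_mul_inv]
    exact mul_le_mul_of_nonneg_right (hM _) (inv_nonneg.mpr (Real.rpow_nonneg h0 _))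
  · exact (intervalIntegrable_one_sub_rpow hα 1).const_mul M
  · refine Eventually.of_forall fun z _ => ?_
    exact (hf.comp (by fun_prop)).div_const _

theorem continuousOn_abel {α : ℝ} (hα : α < 1) {f : ℝ → ℂ} (hf : Continuous f) {M : ℝ}
    (hM : ∀ x, ‖f x‖ ≤ M) : ContinuousOn (abel α f) (Ici 0) := by
  have hc : Continuous fun t : ℝ => ((t ^ (1 - α) : ℝ) : ℂ) *
      ∫ z in (0 : ℝ)..1, f (t * z) / (((1 - z) ^ α : ℝ) : ℂ) :=
    (Complex.continuous_ofReal.comp (Real.continuous_rpow_const (by linarith))).mul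
      (continuous_abel_scaled hα hf hM)
  refine hc.continuousOn.congr fun t ht => ?_
  rcases eq_or_lt_of_le (mem_Ici.mp ht) with h | h
  · have h0 : (1 : ℝ) - α ≠ 0 := by linarith
    simp only [← h, Real.zero_rpow h0]
    simp [abel]
  · exact abel_eq_scaled α f h

theorem integral_Ioi_exp_mul_rpow {α : ℝ} (hα : α < 1) {s : ℝ} (hs : 0 < s) :
    ∫ y in Ioi (0 : ℝ), y ^ (-α) * Real.exp (-(s * y)) = Real.Gamma (1 - α) * s ^ (α - 1) := by
  have h := Real.integral_rpow_mul_exp_neg_mul_Ioi (a := 1 - α) (by linarith) hs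
  rw [show 1 - α - 1 = -α by ring] at h
  rw [h, one_div, Real.inv_rpow hs.le, ← Real.rpow_neg hs.le, neg_sub, mul_comm]

theorem integrableOn_exp_mul_rpow {α : ℝ} (hα : α < 1) {s : ℝ} (hs : 0 < s) :
    IntegrableOn (fun y : ℝ => y ^ (-α) * Real.exp (-(s * y))) (Ioi 0) := by
  -- The integral of a nonintegrable function is `0` by convention, so the positive value of the
  -- Gamma integral implies integrability.
  apply Integrable.of_integral_ne_zero
  rw [integral_Ioi_exp_mul_rpow hα hs]
  have := Real.Gamma_pos_of_pos (show 0 < 1 - α by linarith)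
  positivity

/-- The truncated Laplace transform of an Abel integral, up to an error `O(e^{-st})`. -/
theorem laplace_abel {α : ℝ} (hα0 : 0 ≤ α) (hα : α < 1) {f : ℝ → ℂ} (hf : Continuous f) {M : ℝ}
    (hM : ∀ x, ‖f x‖ ≤ M) {t : ℝ} (ht : 0 ≤ t) :
    ∃ K, ∀ s : ℝ, 1 ≤ s →
      ‖(∫ τ in (0 : ℝ)..t, (Real.exp (-(s * τ)) : ℂ) * abel α f τ) -
        ((Real.Gamma (1 - α) * s ^ (α - 1) : ℝ) : ℂ) *
          ∫ τ in (0 : ℝ)..t, (Real.exp (-(s * τ)) : ℂ) * f τ‖ ≤ K * Real.exp (-(s * t)) := by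
  have hM0 : 0 ≤ M := (norm_nonneg _).trans (hM 0)
  set c := ∫ σ in Ioo (0 : ℝ) t, M * (t - σ) ^ (-α) with hc
  have hc0 : 0 ≤ c := setIntegral_nonneg measurableSet_Ioo fun σ hσ =>
    mul_nonneg hM0 (Real.rpow_nonneg (by linarith [hσ.2]) _)
  refine ⟨c, fun s hs => ?_⟩
  have hs0 : 0 < s := by linarith
  -- The exponential is split as `e^{-sσ} e^{-s(τ-σ)}`. The convolution of `F` and `G` vanishes for
  -- `τ ≤ 0`, is the weighted Abel integral on `(0, t]`, and has total integral equal to the product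
  -- of the two transforms; the error is its tail beyond `t`.
  set F : ℝ → ℂ := indicator (Ioo 0 t) fun σ => (Real.exp (-(s * σ)) : ℂ) * f σ with hF
  set G : ℝ → ℂ := indicator (Ioi 0) fun y => ((y ^ (-α) * Real.exp (-(s * y)) : ℝ) : ℂ) with hG
  have hFi : Integrable F := by
    refine (integrable_indicator_iff measurableSet_Ioo).mpr ?_
    exact ((Continuous.mul (by fun_prop) hf).continuousOn.integrableOn_compact
      isCompact_Icc).mono_set Ioo_subset_Icc_self
  have hGi : Integrable G := by
    refine (integrable_indicator_iff measurableSet_Ioi).mpr ?_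
    exact (integrableOn_exp_mul_rpow hα hs0).ofReal
  have hFint : ∫ σ, F σ = ∫ τ in (0 : ℝ)..t, (Real.exp (-(s * τ)) : ℂ) * f τ := by
    rw [hF, integral_indicator measurableSet_Ioo, intervalIntegral.integral_of_le ht,
      integral_Ioc_eq_integral_Ioo]
  have hGint : ∫ y, G y = ((Real.Gamma (1 - α) * s ^ (α - 1) : ℝ) : ℂ) := by
    rw [hG, integral_indicator measurableSet_Ioi, integral_complex_ofReal,
      integral_Ioi_exp_mul_rpow hα hs0]
  set H : ℝ → ℂ := convolution F G (ContinuousLinearMap.mul ℝ ℂ) volume with hH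
  have hHi : Integrable H := hFi.integrable_convolution _ hGi
  have hHint : ∫ τ, H τ = (∫ σ, F σ) * ∫ y, G y := by
    rw [hH, integral_convolution _ hFi hGi]; rfl
  have hHdef : ∀ τ, H τ = ∫ σ in Ioo 0 t, ((Real.exp (-(s * σ)) : ℂ) * f σ) * G (τ - σ) := by
    intro τ
    rw [hH, convolution_def, ← integral_indicator measurableSet_Ioo]
    congr 1
    funext σ
    rw [ContinuousLinearMap.mul_apply', hF]
    by_cases hσ : σ ∈ Ioo 0 t
    · rw [indicator_of_mem hσ, indicator_of_mem hσ]
    · rw [indicator_of_notMem hσ, indicator_of_notMem hσ, zero_mul]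
  have hHneg : ∀ τ ∈ Iic (0 : ℝ), H τ = 0 := by
    intro τ hτ
    rw [hHdef]
    refine setIntegral_eq_zero_of_forall_eq_zero fun σ hσ => ?_
    rw [hG, indicator_of_notMem, mul_zero]
    have := hσ.1
    have : τ ≤ 0 := hτ
    simp only [mem_Ioi, not_lt]
    linarith
  have hHmid : ∀ τ ∈ Ioc 0 t, H τ = (Real.exp (-(s * τ)) : ℂ) * abel α f τ := by
    intro τ hτ
    rw [hHdef]
    unfold abel
    rw [← intervalIntegral.integral_const_mul, intervalIntegral.integral_of_le hτ.1.le,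
      integral_Ioc_eq_integral_Ioo, ← integral_indicator measurableSet_Ioo,
      ← integral_indicator measurableSet_Ioo]
    congr 1
    funext σ
    by_cases h1 : σ ∈ Ioo 0 τ
    · have hσt : σ ∈ Ioo 0 t := ⟨h1.1, h1.2.trans_le hτ.2⟩
      have hpos : 0 < τ - σ := by linarith [h1.2]
      rw [indicator_of_mem h1, indicator_of_mem hσt, hG, indicator_of_mem (mem_Ioi.mpr hpos),
        Real.rpow_neg hpos.le]
      have e : Real.exp (-(s * τ)) = Real.exp (-(s * σ)) * Real.exp (-(s * (τ - σ))) := by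
        rw [← Real.exp_add]; congr 1; ring
      rw [e]
      push_cast
      ring
    · rw [indicator_of_notMem h1]
      by_cases h2 : σ ∈ Ioo 0 t
      · rw [indicator_of_mem h2, hG, indicator_of_notMem, mul_zero]
        simp only [mem_Ioi, not_lt]
        by_contra h3
        exact h1 ⟨h2.1, by linarith⟩
      · rw [indicator_of_notMem h2]
  have hHtail : ∀ τ ∈ Ioi t, ‖H τ‖ ≤ c * Real.exp (-(s * τ)) := by
    intro τ hτ
    have hτ : t < τ := hτ
    rw [hHdef, hc, ← integral_mul_const]
    have hi := (intervalIntegrable_one_sub_rpow hα t).const_mul M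
    rw [intervalIntegrable_iff_integrableOn_Ioo_of_le ht] at hi
    refine norm_integral_le_of_norm_le (hi.mul_const _) ?_
    refine (ae_restrict_iff' measurableSet_Ioo).mpr (Eventually.of_forall fun σ hσ => ?_)
    have h1 : 0 < t - σ := by linarith [hσ.2]
    have h2 : 0 < τ - σ := by linarith
    rw [hG, indicator_of_mem (mem_Ioi.mpr h2), norm_mul, norm_mul, Complex.norm_real,
      Complex.norm_real, Real.norm_of_nonneg (Real.exp_pos _).le,
      Real.norm_of_nonneg (mul_nonneg (Real.rpow_nonneg h2.le _) (Real.exp_pos _).le)]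
    have e : Real.exp (-(s * τ)) = Real.exp (-(s * σ)) * Real.exp (-(s * (τ - σ))) := by
      rw [← Real.exp_add]; congr 1; ring
    have hstep : 0 ≤ (τ - σ) ^ (-α) := Real.rpow_nonneg h2.le _
    rw [e]
    -- Here `α ≥ 0` is used: past time `t` the kernel is dominated by its value at `t`, which makes
    -- the constant `c` independent of `τ` and `s`.
    have hr : (τ - σ) ^ (-α) ≤ (t - σ) ^ (-α) :=
      Real.rpow_le_rpow_of_nonpos h1 (by linarith) (by linarith)
    calc _ ≤ Real.exp (-(s * σ)) * M * ((t - σ) ^ (-α) * Real.exp (-(s * (τ - σ)))) := by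
          gcongr
          exact hM σ
      _ = _ := by ring
  have hsplit : ∫ τ, H τ = (∫ τ in (0 : ℝ)..t, (Real.exp (-(s * τ)) : ℂ) * abel α f τ) +
      ∫ τ in Ioi t, H τ := by
    rw [← setIntegral_univ, ← Iic_union_Ioi (a := (0 : ℝ)),
      setIntegral_union (Iic_disjoint_Ioi le_rfl) measurableSet_Ioi hHi.integrableOn
        hHi.integrableOn, setIntegral_eq_zero_of_forall_eq_zero hHneg, zero_add,
      ← Ioc_union_Ioi_eq_Ioi ht, setIntegral_union (Ioc_disjoint_Ioi le_rfl) measurableSet_Ioi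
        hHi.integrableOn hHi.integrableOn, setIntegral_congr_fun measurableSet_Ioc hHmid,
      intervalIntegral.integral_of_le ht]
  have e : (∫ τ in (0 : ℝ)..t, (Real.exp (-(s * τ)) : ℂ) * abel α f τ) -
        ((Real.Gamma (1 - α) * s ^ (α - 1) : ℝ) : ℂ) *
          ∫ τ in (0 : ℝ)..t, (Real.exp (-(s * τ)) : ℂ) * f τ = -∫ τ in Ioi t, H τ := by
    rw [← hGint, ← hFint, mul_comm (∫ y, G y), ← hHint, hsplit]; ring
  rw [e, norm_neg]
  have hexp := integrableOn_exp_mul_Ioi (neg_lt_zero.mpr hs0) t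
  simp_rw [neg_mul] at hexp
  refine (norm_integral_le_of_norm_le (hexp.const_mul c)
    ((ae_restrict_iff' measurableSet_Ioi).mpr (Eventually.of_forall hHtail))).trans ?_
  rw [integral_const_mul]
  gcongr
  have hI := integral_exp_mul_Ioi (neg_lt_zero.mpr hs0) t
  simp_rw [neg_mul] at hI
  rw [hI, neg_div_neg_eq]
  exact div_le_self (Real.exp_pos _).le hs

/-! ### Green's formula and the global relation -/

theorem dx_zero (f : ℝ → ℂ) : dx 0 f = f := by
  funext x; simp [dx]

theorem continuousOn_dx {N : ℕ} {f : ℝ → ℂ} (hf : ContDiffOn ℝ N f (Ici 0)) {m : ℕ} (hm : m ≤ N) :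
    ContinuousOn (dx m f) (Ici 0) :=
  hf.continuousOn_iteratedDerivWithin (by exact_mod_cast hm) (uniqueDiffOn_Ici 0)

theorem hasDerivAt_dx {N : ℕ} {f : ℝ → ℂ} (hf : ContDiffOn ℝ N f (Ici 0)) {m : ℕ} (hm : m < N)
    {x : ℝ} (hx : 0 < x) : HasDerivAt (dx m f) (dx (m + 1) f x) x := by
  have hd : DifferentiableOn ℝ (dx m f) (Ici 0) :=
    hf.differentiableOn_iteratedDerivWithin (by exact_mod_cast hm) (uniqueDiffOn_Ici 0)
  have h1 := (hd x hx.le).hasDerivWithinAt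
  have e : derivWithin (dx m f) (Ici 0) x = dx (m + 1) f x := by
    unfold dx
    rw [iteratedDerivWithin_succ]
  rw [e] at h1
  exact h1.hasDerivAt (Ici_mem_nhds hx)

theorem intervalIntegral_swap_of_continuousOn {f : ℝ → ℝ → ℂ} {a b c d : ℝ} (hab : a ≤ b)
    (hcd : c ≤ d) (hf : ContinuousOn (Function.uncurry f) (Icc a b ×ˢ Icc c d)) :
    ∫ x in a..b, ∫ y in c..d, f x y = ∫ y in c..d, ∫ x in a..b, f x y := by
  simp_rw [intervalIntegral.integral_of_le hab, intervalIntegral.integral_of_le hcd]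
  apply integral_integral_swap
  rw [Measure.prod_restrict]
  exact (hf.integrableOn_compact (isCompact_Icc.prod isCompact_Icc)).mono_set
    (prod_mono Ioc_subset_Icc_self Ioc_subset_Icc_self)

/-- The kernel `e^{-ixξ}` of the half-line transform. -/
def planeWave (ξ : ℂ) (x : ℝ) : ℂ := Complex.exp (-(Complex.I * x * ξ))

theorem continuous_planeWave (ξ : ℂ) : Continuous (planeWave ξ) := by
  unfold planeWave; fun_prop

theorem norm_planeWave (ξ : ℂ) (x : ℝ) : ‖planeWave ξ x‖ = Real.exp (x * ξ.im) := by
  unfold planeWave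
  rw [Complex.norm_exp]
  congr 1
  simp [Complex.mul_re, Complex.mul_im]

theorem norm_planeWave_le_one {ξ : ℂ} (hξ : ξ.im ≤ 0) {x : ℝ} (hx : 0 ≤ x) :
    ‖planeWave ξ x‖ ≤ 1 := by
  rw [norm_planeWave, Real.exp_le_one_iff]
  exact mul_nonpos_of_nonneg_of_nonpos hx hξ

theorem hasDerivAt_planeWave (ξ : ℂ) (x : ℝ) :
    HasDerivAt (planeWave ξ) (-(Complex.I * ξ) * planeWave ξ x) x := by
  unfold planeWave
  have h : HasDerivAt (fun y : ℝ => -(Complex.I * (y : ℂ) * ξ)) (-(Complex.I * 1 * ξ)) x :=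
    (((hasDerivAt_id x).ofReal_comp.const_mul Complex.I).mul_const ξ).neg
  refine h.cexp.congr_deriv ?_
  ring

theorem integrableOn_planeWave_mul {ξ : ℂ} (hξ : ξ.im ≤ 0) {f : ℝ → ℂ}
    (hf : IntegrableOn f (Ioi 0)) : IntegrableOn (fun x => planeWave ξ x * f x) (Ioi 0) := by
  refine hf.norm.mono'
    ((continuous_planeWave ξ).aestronglyMeasurable.mul hf.aestronglyMeasurable) ?_
  refine (ae_restrict_iff' measurableSet_Ioi).mpr (Eventually.of_forall fun x hx => ?_)
  rw [norm_mul]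
  have := norm_planeWave_le_one hξ (le_of_lt (mem_Ioi.mp hx))
  exact mul_le_of_le_one_left (norm_nonneg _) this

/-- The boundary form of the equation: the primitive in `x` of
`e^{-ixξ} (∂ₓⁿ f - (iξ)ⁿ f)`. -/
def boundaryForm (n : ℕ) (ξ : ℂ) (D : ℕ → ℂ) (x : ℝ) : ℂ :=
  ∑ m ∈ Finset.range n, (Complex.I * ξ) ^ (n - 1 - m) * D m * planeWave ξ x

/-- The derivative of the `m`-th summand is a difference of consecutive terms `(iξ)^{n-k} ∂ₓᵏ f
e^{-ixξ}`, so the sum telescopes. -/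
theorem hasDerivAt_boundaryForm {n : ℕ} {f : ℝ → ℂ} (hf : ContDiffOn ℝ n f (Ici 0)) (ξ : ℂ) {x : ℝ}
    (hx : 0 < x) : HasDerivAt (fun y => boundaryForm n ξ (fun m => dx m f y) y)
      (planeWave ξ x * (dx n f x - (Complex.I * ξ) ^ n * f x)) x := by
  unfold boundaryForm
  have h : ∀ m ∈ Finset.range n, HasDerivAt
      (fun y => (Complex.I * ξ) ^ (n - 1 - m) * dx m f y * planeWave ξ y)
      ((fun k => (Complex.I * ξ) ^ (n - k) * dx k f x * planeWave ξ x) (m + 1) -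
        (fun k => (Complex.I * ξ) ^ (n - k) * dx k f x * planeWave ξ x) m) x := by
    intro m hm
    have hm := Finset.mem_range.mp hm
    refine (((hasDerivAt_dx hf hm hx).const_mul _).mul (hasDerivAt_planeWave ξ x)).congr_deriv ?_
    have e1 : n - (m + 1) = n - 1 - m := by omega
    have e2 : n - m = (n - 1 - m) + 1 := by omega
    simp only [e1, e2, pow_succ]
    ring
  refine (HasDerivAt.fun_sum h).congr_deriv ?_
  rw [Finset.sum_range_sub (fun k => (Complex.I * ξ) ^ (n - k) * dx k f x * planeWave ξ x) n]
  simp only [Nat.sub_self, pow_zero, Nat.sub_zero, dx_zero]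
  ring

/-- The rectangle stays strictly inside the domain, where the equation holds and `∂ₓⁿ q` is
continuous; its edges reach the boundary only in a later limit. -/
theorem IsSolution.green_identity {n : ℕ} (hn : 0 < n) {a : ℂ} {T : ℝ} {q : ℝ → ℝ → ℂ}
    (hq : IsSolution n a T q) (ξ : ℂ) {s t : ℝ} (hs : 0 < s) (hst : s ≤ t) (ht : t < T) {ε R : ℝ}
    (hε : 0 < ε) (hεR : ε ≤ R) :
    ∫ x in ε..R, planeWave ξ x * (Complex.exp (symbol n a ξ * t) * q t x -
        Complex.exp (symbol n a ξ * s) * q s x) =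
      -(a * (-Complex.I) ^ n) * ∫ τ in s..t, Complex.exp (symbol n a ξ * τ) *
        (boundaryForm n ξ (fun m => dx m (q τ) R) R -
          boundaryForm n ξ (fun m => dx m (q τ) ε) ε) := by
  set ω := symbol n a ξ with hω
  have hωeq : ω = a * (-Complex.I) ^ n * (Complex.I * ξ) ^ n := by
    rw [hω, symbol, mul_assoc, ← mul_pow]
    congr 2
    rw [← mul_assoc, neg_mul, Complex.I_mul_I]; ring
  have hτmem : ∀ τ ∈ Icc s t, τ ∈ Ioo 0 T := fun τ h => ⟨by linarith [h.1], by linarith [h.2]⟩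
  have hτmem' : ∀ τ ∈ Icc s t, τ ∈ Icc 0 T := fun τ h => Ioo_subset_Icc_self (hτmem τ h)
  have hxmem : ∀ x ∈ Icc ε R, x ∈ Ioi (0 : ℝ) := fun x h => lt_of_lt_of_le hε h.1
  -- Because `ω = a (-i)ⁿ (iξ)ⁿ`, the equation makes `-a (-i)ⁿ Ψ` the time derivative of `e^{ωτ -
  -- ixξ} q`, while `Ψ` is also the `x`-derivative of `e^{ωτ}` times the boundary form. The identity
  -- compares the two iterated integrals of `Ψ`.
  set Ψ : ℝ → ℝ → ℂ := fun x τ => Complex.exp (ω * τ) *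
    (planeWave ξ x * (dx n (q τ) x - (Complex.I * ξ) ^ n * q τ x)) with hΨ
  have hΨc : ContinuousOn (Function.uncurry Ψ) (Icc ε R ×ˢ Icc s t) := by
    have c1 : ContinuousOn (fun p : ℝ × ℝ => dx n (q p.2) p.1) (Icc ε R ×ˢ Icc s t) :=
      hq.continuousOn_top.comp (f := fun p : ℝ × ℝ => (p.2, p.1)) (by fun_prop)
        fun p hp => ⟨hτmem _ hp.2, hxmem _ hp.1⟩
    have c2 : ContinuousOn (fun p : ℝ × ℝ => q p.2 p.1) (Icc ε R ×ˢ Icc s t) := by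
      have := (hq.continuousOn 0 hn).comp (s := Icc ε R ×ˢ Icc s t)
        (f := fun p : ℝ × ℝ => (p.2, p.1)) (by fun_prop)
        fun p hp => ⟨hτmem' _ hp.2, mem_Ici.mpr (le_of_lt (hxmem _ hp.1))⟩
      simpa only [dx_zero, Function.comp_def] using this
    have c3 : Continuous fun p : ℝ × ℝ => planeWave ξ p.1 :=
      (continuous_planeWave ξ).comp continuous_fst
    have c4 : Continuous fun p : ℝ × ℝ => Complex.exp (ω * p.2) := by fun_prop
    exact c4.continuousOn.mul (c3.continuousOn.mul (c1.sub (continuousOn_const.mul c2)))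
  have htime : ∀ x ∈ Icc ε R, planeWave ξ x * (Complex.exp (ω * t) * q t x -
      Complex.exp (ω * s) * q s x) = -(a * (-Complex.I) ^ n) * ∫ τ in s..t, Ψ x τ := by
    intro x hx
    have hx0 : 0 < x := hxmem x hx
    have hder : ∀ τ ∈ uIcc s t, HasDerivAt
        (fun τ : ℝ => planeWave ξ x * (Complex.exp (ω * τ) * q τ x))
        (-(a * (-Complex.I) ^ n) * Ψ x τ) τ := by
      intro τ hτ
      rw [uIcc_of_le hst] at hτ
      have hτ' := hτmem τ hτ
      have h1 := (hq.differentiableAt τ hτ' x hx0).hasDerivAt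
      have h2 := hq.pde τ hτ' x hx0
      have h3 : HasDerivAt (fun τ : ℝ => Complex.exp (ω * τ)) (Complex.exp (ω * τ) * (ω * 1)) τ :=
        ((hasDerivAt_id τ).ofReal_comp.const_mul ω).cexp
      refine ((h3.mul h1).const_mul (planeWave ξ x)).congr_deriv ?_
      have h4 : deriv (fun s => q s x) τ = -(a * ((-Complex.I) ^ n * dx n (q τ) x)) :=
        eq_neg_of_add_eq_zero_left h2
      simp only [hΨ]
      rw [h4, hωeq]
      ring
    have hi : IntervalIntegrable (fun τ => -(a * (-Complex.I) ^ n) * Ψ x τ) volume s t := by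
      apply ContinuousOn.intervalIntegrable
      rw [uIcc_of_le hst]
      exact continuousOn_const.mul
        (hΨc.comp (f := fun τ : ℝ => (x, τ)) (by fun_prop) fun τ hτ => ⟨hx, hτ⟩)
    have := intervalIntegral.integral_eq_sub_of_hasDerivAt hder hi
    rw [intervalIntegral.integral_const_mul] at this
    rw [this]; ring
  have hspace : ∀ τ ∈ Icc s t, ∫ x in ε..R, Ψ x τ = Complex.exp (ω * τ) *
      (boundaryForm n ξ (fun m => dx m (q τ) R) R -
        boundaryForm n ξ (fun m => dx m (q τ) ε) ε) := by
    intro τ hτ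
    simp only [hΨ]
    rw [intervalIntegral.integral_const_mul]
    congr 1
    apply intervalIntegral.integral_eq_sub_of_hasDerivAt
      (f := fun y => boundaryForm n ξ (fun m => dx m (q τ) y) y)
    · intro x hx
      rw [uIcc_of_le hεR] at hx
      exact hasDerivAt_boundaryForm (hq.contDiffOn τ (hτmem' τ hτ)) ξ (hxmem x hx)
    · apply ContinuousOn.intervalIntegrable
      rw [uIcc_of_le hεR]
      have hsub : Icc ε R ⊆ Ici 0 := fun x hx => mem_Ici.mpr (le_of_lt (hxmem x hx))
      have hcd := hq.contDiffOn τ (hτmem' τ hτ)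
      exact (continuous_planeWave ξ).continuousOn.mul
        (((continuousOn_dx hcd le_rfl).mono hsub).sub
          (continuousOn_const.mul (hcd.continuousOn.mono hsub)))
  calc ∫ x in ε..R, planeWave ξ x * (Complex.exp (ω * t) * q t x - Complex.exp (ω * s) * q s x)
      = ∫ x in ε..R, -(a * (-Complex.I) ^ n) * ∫ τ in s..t, Ψ x τ := by
        apply intervalIntegral.integral_congr
        intro x hx
        rw [uIcc_of_le hεR] at hx
        exact htime x hx
    _ = -(a * (-Complex.I) ^ n) * ∫ τ in s..t, ∫ x in ε..R, Ψ x τ := by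
        rw [intervalIntegral.integral_const_mul,
          intervalIntegral_swap_of_continuousOn hεR hst hΨc]
    _ = _ := by
        congr 1
        apply intervalIntegral.integral_congr
        intro τ hτ
        rw [uIcc_of_le hst] at hτ
        exact hspace τ hτ

/-- The derivatives of a solution, continued to the whole plane by freezing the arguments at the
boundary of `[0, T] × [0, ∞)`. -/
def clampDx (T : ℝ) (q : ℝ → ℝ → ℂ) (m : ℕ) (τ x : ℝ) : ℂ :=
  dx m (q (max 0 (min τ T))) (max x 0)

theorem clampDx_eq {T τ x : ℝ} (q : ℝ → ℝ → ℂ) (m : ℕ) (hτ : τ ∈ Icc 0 T) (hx : 0 ≤ x) :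
    clampDx T q m τ x = dx m (q τ) x := by
  unfold clampDx
  rw [min_eq_left hτ.2, max_eq_right hτ.1, max_eq_left hx]

theorem IsSolution.continuous_clampDx {n : ℕ} {a : ℂ} {T : ℝ} (hT : 0 ≤ T) {q : ℝ → ℝ → ℂ}
    (hq : IsSolution n a T q) {m : ℕ} (hm : m < n) :
    Continuous fun p : ℝ × ℝ => clampDx T q m p.1 p.2 := by
  unfold clampDx
  refine (hq.continuousOn m hm).comp_continuous
    (f := fun p : ℝ × ℝ => (max 0 (min p.1 T), max p.2 0)) (by fun_prop) fun p => ?_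
  exact ⟨⟨le_max_left _ _, max_le hT (min_le_right _ _)⟩, mem_Ici.mpr (le_max_right _ _)⟩

theorem continuous_boundaryForm {X : Type*} [TopologicalSpace X] (n : ℕ) (ξ : ℂ)
    {D : X → ℕ → ℂ} (hD : ∀ m < n, Continuous fun p => D p m) {y : X → ℝ} (hy : Continuous y) :
    Continuous fun p => boundaryForm n ξ (D p) (y p) := by
  unfold boundaryForm
  refine continuous_finsetSum _ fun m hm => ?_
  exact (continuous_const.mul (hD m (Finset.mem_range.mp hm))).mul
    ((continuous_planeWave ξ).comp hy)

theorem boundaryForm_congr {n : ℕ} (ξ : ℂ) {D D' : ℕ → ℂ} (h : ∀ m < n, D m = D' m) (x : ℝ) :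
    boundaryForm n ξ D x = boundaryForm n ξ D' x := by
  unfold boundaryForm
  exact Finset.sum_congr rfl fun m hm => by rw [h m (Finset.mem_range.mp hm)]

theorem eq_at_zero_of_eqOn_Ioc {f g : ℝ → ℂ} (hf : Continuous f) (hg : Continuous g) {b : ℝ}
    (hb : 0 < b) (h : ∀ s, 0 < s → s ≤ b → f s = g s) : f 0 = g 0 := by
  have h1 : Tendsto f (𝓝[>] 0) (𝓝 (f 0)) := (hf.tendsto 0).mono_left nhdsWithin_le_nhds
  have h2 : Tendsto g (𝓝[>] 0) (𝓝 (g 0)) := (hg.tendsto 0).mono_left nhdsWithin_le_nhds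
  refine tendsto_nhds_unique (h1.congr' ?_) h2
  filter_upwards [Ioc_mem_nhdsGT hb] with s hs
  exact h s hs.1 hs.2

theorem continuous_integral_left {f : ℝ → ℂ} (hf : Continuous f) (b : ℝ) :
    Continuous fun s => ∫ x in s..b, f x := by
  have e : (fun s => ∫ x in s..b, f x) = fun s => -∫ x in b..s, f x := by
    funext s; exact intervalIntegral.integral_symm b s
  rw [e]
  exact (intervalIntegral.continuous_primitive (fun _ _ => hf.intervalIntegrable _ _) b).neg

/-- Both sides are continuous in the lower edges `s` and `ε`, which are sent to `0` one after the
other. Derivatives of order `n` no longer occur, so continuity up to the boundary suffices. -/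
theorem rectangle_identity_zero {P E : ℝ → ℂ} {Q B : ℝ → ℝ → ℂ} {κ : ℂ} (hP : Continuous P)
    (hE : Continuous E) (hQ : Continuous fun p : ℝ × ℝ => Q p.1 p.2)
    (hB : Continuous fun p : ℝ × ℝ => B p.1 p.2) {t R : ℝ} (ht : 0 < t) (hR : 0 < R)
    (h : ∀ s, 0 < s → s ≤ t → ∀ ε, 0 < ε → ε ≤ R →
      ∫ x in ε..R, P x * (E t * Q t x - E s * Q s x) =
        κ * ∫ τ in s..t, E τ * (B τ R - B τ ε)) :
    ∫ x in (0 : ℝ)..R, P x * (E t * Q t x - E 0 * Q 0 x) =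
      κ * ∫ τ in (0 : ℝ)..t, E τ * (B τ R - B τ 0) := by
  have hQt : ∀ s, Continuous fun x => Q s x := fun s =>
    hQ.comp (by fun_prop : Continuous fun x : ℝ => (s, x))
  have hBx : ∀ x, Continuous fun τ => B τ x := fun x =>
    hB.comp (by fun_prop : Continuous fun τ : ℝ => (τ, x))
  have step1 : ∀ ε, 0 < ε → ε ≤ R → ∫ x in ε..R, P x * (E t * Q t x - E 0 * Q 0 x) =
      κ * ∫ τ in (0 : ℝ)..t, E τ * (B τ R - B τ ε) := by
    intro ε hε hεR
    refine eq_at_zero_of_eqOn_Ioc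
      (f := fun s : ℝ => ∫ x in ε..R, P x * (E t * Q t x - E s * Q s x))
      (g := fun s => κ * ∫ τ in s..t, E τ * (B τ R - B τ ε))
      ?_ ?_ ht fun s hs hst => h s hs hst ε hε hεR
    · apply intervalIntegral.continuous_parametric_intervalIntegral_of_continuous'
      exact (hP.comp continuous_snd).mul ((continuous_const.mul ((hQt t).comp continuous_snd)).sub
        ((hE.comp continuous_fst).mul hQ))
    · exact continuous_const.mul (continuous_integral_left (hE.mul ((hBx R).sub (hBx ε))) t)
  refine eq_at_zero_of_eqOn_Ioc
    (f := fun ε : ℝ => ∫ x in ε..R, P x * (E t * Q t x - E 0 * Q 0 x))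
    (g := fun ε => κ * ∫ τ in (0 : ℝ)..t, E τ * (B τ R - B τ ε)) ?_ ?_ hR step1
  · exact continuous_integral_left (hP.mul ((continuous_const.mul (hQt t)).sub
      (continuous_const.mul (hQt 0)))) R
  · refine continuous_const.mul ?_
    apply intervalIntegral.continuous_parametric_intervalIntegral_of_continuous'
    exact (hE.comp continuous_snd).mul (((hBx R).comp continuous_snd).sub
      (hB.comp (by fun_prop : Continuous fun p : ℝ × ℝ => (p.2, p.1))))

theorem IsSolution.green_identity_zero {n : ℕ} (hn : 0 < n) {a : ℂ} {T : ℝ} {q : ℝ → ℝ → ℂ}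
    (hq : IsSolution n a T q) (ξ : ℂ) {t : ℝ} (ht0 : 0 < t) (ht : t < T) {R : ℝ} (hR : 0 < R) :
    ∫ x in (0 : ℝ)..R, planeWave ξ x * (Complex.exp (symbol n a ξ * t) * q t x - q 0 x) =
      -(a * (-Complex.I) ^ n) * ∫ τ in (0 : ℝ)..t, Complex.exp (symbol n a ξ * τ) *
        (boundaryForm n ξ (fun m => clampDx T q m τ R) R -
          boundaryForm n ξ (fun m => clampDx T q m τ 0) 0) := by
  set ω := symbol n a ξ with hω
  have hT : 0 ≤ T := by linarith
  have hcl : ∀ m < n, Continuous fun p : ℝ × ℝ => clampDx T q m p.1 p.2 :=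
    fun m hm => hq.continuous_clampDx hT hm
  have hc0 := hcl 0 hn
  set Q : ℝ → ℝ → ℂ := fun τ x => clampDx T q 0 τ x with hQ
  have hQeq : ∀ τ ∈ Icc 0 T, ∀ x, 0 ≤ x → Q τ x = q τ x := fun τ hτ x hx => by
    simp only [hQ]; rw [clampDx_eq q 0 hτ hx, dx_zero]
  set B : ℝ → ℝ → ℂ := fun τ x => boundaryForm n ξ (fun m => clampDx T q m τ x) x with hB
  have hBc : Continuous fun p : ℝ × ℝ => B p.1 p.2 :=
    continuous_boundaryForm n ξ hcl continuous_snd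
  have hE : Continuous fun τ : ℝ => Complex.exp (ω * τ) := by fun_prop
  have hP := continuous_planeWave ξ
  have htm : t ∈ Icc 0 T := ⟨ht0.le, ht.le⟩
  have step0 : ∀ s, 0 < s → s ≤ t → ∀ ε, 0 < ε → ε ≤ R →
      ∫ x in ε..R, planeWave ξ x * (Complex.exp (ω * t) * Q t x - Complex.exp (ω * s) * Q s x) =
      -(a * (-Complex.I) ^ n) * ∫ τ in s..t, Complex.exp (ω * τ) * (B τ R - B τ ε) := by
    intro s hs hst ε hε hεR
    have hsm : s ∈ Icc 0 T := ⟨hs.le, hst.trans ht.le⟩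
    have h := hq.green_identity hn ξ hs hst ht hε hεR
    convert h using 1
    · apply intervalIntegral.integral_congr
      intro x hx
      rw [uIcc_of_le hεR] at hx
      have hx0 : 0 ≤ x := hε.le.trans hx.1
      simp only [hQeq t htm x hx0, hQeq s hsm x hx0, hω]
    · congr 1
      apply intervalIntegral.integral_congr
      intro τ hτ
      rw [uIcc_of_le hst] at hτ
      have hτm : τ ∈ Icc 0 T := ⟨hs.le.trans hτ.1, hτ.2.trans ht.le⟩
      have e : ∀ x, 0 ≤ x → B τ x = boundaryForm n ξ (fun m => dx m (q τ) x) x := fun x hx =>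
        boundaryForm_congr ξ (fun m _ => clampDx_eq q m hτm hx) x
      simp only [e R hR.le, e ε hε.le, hω]
  have step2 := rectangle_identity_zero (Q := Q) hP hE hc0 hBc ht0 hR step0
  rw [← step2]
  apply intervalIntegral.integral_congr
  intro x hx
  rw [uIcc_of_le hR.le] at hx
  simp only [hQeq t htm x hx.1, hQeq 0 ⟨le_rfl, hT⟩ x hx.1, Complex.ofReal_zero, mul_zero,
    Complex.exp_zero, one_mul]

/-- The side `x = R` disappears: `|e^{-iRξ}| ≤ 1` in the lower half-plane, and the derivatives of
order below `n` decay uniformly in time. -/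
theorem IsSolution.tendsto_integral_boundaryForm {n : ℕ} {a : ℂ} {T : ℝ} {q : ℝ → ℝ → ℂ}
    (hq : IsSolution n a T q) {ξ : ℂ} (hξ : ξ.im ≤ 0) (ω : ℂ) {t : ℝ} (ht0 : 0 < t) (ht : t < T) :
    Tendsto (fun R : ℝ => ∫ τ in (0 : ℝ)..t, Complex.exp (ω * τ) *
      boundaryForm n ξ (fun m => clampDx T q m τ R) R) atTop (𝓝 0) := by
  have hT : 0 ≤ T := by linarith
  have hE : Continuous fun τ : ℝ => Complex.exp (ω * τ) := by fun_prop
  have hmem : ∀ τ ∈ uIoc 0 t, τ ∈ Icc 0 T := fun τ hτ => by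
    rw [uIoc_of_le ht0.le] at hτ
    exact ⟨hτ.1.le, hτ.2.trans ht.le⟩
  have hterm : ∀ m ∈ Finset.range n, ∀ ε > 0, ∀ᶠ R : ℝ in atTop, ∀ τ ∈ uIoc 0 t,
      ‖(Complex.I * ξ) ^ (n - 1 - m) * clampDx T q m τ R * planeWave ξ R‖ ≤ ε := by
    intro m hm ε hε
    set c := ‖(Complex.I * ξ) ^ (n - 1 - m)‖ with hc
    have hc0 : 0 ≤ c := norm_nonneg _
    have hu := Metric.tendstoUniformlyOn_iff.mp (hq.decay m (Finset.mem_range.mp hm))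
      (ε / (c + 1)) (by positivity)
    filter_upwards [hu, eventually_ge_atTop (0 : ℝ)] with R hR hR0 τ hτ
    have h1 := hR τ (hmem τ hτ)
    rw [dist_zero_left] at h1
    rw [norm_mul, norm_mul, clampDx_eq q m (hmem τ hτ) hR0]
    have h2 := norm_planeWave_le_one hξ hR0
    calc c * ‖dx m (q τ) R‖ * ‖planeWave ξ R‖ ≤ c * (ε / (c + 1)) * 1 := by gcongr
      _ ≤ (c + 1) * (ε / (c + 1)) := by
        rw [mul_one]
        have : 0 < ε / (c + 1) := by positivity
        nlinarith
      _ = ε := by field_simp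
  have hall : ∀ ε > 0, ∀ᶠ R : ℝ in atTop, ∀ τ ∈ uIoc 0 t,
      ‖boundaryForm n ξ (fun m => clampDx T q m τ R) R‖ ≤ n * ε := by
    intro ε hε
    have := (Filter.eventually_all_finset (Finset.range n)).mpr fun m hm => hterm m hm ε hε
    filter_upwards [this] with R hR τ hτ
    refine (norm_sum_le_of_le _ fun m hm => hR m hm τ hτ).trans (le_of_eq ?_)
    rw [Finset.sum_const, Finset.card_range, nsmul_eq_mul]
  have h0 : (0 : ℂ) = ∫ τ in (0 : ℝ)..t, (0 : ℂ) := by simp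
  rw [h0]
  apply intervalIntegral.tendsto_integral_filter_of_dominated_convergence
    (fun τ => ‖Complex.exp (ω * τ)‖ * n)
  · refine Eventually.of_forall fun R => Continuous.aestronglyMeasurable (hE.mul ?_)
    refine continuous_boundaryForm n ξ (fun m hm => ?_) continuous_const
    exact (hq.continuous_clampDx hT hm).comp (by fun_prop : Continuous fun τ : ℝ => (τ, R))
  · filter_upwards [hall 1 one_pos] with R hR
    refine Eventually.of_forall fun τ hτ => ?_
    rw [norm_mul]
    have := hR τ hτ
    rw [mul_one] at this
    gcongr
  · exact (hE.norm.mul continuous_const).intervalIntegrable _ _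
  · refine Eventually.of_forall fun τ hτ => ?_
    have : Tendsto (fun R : ℝ => boundaryForm n ξ (fun m => clampDx T q m τ R) R) atTop (𝓝 0) := by
      rw [Metric.tendsto_nhds]
      intro ε hε
      filter_upwards [hall (ε / (n + 1)) (by positivity)] with R hR
      rw [dist_zero_right]
      refine (hR τ hτ).trans_lt ?_
      rw [mul_div_assoc', div_lt_iff₀ (by positivity)]
      linarith
    simpa using this.const_mul (Complex.exp (ω * τ))

/-- The global relation between the transforms of a solution and its boundary values. -/
theorem IsSolution.global_relation {n : ℕ} (hn : 0 < n) {a : ℂ} {T : ℝ} {q : ℝ → ℝ → ℂ}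
    (hq : IsSolution n a T q) {ξ : ℂ} (hξ : ξ.im ≤ 0) {t : ℝ} (ht0 : 0 < t) (ht : t < T) :
    Complex.exp (symbol n a ξ * t) * halfLineTransform (q t) ξ - halfLineTransform (q 0) ξ =
      a * (-Complex.I) ^ n * ∑ m ∈ Finset.range n, (Complex.I * ξ) ^ (n - 1 - m) *
        ∫ τ in (0 : ℝ)..t, Complex.exp (symbol n a ξ * τ) * dx m (q τ) 0 := by
  set ω := symbol n a ξ with hω
  have hT : 0 ≤ T := by linarith
  have hE : Continuous fun τ : ℝ => Complex.exp (ω * τ) := by fun_prop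
  have i1 := integrableOn_planeWave_mul hξ (hq.integrable t ⟨ht0.le, ht.le⟩)
  have i0 := integrableOn_planeWave_mul hξ (hq.integrable 0 ⟨le_rfl, hT⟩)
  have hlhs := intervalIntegral_tendsto_integral_Ioi 0
    ((i1.const_mul (Complex.exp (ω * t))).sub i0) tendsto_id
  have hBc : ∀ x : ℝ, Continuous fun τ => boundaryForm n ξ (fun m => clampDx T q m τ x) x := by
    intro x
    refine continuous_boundaryForm n ξ (fun m hm => ?_) continuous_const
    exact (hq.continuous_clampDx hT hm).comp (by fun_prop : Continuous fun τ : ℝ => (τ, x))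
  have hrhs := ((hq.tendsto_integral_boundaryForm hξ ω ht0 ht).sub_const
    (∫ τ in (0 : ℝ)..t, Complex.exp (ω * τ) *
      boundaryForm n ξ (fun m => clampDx T q m τ 0) 0)).const_mul (-(a * (-Complex.I) ^ n))
  have heq := tendsto_nhds_unique (hlhs.congr' (by
    filter_upwards [eventually_gt_atTop (0 : ℝ)] with R hR
    have := hq.green_identity_zero hn ξ ht0 ht hR
    rw [← hω] at this
    simp_rw [mul_sub (Complex.exp _)] at this
    have hsub := intervalIntegral.integral_sub (((hE.mul (hBc R)).intervalIntegrable 0 t :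
      IntervalIntegrable (fun τ : ℝ => Complex.exp (ω * τ) *
        boundaryForm n ξ (fun m => clampDx T q m τ R) R) volume 0 t))
      ((hE.mul (hBc 0)).intervalIntegrable 0 t : IntervalIntegrable (fun τ : ℝ =>
        Complex.exp (ω * τ) * boundaryForm n ξ (fun m => clampDx T q m τ 0) 0) volume 0 t)
    simp only [Pi.mul_apply] at hsub
    rw [hsub] at this
    rw [← this]
    apply intervalIntegral.integral_congr
    intro x _
    simp only [Pi.sub_apply]
    ring)) hrhs
  simp only [Pi.sub_apply] at heq
  rw [integral_sub (i1.const_mul _) i0, integral_const_mul] at heq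
  have e1 : Complex.exp (ω * t) * halfLineTransform (q t) ξ - halfLineTransform (q 0) ξ =
      Complex.exp (ω * t) * (∫ x in Ioi (0 : ℝ), planeWave ξ x * q t x) -
        ∫ x in Ioi (0 : ℝ), planeWave ξ x * q 0 x := rfl
  rw [e1, heq, zero_sub, neg_mul_neg]
  congr 1
  have e2 : ∀ τ : ℝ, Complex.exp (ω * τ) * boundaryForm n ξ (fun m => clampDx T q m τ 0) 0 =
      ∑ m ∈ Finset.range n, (Complex.I * ξ) ^ (n - 1 - m) *
        (Complex.exp (ω * τ) * clampDx T q m τ 0) := by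
    intro τ
    unfold boundaryForm
    rw [Finset.mul_sum]
    refine Finset.sum_congr rfl fun m _ => ?_
    simp only [planeWave, Complex.ofReal_zero, mul_zero, zero_mul, neg_zero, Complex.exp_zero]
    ring
  simp_rw [e2]
  rw [intervalIntegral.integral_finsetSum]
  · refine Finset.sum_congr rfl fun m _ => ?_
    rw [intervalIntegral.integral_const_mul]
    congr 1
    apply intervalIntegral.integral_congr
    intro τ hτ
    rw [uIcc_of_le ht0.le] at hτ
    simp only [clampDx_eq q m (⟨hτ.1, hτ.2.trans ht.le⟩ : τ ∈ Icc 0 T) le_rfl]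
  · intro m hm
    refine (continuous_const.mul (hE.mul ?_)).intervalIntegrable _ _
    exact (hq.continuous_clampDx hT (Finset.mem_range.mp hm)).comp
      (by fun_prop : Continuous fun τ : ℝ => (τ, (0 : ℝ)))

/-! ### The half-line transform of the initial datum -/

theorem halfLineTransform_eq (f : ℝ → ℂ) (ξ : ℂ) :
    halfLineTransform f ξ = ∫ x in Ioi (0 : ℝ), planeWave ξ x * f x := rfl

theorem norm_halfLineTransform_le {ξ : ℂ} (hξ : ξ.im ≤ 0) {f : ℝ → ℂ}
    (hf : IntegrableOn f (Ioi 0)) : ‖halfLineTransform f ξ‖ ≤ ∫ x in Ioi (0 : ℝ), ‖f x‖ := by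
  rw [halfLineTransform_eq]
  refine norm_integral_le_of_norm_le hf.norm ?_
  refine (ae_restrict_iff' measurableSet_Ioi).mpr (Eventually.of_forall fun x hx => ?_)
  rw [norm_mul]
  exact mul_le_of_le_one_left (norm_nonneg _) (norm_planeWave_le_one hξ (le_of_lt hx))

theorem continuousOn_halfLineTransform {f : ℝ → ℂ} (hf : IntegrableOn f (Ioi 0)) :
    ContinuousOn (halfLineTransform f) {ξ : ℂ | ξ.im ≤ 0} := by
  have e : halfLineTransform f = fun ξ => ∫ x in Ioi (0 : ℝ), planeWave ξ x * f x := rfl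
  rw [e]
  apply continuousOn_of_dominated (bound := fun x => ‖f x‖)
  · intro ξ _
    exact (continuous_planeWave ξ).aestronglyMeasurable.mul hf.aestronglyMeasurable
  · intro ξ hξ
    refine (ae_restrict_iff' measurableSet_Ioi).mpr (Eventually.of_forall fun x hx => ?_)
    rw [norm_mul]
    exact mul_le_of_le_one_left (norm_nonneg _) (norm_planeWave_le_one hξ (le_of_lt hx))
  · exact hf.norm
  · refine Eventually.of_forall fun x => ?_
    unfold planeWave
    fun_prop

theorem differentiableOn_halfLineTransform {f : ℝ → ℂ} (hf : IntegrableOn f (Ioi 0)) :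
    DifferentiableOn ℂ (halfLineTransform f) {ξ : ℂ | ξ.im < 0} := by
  intro ξ₀ hξ₀
  have hξ₀ : ξ₀.im < 0 := hξ₀
  set δ := -ξ₀.im / 2 with hδ
  have hδ0 : 0 < δ := by rw [hδ]; linarith
  have hs : {ξ : ℂ | ξ.im < -δ} ∈ 𝓝 ξ₀ := by
    refine (isOpen_lt Complex.continuous_im continuous_const).mem_nhds ?_
    simp only [mem_ofPred_eq, hδ]
    linarith
  have hm : ∀ ξ, AEStronglyMeasurable (fun x => planeWave ξ x * f x)
      (volume.restrict (Ioi 0)) := fun ξ =>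
    (continuous_planeWave ξ).aestronglyMeasurable.mul hf.aestronglyMeasurable
  have key := hasDerivAt_integral_of_dominated_loc_of_deriv_le (μ := volume.restrict (Ioi 0))
    (F := fun ξ x => planeWave ξ x * f x)
    (F' := fun ξ x => -(Complex.I * x) * (planeWave ξ x * f x))
    (bound := fun x => 1 / δ * ‖f x‖) hs (Eventually.of_forall hm)
    (integrableOn_planeWave_mul hξ₀.le hf)
    ((Continuous.aestronglyMeasurable (by fun_prop)).mul (hm ξ₀)) ?_ (hf.norm.const_mul _) ?_
  · exact (key.2.differentiableAt).differentiableWithinAt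
  · refine (ae_restrict_iff' measurableSet_Ioi).mpr (Eventually.of_forall fun x hx ξ hξ => ?_)
    have hx : 0 < x := hx
    have hξ : ξ.im < -δ := hξ
    rw [norm_mul, norm_mul, norm_neg, norm_mul, Complex.norm_I, one_mul, Complex.norm_real,
      Real.norm_of_nonneg hx.le, ← mul_assoc, norm_planeWave]
    gcongr
    rw [le_div_iff₀ hδ0]
    have h1 : Real.exp (x * ξ.im) ≤ Real.exp (-(x * δ)) := by
      apply Real.exp_le_exp.mpr; nlinarith
    have h2 : x * δ ≤ Real.exp (x * δ) := by linarith [Real.add_one_le_exp (x * δ)]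
    calc x * Real.exp (x * ξ.im) * δ ≤ x * Real.exp (-(x * δ)) * δ := by gcongr
      _ = x * δ * Real.exp (-(x * δ)) := by ring
      _ ≤ Real.exp (x * δ) * Real.exp (-(x * δ)) := by gcongr
      _ = 1 := by rw [← Real.exp_add]; simp
  · refine Eventually.of_forall fun x ξ _ => ?_
    have h : HasDerivAt (fun ξ : ℂ => planeWave ξ x) (planeWave ξ x * -(Complex.I * x * 1)) ξ :=
      (((hasDerivAt_id ξ).const_mul (Complex.I * (x : ℂ))).neg).cexp
    refine (h.mul_const (f x)).congr_deriv ?_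
    ring

/-- Integration by parts. There is no contribution from infinity, since an integrable function with
integrable derivative tends to `0`. -/
theorem mul_halfLineTransform_dx {N : ℕ} {f : ℝ → ℂ} (hf : ContDiffOn ℝ N f (Ici 0)) {m : ℕ}
    (hm : m < N) (h0 : IntegrableOn (dx m f) (Ioi 0)) (h1 : IntegrableOn (dx (m + 1) f) (Ioi 0))
    {ξ : ℂ} (hξ : ξ.im ≤ 0) :
    Complex.I * ξ * halfLineTransform (dx m f) ξ =
      dx m f 0 + halfLineTransform (dx (m + 1) f) ξ := by
  have i0 := integrableOn_planeWave_mul hξ h0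
  have i1 := integrableOn_planeWave_mul hξ h1
  have hder : ∀ x ∈ Ioi (0 : ℝ), HasDerivAt (fun x => planeWave ξ x * dx m f x)
      (planeWave ξ x * dx (m + 1) f x - Complex.I * ξ * (planeWave ξ x * dx m f x)) x := by
    intro x hx
    refine ((hasDerivAt_planeWave ξ x).mul (hasDerivAt_dx hf hm hx)).congr_deriv ?_
    ring
  have hlim0 := tendsto_zero_of_hasDerivAt_of_integrableOn_Ioi
    (fun x hx => hasDerivAt_dx hf hm hx) h1 h0
  have hlim : Tendsto (fun x => planeWave ξ x * dx m f x) atTop (𝓝 0) := by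
    refine squeeze_zero_norm' ?_ (tendsto_zero_iff_norm_tendsto_zero.mp hlim0)
    filter_upwards [eventually_ge_atTop (0 : ℝ)] with x hx
    rw [norm_mul]
    exact mul_le_of_le_one_left (norm_nonneg _) (norm_planeWave_le_one hξ hx)
  have hcont : ContinuousWithinAt (fun x => planeWave ξ x * dx m f x) (Ici 0) 0 :=
    (continuous_planeWave ξ).continuousWithinAt.mul (continuousOn_dx hf hm.le 0 self_mem_Ici)
  have h := integral_Ioi_of_hasDerivAt_of_tendsto hcont hder (i1.sub (i0.const_mul _)) hlim
  rw [integral_sub i1 (i0.const_mul _), integral_const_mul] at h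
  have hp : planeWave ξ 0 = 1 := by simp [planeWave]
  rw [hp, one_mul] at h
  rw [halfLineTransform_eq, halfLineTransform_eq]
  linear_combination -h

theorem pow_mul_halfLineTransform {N : ℕ} {f : ℝ → ℂ} (hf : ContDiffOn ℝ N f (Ici 0))
    (hi : ∀ m ≤ N, IntegrableOn (dx m f) (Ioi 0)) {ξ : ℂ} (hξ : ξ.im ≤ 0) {k : ℕ} (hk : k ≤ N) :
    (Complex.I * ξ) ^ k * halfLineTransform f ξ =
      (∑ m ∈ Finset.range k, (Complex.I * ξ) ^ (k - 1 - m) * dx m f 0) +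
        halfLineTransform (dx k f) ξ := by
  induction k with
  | zero => simp [dx_zero]
  | succ k ih =>
    have h := mul_halfLineTransform_dx hf (by omega) (hi k (by omega)) (hi (k + 1) hk) hξ
    have e : ∑ m ∈ Finset.range k, (Complex.I * ξ) ^ (k + 1 - 1 - m) * dx m f 0 =
        Complex.I * ξ * ∑ m ∈ Finset.range k, (Complex.I * ξ) ^ (k - 1 - m) * dx m f 0 := by
      rw [Finset.mul_sum]
      refine Finset.sum_congr rfl fun m hm => ?_
      have hm := Finset.mem_range.mp hm
      rw [← mul_assoc, ← pow_succ', show k - 1 - m + 1 = k + 1 - 1 - m by omega]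
    rw [Finset.sum_range_succ, e, pow_succ', mul_assoc, ih (by omega), mul_add, h]
    have e2 : k + 1 - 1 - k = 0 := by omega
    rw [e2, pow_zero]
    ring

theorem IsInitialDatum.contDiffOn' {n : ℕ} {qo : ℝ → ℂ} (h : IsInitialDatum n qo) :
    ContDiffOn ℝ (n + 1 : ℕ) qo (Ici 0) := by exact_mod_cast h.contDiffOn

theorem IsInitialDatum.integrableOn {n : ℕ} {qo : ℝ → ℂ} (h : IsInitialDatum n qo) :
    IntegrableOn qo (Ioi 0) := by
  have := h.integrable 0 (Nat.zero_le _)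
  rwa [dx_zero] at this

/-- One integration by parts gives decay of order `1 / |ξ|`. -/
theorem IsInitialDatum.norm_transform_le {n : ℕ} {qo : ℝ → ℂ} (h : IsInitialDatum n qo) :
    ∃ C, 0 ≤ C ∧ ∀ ξ : ℂ, ξ.im ≤ 0 → ‖halfLineTransform qo ξ‖ * (1 + ‖ξ‖) ≤ C := by
  refine ⟨(∫ x in Ioi (0 : ℝ), ‖qo x‖) + (‖qo 0‖ + ∫ x in Ioi (0 : ℝ), ‖dx 1 qo x‖), ?_,
    fun ξ hξ => ?_⟩
  · have h1 : 0 ≤ ∫ x in Ioi (0 : ℝ), ‖qo x‖ := integral_nonneg fun _ => norm_nonneg _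
    have h2 : 0 ≤ ∫ x in Ioi (0 : ℝ), ‖dx 1 qo x‖ := integral_nonneg fun _ => norm_nonneg _
    positivity
  · have h0 := norm_halfLineTransform_le hξ h.integrableOn
    have h1 := norm_halfLineTransform_le hξ (h.integrable 1 (by omega))
    have hp := pow_mul_halfLineTransform h.contDiffOn' h.integrable hξ (k := 1) (by omega)
    simp only [pow_one, Finset.range_one, Finset.sum_singleton, dx_zero, Nat.sub_self, pow_zero,
      one_mul] at hp
    have h3 : ‖ξ‖ * ‖halfLineTransform qo ξ‖ ≤ ‖qo 0‖ + ∫ x in Ioi (0 : ℝ), ‖dx 1 qo x‖ := by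
      have : ‖Complex.I * ξ * halfLineTransform qo ξ‖ = ‖ξ‖ * ‖halfLineTransform qo ξ‖ := by
        rw [norm_mul, norm_mul, Complex.norm_I, one_mul]
      rw [← this, hp]
      exact (norm_add_le _ _).trans (by gcongr)
    rw [mul_add, mul_one, mul_comm _ ‖ξ‖]
    exact add_le_add h0 h3

/-- The gained power lowers the growth from `n - 1` to `n - 2`, the order that the resolvent
integrals tolerate. -/
theorem IsInitialDatum.norm_pow_mul_transform_le {n : ℕ} (hn : 2 ≤ n) {qo : ℝ → ℂ}
    (h : IsInitialDatum n qo) : ∃ C, 0 ≤ C ∧ ∀ v < n, ∀ ξ : ℂ, ξ.im ≤ 0 →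
      ‖ξ‖ ^ v * ‖halfLineTransform qo ξ‖ ≤ C * (1 + ‖ξ‖) ^ (n - 2) := by
  obtain ⟨C, hC, hb⟩ := h.norm_transform_le
  refine ⟨C, hC, fun v hv ξ hξ => ?_⟩
  have h1 : ‖ξ‖ ^ v ≤ (1 + ‖ξ‖) ^ (n - 1) := by
    calc ‖ξ‖ ^ v ≤ (1 + ‖ξ‖) ^ v := by gcongr; linarith
      _ ≤ (1 + ‖ξ‖) ^ (n - 1) := by
        apply pow_le_pow_right₀ (by linarith [norm_nonneg ξ]) (by omega)
  calc ‖ξ‖ ^ v * ‖halfLineTransform qo ξ‖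
      ≤ (1 + ‖ξ‖) ^ (n - 1) * ‖halfLineTransform qo ξ‖ := by gcongr
    _ = ‖halfLineTransform qo ξ‖ * (1 + ‖ξ‖) * (1 + ‖ξ‖) ^ (n - 2) := by
      rw [show n - 1 = (n - 2) + 1 by omega, pow_succ]; ring
    _ ≤ C * (1 + ‖ξ‖) ^ (n - 2) := by gcongr; exact hb ξ hξ

/-- A function on a ray with an expansion in the powers `r^{n-1-k}`, `k ≥ 1`, up to an error
`O(r^{-2})`, satisfies the oscillatory bound. -/
theorem osc_of_expansion {n : ℕ} (hn : 1 ≤ n) {f : ℝ → ℂ} (hf : ContinuousOn f (Ici 0)) {ι : Type*}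
    (S : Finset ι) (b : ι → ℂ) (k : ι → ℕ) (hk : ∀ i ∈ S, 1 ≤ k i) {C : ℝ}
    (hC : ∀ r : ℝ, 1 ≤ r →
      ‖f r - ∑ i ∈ S, b i * ((r ^ (n - 1) * (r ^ k i)⁻¹ : ℝ) : ℂ)‖ ≤ C * (r ^ 2)⁻¹) :
    ∃ D, ∀ c : ℝ, |c| = 1 → ∀ τ, 0 < τ → ∀ A R, 1 ≤ A → A ≤ R →
      ‖∫ r in A..R, f r * phase n c τ r‖ ≤ D * ((1 + 1 / τ) / A) := by
  have hC0 : 0 ≤ C := by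
    have := (norm_nonneg _).trans (hC 1 le_rfl)
    simpa using this
  refine ⟨C + ∑ i ∈ S, ‖b i‖ * 2, fun c hc τ hτ A R hA hR => ?_⟩
  have hA0 : 0 < A := by linarith
  have hpos : ∀ r ∈ uIcc A R, 1 ≤ r := by
    intro r hr; rw [uIcc_of_le hR] at hr; linarith [hr.1]
  have hmc : ∀ i, ContinuousOn (fun r : ℝ => ((r ^ (n - 1) * (r ^ k i)⁻¹ : ℝ) : ℂ)) (uIcc A R) := by
    intro i
    refine Complex.continuous_ofReal.comp_continuousOn
      (ContinuousOn.mul (by fun_prop) (ContinuousOn.inv₀ (by fun_prop) ?_))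
    intro r hr
    have := hpos r hr
    positivity
  have hph := (continuous_phase_right n c τ).continuousOn (s := uIcc A R)
  have hmi : ∀ i ∈ S, IntervalIntegrable
      (fun r : ℝ => b i * (((r ^ (n - 1) * (r ^ k i)⁻¹ : ℝ) : ℂ) * phase n c τ r)) volume A R :=
    fun i _ => (continuousOn_const.mul ((hmc i).mul hph)).intervalIntegrable
  have hsc : ContinuousOn (fun r : ℝ => ∑ i ∈ S, b i * ((r ^ (n - 1) * (r ^ k i)⁻¹ : ℝ) : ℂ))
      (uIcc A R) := continuousOn_finsetSum _ fun i _ => continuousOn_const.mul (hmc i)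
  have hfc : ContinuousOn f (uIcc A R) :=
    hf.mono fun r hr => mem_Ici.mpr (zero_le_one.trans (hpos r hr))
  have hei : IntervalIntegrable (fun r : ℝ => (f r -
      ∑ i ∈ S, b i * ((r ^ (n - 1) * (r ^ k i)⁻¹ : ℝ) : ℂ)) * phase n c τ r) volume A R :=
    ((hfc.sub hsc).mul hph).intervalIntegrable
  have hsum : IntervalIntegrable (fun r : ℝ => ∑ i ∈ S,
      b i * (((r ^ (n - 1) * (r ^ k i)⁻¹ : ℝ) : ℂ) * phase n c τ r)) volume A R :=
    (continuousOn_finsetSum _ fun i _ =>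
      continuousOn_const.mul ((hmc i).mul hph)).intervalIntegrable
  have hdec : ∫ r in A..R, f r * phase n c τ r =
      (∫ r in A..R, (f r - ∑ i ∈ S, b i * ((r ^ (n - 1) * (r ^ k i)⁻¹ : ℝ) : ℂ)) *
        phase n c τ r) + ∑ i ∈ S, b i * ∫ r in A..R, ((r ^ (n - 1) * (r ^ k i)⁻¹ : ℝ) : ℂ) *
          phase n c τ r := by
    simp_rw [← intervalIntegral.integral_const_mul]
    rw [← intervalIntegral.integral_finsetSum hmi, ← intervalIntegral.integral_add hei hsum]
    congr 1
    funext r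
    simp_rw [← mul_assoc]
    rw [← Finset.sum_mul]
    ring
  have hinv : ∀ r ∈ uIcc A R, HasDerivAt (fun r : ℝ => -r⁻¹) ((r ^ 2)⁻¹) r := by
    intro r hr
    have := hpos r hr
    exact ((hasDerivAt_inv (by linarith : r ≠ 0)).neg).congr_deriv (by rw [neg_neg])
  have hinvc : ContinuousOn (fun r : ℝ => (r ^ 2)⁻¹) (uIcc A R) :=
    ContinuousOn.inv₀ (by fun_prop) fun r hr => by have := hpos r hr; positivity
  have hq : ∫ r in A..R, (r ^ 2)⁻¹ ≤ A⁻¹ := by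
    rw [intervalIntegral.integral_eq_sub_of_hasDerivAt hinv hinvc.intervalIntegrable]
    have hR0 : 0 < R := by linarith
    have : 0 < R⁻¹ := by positivity
    linarith
  have he : ‖∫ r in A..R, (f r - ∑ i ∈ S, b i * ((r ^ (n - 1) * (r ^ k i)⁻¹ : ℝ) : ℂ)) *
      phase n c τ r‖ ≤ C * A⁻¹ := by
    refine le_trans ?_ (mul_le_mul_of_nonneg_left hq hC0)
    rw [← intervalIntegral.integral_const_mul]
    apply intervalIntegral.norm_integral_le_of_norm_le hR _
      (hinvc.intervalIntegrable.const_mul C)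
    refine Eventually.of_forall fun r hr => ?_
    rw [norm_mul, norm_phase, mul_one]
    exact hC r (by linarith [hr.1])
  rw [hdec]
  have hτ1 : 0 < 1 / τ := by positivity
  have hAi : 0 < A⁻¹ := by positivity
  calc _ ≤ C * A⁻¹ + ∑ i ∈ S, ‖b i‖ * (2 / (τ * A)) := by
        refine (norm_add_le _ _).trans (add_le_add he (norm_sum_le_of_le _ fun i hi => ?_))
        rw [norm_mul]
        exact mul_le_mul_of_nonneg_left
          (norm_integral_monomial_mul_phase_le hn (hk i hi) hc hτ hA hR) (norm_nonneg _)
    _ = C * A⁻¹ + (∑ i ∈ S, ‖b i‖ * 2) * (1 / τ * A⁻¹) := by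
        rw [Finset.sum_mul]
        congr 1
        refine Finset.sum_congr rfl fun i _ => ?_
        field_simp
    _ ≤ _ := by
        have hS : 0 ≤ ∑ i ∈ S, ‖b i‖ * 2 := Finset.sum_nonneg fun i _ => by positivity
        rw [div_eq_mul_inv (1 + 1 / τ), add_mul]
        have h1 := mul_nonneg hC0 (mul_pos hτ1 hAi).le
        have h2 := mul_nonneg hS hAi.le
        nlinarith

theorem admissible_pow {n : ℕ} {p : ℕ} (hp : p + 2 ≤ n) :
    Admissible n fun r : ℝ => (r : ℂ) ^ p := by
  have hc : Continuous fun r : ℝ => (r : ℂ) ^ p := by fun_prop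
  refine ⟨hc.continuousOn, ⟨1, fun r hr => ?_⟩,
    osc_of_expansion (by omega) hc.continuousOn ({n - 1 - p} : Finset ℕ) (fun _ => 1) id ?_
      (C := 0) ?_⟩
  · rw [norm_pow, Complex.norm_real, Real.norm_of_nonneg hr, one_mul]
    calc r ^ p ≤ (1 + r) ^ p := by gcongr; linarith
      _ ≤ (1 + r) ^ (n - 2) := pow_le_pow_right₀ (by linarith) (by omega)
  · intro i hi
    rw [Finset.mem_singleton.mp hi]
    simp only [id]
    omega
  · intro r hr
    rw [Finset.sum_singleton, one_mul, zero_mul]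
    apply le_of_eq
    rw [norm_eq_zero, sub_eq_zero, ← Complex.ofReal_pow]
    congr 1
    have hr0 : r ^ (n - 1 - p) ≠ 0 := by positivity
    rw [id, eq_mul_inv_iff_mul_eq₀ hr0, ← pow_add]
    congr 1
    omega

/-- Integrating by parts `n + 1` times expands the transform in powers `r^{-m-1}`, `m ≤ n`. After
multiplication by `r^v` the exponents are `n - 1 - (n - v + m)` with `n - v + m ≥ 1`, and the
remainder is `O(r^{v-n-1})`, hence `O(r^{-2})`. -/
theorem IsInitialDatum.admissible {n : ℕ} (hn : 2 ≤ n) {qo : ℝ → ℂ} (h : IsInitialDatum n qo)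
    {v : ℕ} (hv : v < n) {η : ℂ} (hη : ‖η‖ = 1) (hηi : η.im ≤ 0) :
    Admissible n fun r : ℝ => (r : ℂ) ^ v * halfLineTransform qo (η * r) := by
  have him : ∀ r : ℝ, 0 ≤ r → (η * r).im ≤ 0 := by
    intro r hr
    rw [Complex.im_mul_ofReal]
    exact mul_nonpos_of_nonpos_of_nonneg hηi hr
  have hnorm : ∀ r : ℝ, 0 ≤ r → ‖η * r‖ = r := by
    intro r hr
    rw [norm_mul, hη, one_mul, Complex.norm_real, Real.norm_of_nonneg hr]
  have hη0 : η ≠ 0 := by rw [← norm_pos_iff, hη]; exact one_pos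
  have hc : ContinuousOn (fun r : ℝ => (r : ℂ) ^ v * halfLineTransform qo (η * r)) (Ici 0) := by
    refine ContinuousOn.mul (by fun_prop) ?_
    exact (continuousOn_halfLineTransform h.integrableOn).comp (by fun_prop) fun r hr => him r hr
  obtain ⟨C, hC, hb⟩ := h.norm_pow_mul_transform_le hn
  refine ⟨hc, ⟨C, fun r hr => ?_⟩,
    osc_of_expansion (by omega) hc (Finset.range (n + 1))
      (fun m => dx m qo 0 / (Complex.I * η) ^ (m + 1)) (fun m => n - v + m) ?_
      (C := ∫ x in Ioi (0 : ℝ), ‖dx (n + 1) qo x‖) ?_⟩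
  · have := hb v hv (η * r) (him r hr)
    rw [hnorm r hr] at this
    rwa [norm_mul, norm_pow, Complex.norm_real, Real.norm_of_nonneg hr]
  · intro m _
    omega
  · intro r hr
    have hr0 : (0 : ℝ) < r := by linarith
    have hrC : (r : ℂ) ≠ 0 := by exact_mod_cast hr0.ne'
    have hz : Complex.I * (η * r) ≠ 0 := mul_ne_zero Complex.I_ne_zero (mul_ne_zero hη0 hrC)
    have hp := pow_mul_halfLineTransform h.contDiffOn' h.integrable (him r hr0.le) (k := n + 1)
      le_rfl
    have hdiff : (r : ℂ) ^ v * halfLineTransform qo (η * r) - ∑ m ∈ Finset.range (n + 1),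
        dx m qo 0 / (Complex.I * η) ^ (m + 1) * ((r ^ (n - 1) * (r ^ (n - v + m))⁻¹ : ℝ) : ℂ) =
        (r : ℂ) ^ v * halfLineTransform (dx (n + 1) qo) (η * r) /
          (Complex.I * (η * r)) ^ (n + 1) := by
      rw [eq_div_iff (pow_ne_zero _ hz), sub_mul, Finset.sum_mul, mul_right_comm, mul_assoc, hp,
        mul_add, add_comm, add_sub_assoc]
      conv_rhs => rw [← add_zero ((r : ℂ) ^ v * halfLineTransform (dx (n + 1) qo) (η * r))]
      congr 1
      rw [sub_eq_zero, Finset.mul_sum]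
      refine Finset.sum_congr rfl fun m hm => ?_
      have hm := Finset.mem_range.mp hm
      have e1 : (Complex.I * (η * r)) ^ (n + 1) =
          (Complex.I * (η * r)) ^ (n + 1 - 1 - m) * (Complex.I * (η * r)) ^ (m + 1) := by
        rw [← pow_add]; congr 1; omega
      have e2 : (r : ℂ) ^ (n - v + m) * (r : ℂ) ^ v = (r : ℂ) ^ (n - 1) * (r : ℂ) ^ (m + 1) := by
        rw [← pow_add, ← pow_add]; congr 1; omega
      have e3 : (Complex.I * (η * r)) ^ (m + 1) = (Complex.I * η) ^ (m + 1) * (r : ℂ) ^ (m + 1) := by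
        rw [← mul_assoc, mul_pow]
      have hη1 : (Complex.I * η) ^ (m + 1) ≠ 0 :=
        pow_ne_zero _ (mul_ne_zero Complex.I_ne_zero hη0)
      have hr1 : (r : ℂ) ^ (n - v + m) ≠ 0 := pow_ne_zero _ hrC
      rw [e1, e3]
      generalize (Complex.I * (η * r)) ^ (n + 1 - 1 - m) = z at *
      push_cast
      generalize (Complex.I * η) ^ (m + 1) = y at *
      generalize (r : ℂ) ^ (n - v + m) = w at *
      field_simp
      linear_combination z * dx m qo 0 * e2
    rw [hdiff, norm_div, norm_mul, norm_pow, norm_pow, norm_mul, hnorm r hr0.le, Complex.norm_I,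
      one_mul, Complex.norm_real, Real.norm_of_nonneg hr0.le, div_le_iff₀ (by positivity)]
    have h1 := norm_halfLineTransform_le (him r hr0.le) (h.integrable (n + 1) le_rfl)
    have h2 : r ^ v ≤ (r ^ 2)⁻¹ * r ^ (n + 1) := by
      rw [inv_mul_eq_div, le_div_iff₀ (by positivity), ← pow_add]
      exact pow_le_pow_right₀ hr (by omega)
    have h3 : 0 ≤ ∫ x in Ioi (0 : ℝ), ‖dx (n + 1) qo x‖ := integral_nonneg fun _ => norm_nonneg _
    calc r ^ v * ‖halfLineTransform (dx (n + 1) qo) (η * r)‖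
        ≤ (r ^ 2)⁻¹ * r ^ (n + 1) * ∫ x in Ioi (0 : ℝ), ‖dx (n + 1) qo x‖ := by gcongr
      _ = _ := by ring

/-! ### Roots of unity and elimination by the generalized Vandermonde matrix -/

theorem rho_pow (n k : ℕ) : rho n ^ k = Complex.exp ((2 * k * Real.pi / n : ℝ) * Complex.I) := by
  rw [rho, ← Complex.exp_nat_mul]
  congr 1
  push_cast
  ring

theorem isPrimitiveRoot_rho {n : ℕ} (hn : n ≠ 0) : IsPrimitiveRoot (rho n) n :=
  Complex.isPrimitiveRoot_exp n hn

theorem rho_ne_zero (n : ℕ) : rho n ≠ 0 := Complex.exp_ne_zero _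

theorem norm_rho_pow (n k : ℕ) : ‖rho n ^ k‖ = 1 := by
  rw [rho_pow, Complex.norm_exp_ofReal_mul_I]

section Vandermonde

variable {n N : ℕ} {v : Fin N → ℕ}

/-- With `ζ^{n-1-v_j}` taken out of column `j`, a transposed Vandermonde matrix remains. Its nodes
`ρ^{n-1-v_j}` are distinct because the exponents are distinct and less than `n`. -/
theorem det_vand_ne_zero (hv : ∀ l, v l < n) (hinj : Function.Injective v) {ζ : ℂ} (hζ : ζ ≠ 0) :
    (vand n v ζ).det ≠ 0 := by
  have e : vand n v ζ = Matrix.of fun i j => ζ ^ (n - 1 - v j) *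
      (Matrix.vandermonde fun l => rho n ^ (n - 1 - v l)).transpose i j := by
    ext i j
    simp only [vand, Matrix.of_apply, Matrix.transpose_apply, Matrix.vandermonde_apply]
    rw [mul_pow, ← pow_mul, ← pow_mul, mul_comm (i : ℕ)]
  rw [e, Matrix.det_mul_row, Matrix.det_transpose]
  refine mul_ne_zero (Finset.prod_ne_zero_iff.mpr fun l _ => pow_ne_zero _ hζ)
    (Matrix.det_vandermonde_ne_zero_iff.mpr fun k l hkl => hinj ?_)
  have hk := hv k
  have hl := hv l
  have := (isPrimitiveRoot_rho (by omega : n ≠ 0)).pow_inj (by omega) (by omega) hkl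
  omega

/-- The weights that eliminate the unknown boundary values: up to sign the quotients
`det V_{ji} / det V`. -/
def weight (n : ℕ) {N : ℕ} (v : Fin N → ℕ) (j : Fin N) (ζ : ℂ) (i : Fin N) : ℂ :=
  (-1) ^ ((i : ℕ) + (j : ℕ)) * minorQuot n v j i ζ

/-- Cramer's rule: the signed minors are the cofactors in the expansion along column `j`. -/
theorem sum_weight_mul (j : Fin N) (ζ : ℂ) (f : Fin N → ℂ) :
    ∑ i, weight n v j ζ i * f i = ((vand n v ζ).updateCol j f).det / (vand n v ζ).det := by
  cases N with
  | zero => exact j.elim0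
  | succ N =>
    rw [Matrix.det_succ_column _ j, Finset.sum_div]
    refine Finset.sum_congr rfl fun i _ => ?_
    rw [Matrix.submatrix_updateCol_succAbove, Matrix.updateCol_self, weight, minorQuot, minorDet]
    ring

theorem sum_weight_mul_replace (j : Fin N) (u : ℕ) (ζ : ℂ) :
    ∑ i, weight n v j ζ i * (ζ * rho n ^ (i : ℕ)) ^ (n - 1 - u) = replaceQuot n v j u ζ :=
  sum_weight_mul j ζ _

/-- The weights form the `j`-th row of the inverse matrix; applied to the system they remove every
unknown except the one of order `v_j`. -/
theorem sum_weight_mul_vand (hv : ∀ l, v l < n) (hinj : Function.Injective v) {ζ : ℂ} (hζ : ζ ≠ 0)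
    (j l : Fin N) :
    ∑ i, weight n v j ζ i * (ζ * rho n ^ (i : ℕ)) ^ (n - 1 - v l) = if l = j then 1 else 0 := by
  have hd := det_vand_ne_zero hv hinj hζ
  rw [sum_weight_mul j ζ fun i : Fin N => (ζ * rho n ^ (i : ℕ)) ^ (n - 1 - v l)]
  split_ifs with h
  · subst h
    have : (vand n v ζ).updateCol l (fun i => (ζ * rho n ^ (i : ℕ)) ^ (n - 1 - v l)) =
        vand n v ζ := Matrix.updateCol_eq_self _ l
    rw [this, div_self hd]
  · rw [Matrix.det_zero_of_column_eq h, zero_div]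
    intro i
    rw [Matrix.updateCol_self, Matrix.updateCol_ne h]
    rfl

/-- Replacing `ζ` by `wζ` scales the columns of `V`. Both sides therefore solve the same invertible
linear system, whose solution is unique. -/
theorem weight_mul_left (hv : ∀ l, v l < n) (hinj : Function.Injective v) {w ζ : ℂ} (hw : w ≠ 0)
    (hζ : ζ ≠ 0) (j i : Fin N) :
    w ^ (n - 1 - v j) * weight n v j (w * ζ) i = weight n v j ζ i := by
  have hd := det_vand_ne_zero hv hinj hζ
  have hinv := Matrix.vecMul_injective_of_isUnit
    ((Matrix.isUnit_iff_isUnit_det _).mpr (isUnit_iff_ne_zero.mpr hd))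
  refine congrFun (hinv (a₁ := fun i => w ^ (n - 1 - v j) * weight n v j (w * ζ) i)
    (a₂ := weight n v j ζ) ?_) i
  ext l
  simp only [Matrix.vecMul, dotProduct, vand, Matrix.of_apply]
  rw [sum_weight_mul_vand hv hinj hζ]
  have h := sum_weight_mul_vand hv hinj (mul_ne_zero hw hζ) j l
  have e : ∑ i, w ^ (n - 1 - v j) * weight n v j (w * ζ) i *
      (ζ * rho n ^ (i : ℕ)) ^ (n - 1 - v l) = w ^ (n - 1 - v j) / w ^ (n - 1 - v l) *
        ∑ i, weight n v j (w * ζ) i * (w * ζ * rho n ^ (i : ℕ)) ^ (n - 1 - v l) := by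
    rw [Finset.mul_sum]
    refine Finset.sum_congr rfl fun i _ => ?_
    rw [mul_assoc w, mul_pow w]
    field_simp
  rw [e, h]
  split_ifs with hl
  · subst hl
    rw [mul_one, div_self (pow_ne_zero _ hw)]
  · rw [mul_zero]

/-- The quotient is homogeneous in `ζ` of degree `v_j - u`; the powers are arranged so that no
negative exponent is needed. -/
theorem replaceQuot_mul_left (hv : ∀ l, v l < n) (hinj : Function.Injective v) {w ζ : ℂ}
    (hw : w ≠ 0) (hζ : ζ ≠ 0) (j : Fin N) (u : ℕ) :
    w ^ (n - 1 - v j) * replaceQuot n v j u (w * ζ) =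
      w ^ (n - 1 - u) * replaceQuot n v j u ζ := by
  rw [← sum_weight_mul_replace, ← sum_weight_mul_replace, Finset.mul_sum, Finset.mul_sum]
  refine Finset.sum_congr rfl fun i _ => ?_
  rw [← mul_assoc, weight_mul_left hv hinj hw hζ, mul_assoc w, mul_pow w]
  ring

end Vandermonde

/-! ### Geometry of the sectors and rotation of the contours -/

/-- The argument of the bisector of the first sector. -/
def midRay (n : ℕ) (a : ℂ) : ℝ := (Real.pi - Complex.arg a) / n

theorem rayOne_eq {n : ℕ} (hn : n ≠ 0) (a : ℂ) (k : ℕ) :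
    rayOne n a k = midRay n a - Real.pi / (2 * n) + 2 * k * Real.pi / n := by
  unfold rayOne midRay; field_simp; ring

theorem rayTwo_eq {n : ℕ} (hn : n ≠ 0) (a : ℂ) (k : ℕ) :
    rayTwo n a k = midRay n a + Real.pi / (2 * n) + 2 * k * Real.pi / n := by
  unfold rayTwo midRay; field_simp; ring

/-- Homogeneity with `w = ρ^{n-N-1}` expresses both terms of `Λ` through the quotient at `ρ^{n-N}`.
The remaining exponentials are conjugate about the bisector and combine to a sine, which is later
cancelled by the reflection formula for `Γ`. -/
theorem I_mul_Lam {n N : ℕ} {v : Fin N → ℕ} (hN : N < n) (hv : ∀ l, v l < n)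
    (hinj : Function.Injective v) (a : ℂ) (j : Fin N) {u : ℕ} (hu : u < n) :
    Complex.I * Lam n a v j u = 2 * replaceQuot n v j u (rho n ^ (n - N)) *
      (Real.sin (Real.pi * (((v j : ℝ) - u) / n)) : ℂ) *
      Complex.exp (((v j : ℂ) - u) * (midRay n a * Complex.I)) := by
  have hn : n ≠ 0 := by omega
  have hnC : (n : ℂ) ≠ 0 := by exact_mod_cast hn
  have hρ := rho_ne_zero n
  have h := replaceQuot_mul_left hv hinj (pow_ne_zero (n - N - 1) hρ) hρ j u
  rw [← pow_succ, show n - N - 1 + 1 = n - N by omega] at h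
  have hs : replaceQuot n v j u (rho n) = replaceQuot n v j u (rho n ^ (n - N)) *
      Complex.exp (-(((v j : ℂ) - u) * (2 * (n - N - 1) * Real.pi / n) * Complex.I)) := by
    have hw : (rho n ^ (n - N - 1)) ^ (n - 1 - u) ≠ 0 := pow_ne_zero _ (pow_ne_zero _ hρ)
    rw [← mul_right_inj' hw, ← h, mul_left_comm, mul_comm]
    congr 1
    rw [rho_pow, ← Complex.exp_nat_mul, ← Complex.exp_nat_mul, ← Complex.exp_add]
    congr 1
    have := hv j
    have c1 : ((n - 1 - v j : ℕ) : ℂ) = n - 1 - v j := by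
      rw [Nat.cast_sub (by omega), Nat.cast_sub (by omega), Nat.cast_one]
    have c2 : ((n - 1 - u : ℕ) : ℂ) = n - 1 - u := by
      rw [Nat.cast_sub (by omega), Nat.cast_sub (by omega), Nat.cast_one]
    have c3 : ((n - N - 1 : ℕ) : ℂ) = n - N - 1 := by
      rw [Nat.cast_sub (by omega), Nat.cast_sub hN.le, Nat.cast_one]
    push_cast
    rw [c1, c2, c3]
    ring
  rw [Lam, hs, rayOne_eq hn, rayTwo_eq hn, mul_assoc (replaceQuot _ _ _ _ _) (Complex.exp (-_)),
    ← Complex.exp_add]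
  generalize replaceQuot n v j u (rho n ^ (n - N)) = R
  have hsin : (Real.sin (Real.pi * (((v j : ℝ) - u) / n)) : ℂ) =
      (Complex.exp (-(((v j : ℂ) - u) * Real.pi / n * Complex.I)) -
        Complex.exp (((v j : ℂ) - u) * Real.pi / n * Complex.I)) * Complex.I / 2 := by
    rw [Complex.ofReal_sin, Complex.sin]
    push_cast
    congr 4 <;> ring_nf
  have e1 : Complex.I * ((v j : ℂ) - u) *
      ((midRay n a - Real.pi / (2 * n) + 2 * (0 : ℕ) * Real.pi / n - Real.pi / (2 * n) : ℝ) : ℂ) =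
      -(((v j : ℂ) - u) * Real.pi / n * Complex.I) + ((v j : ℂ) - u) * (midRay n a * Complex.I) := by
    push_cast
    field_simp
    ring
  have e2 : -(((v j : ℂ) - u) * (2 * (n - N - 1) * Real.pi / n) * Complex.I) +
      Complex.I * ((v j : ℂ) - u) * ((midRay n a + Real.pi / (2 * n) +
        2 * (n - N - 1 : ℕ) * Real.pi / n + Real.pi / (2 * n) : ℝ) : ℂ) =
      ((v j : ℂ) - u) * Real.pi / n * Complex.I + ((v j : ℂ) - u) * (midRay n a * Complex.I) := by
    push_cast [Nat.cast_sub (show 1 ≤ n - N by omega), Nat.cast_sub hN.le]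
    field_simp
    ring
  rw [e1, e2, Complex.exp_add, Complex.exp_add, hsin]
  ring

section Sectors

variable {n : ℕ} {a : ℂ}

/-- Counted from `0`, the sectors in the lower half-plane are the last `N`, and their closures have
arguments in `[π, 2π]`. This is where the conditions on `a` enter. -/
theorem lowerCount_lt_and_ray_bounds (hn : 2 ≤ n) (ha : ‖a‖ = 1)
    (ha_even : Even n → 0 ≤ a.re) (ha_odd : Odd n → a.re = 0) :
    lowerCount n a < n ∧ ∀ k, n - lowerCount n a ≤ k → k < n →
      Real.pi ≤ rayOne n a k ∧ rayTwo n a k ≤ 2 * Real.pi := by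
  have hpi := Real.pi_pos
  have hn0 : (0 : ℝ) < n := by exact_mod_cast (by omega : 0 < n)
  have e1 : ∀ k, rayOne n a k = (Real.pi / 2 - Complex.arg a + 2 * k * Real.pi) / n := by
    intro k; unfold rayOne; field_simp; ring
  have e2 : ∀ k, rayTwo n a k = (3 * Real.pi / 2 - Complex.arg a + 2 * k * Real.pi) / n := by
    intro k; unfold rayTwo; field_simp; ring
  simp only [e1, e2, le_div_iff₀ hn0, div_le_iff₀ hn0]
  rcases Nat.even_or_odd n with hev | hodd
  · have h := abs_le.mp (Complex.abs_arg_le_pi_div_two_iff.mpr (ha_even hev))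
    obtain ⟨m, rfl⟩ := even_iff_two_dvd.mp hev
    rw [lowerCount_even m (by omega) a (ha_even hev)]
    refine ⟨by omega, fun k hk hk2 => ?_⟩
    have hk' : (m : ℝ) ≤ k := by exact_mod_cast (by omega : m ≤ k)
    have hk3 : (k : ℝ) + 1 ≤ 2 * m := by exact_mod_cast hk2
    have := mul_le_mul_of_nonneg_right hk' hpi.le
    have := mul_le_mul_of_nonneg_right hk3 hpi.le
    push_cast
    constructor <;> nlinarith
  · have hre := ha_odd hodd
    have him : a.im = 1 ∨ a.im = -1 := by
      have h2 : a.im ^ 2 = 1 := by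
        have := Complex.sq_norm a
        rw [ha, Complex.normSq_apply, hre] at this
        nlinarith
      exact mul_self_eq_one_iff.mp (by rw [← sq, h2])
    obtain ⟨m, rfl⟩ := hodd
    rcases him with him | him
    · obtain rfl : a = Complex.I := Complex.ext hre him
      rw [lowerCount_odd_I, Complex.arg_I]
      refine ⟨by omega, fun k hk hk2 => ?_⟩
      have hk' : (m : ℝ) + 1 ≤ k := by exact_mod_cast (by omega : m + 1 ≤ k)
      have hk3 : (k : ℝ) ≤ 2 * m := by exact_mod_cast Nat.lt_succ_iff.mp hk2
      have := mul_le_mul_of_nonneg_right hk' hpi.le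
      have := mul_le_mul_of_nonneg_right hk3 hpi.le
      push_cast
      constructor <;> nlinarith
    · obtain rfl : a = -Complex.I := Complex.ext (by simpa using hre) (by simpa using him)
      rw [lowerCount_odd_neg_I, Complex.arg_neg_I]
      refine ⟨by omega, fun k hk hk2 => ?_⟩
      have hk' : (m : ℝ) ≤ k := by exact_mod_cast (by omega : m ≤ k)
      have hk3 : (k : ℝ) ≤ 2 * m := by exact_mod_cast Nat.lt_succ_iff.mp hk2
      have := mul_le_mul_of_nonneg_right hk' hpi.le
      have := mul_le_mul_of_nonneg_right hk3 hpi.le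
      push_cast
      constructor <;> nlinarith

theorem rho_pow_mul_exp (n k : ℕ) (θ : ℝ) :
    rho n ^ k * Complex.exp (θ * Complex.I) =
      Complex.exp ((θ + 2 * k * Real.pi / n : ℝ) * Complex.I) := by
  rw [rho_pow, ← Complex.exp_add]
  congr 1
  push_cast
  ring

theorem im_rho_pow_mul_exp_nonpos (hn : n ≠ 0) {k : ℕ}
    (h : Real.pi ≤ rayOne n a k ∧ rayTwo n a k ≤ 2 * Real.pi) {θ : ℝ}
    (hθ : θ ∈ Icc (midRay n a - Real.pi / (2 * n)) (midRay n a + Real.pi / (2 * n))) :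
    (rho n ^ k * Complex.exp (θ * Complex.I)).im ≤ 0 := by
  rw [rayOne_eq hn, rayTwo_eq hn] at h
  rw [rho_pow_mul_exp, Complex.exp_ofReal_mul_I_im, ← Real.sin_sub_two_pi]
  exact Real.sin_nonpos_of_nonpos_of_neg_pi_le (by linarith [hθ.2]) (by linarith [hθ.1])

theorem im_rho_pow_mul_exp_neg (hn : n ≠ 0) {k : ℕ}
    (h : Real.pi ≤ rayOne n a k ∧ rayTwo n a k ≤ 2 * Real.pi) {θ : ℝ}
    (hθ : θ ∈ Ioo (midRay n a - Real.pi / (2 * n)) (midRay n a + Real.pi / (2 * n))) :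
    (rho n ^ k * Complex.exp (θ * Complex.I)).im < 0 := by
  rw [rayOne_eq hn, rayTwo_eq hn] at h
  rw [rho_pow_mul_exp, Complex.exp_ofReal_mul_I_im, ← Real.sin_sub_two_pi]
  exact Real.sin_neg_of_neg_of_neg_pi_lt (by linarith [hθ.2]) (by linarith [hθ.1])

theorem symbol_rho_pow_mul (hn : n ≠ 0) (k : ℕ) (ξ : ℂ) :
    symbol n a (rho n ^ k * ξ) = symbol n a ξ := by
  rw [symbol, symbol, mul_pow, ← pow_mul, mul_comm k, pow_mul, (isPrimitiveRoot_rho hn).pow_eq_one,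
    one_pow, one_mul]

/-- The substitution `ξ ↦ ρ^k ξ` carries the boundary of the first sector to that of the `k`-th. -/
theorem HasContourIntegral.of_zero (hn : n ≠ 0) {k : ℕ} {f f₀ : ℂ → ℂ} {J : ℂ}
    (hf : ∀ ξ, f (rho n ^ k * ξ) * rho n ^ k = f₀ ξ) (h : HasContourIntegral n a 0 f₀ J) :
    HasContourIntegral n a k f J := by
  have key : ∀ θ J, HasRayIntegral θ f₀ J → HasRayIntegral (θ + 2 * k * Real.pi / n) f J := by
    intro θ J h
    unfold HasRayIntegral at h ⊢
    refine h.congr fun R => ?_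
    congr 1
    ext r
    rw [← hf, ← rho_pow_mul_exp, mul_assoc, mul_left_comm (r : ℂ)]
  obtain ⟨I₁, I₂, h₁, h₂, e⟩ := h
  refine ⟨I₁, I₂, ?_, ?_, e⟩
  · have := key _ _ h₁
    rwa [show rayOne n a 0 + 2 * k * Real.pi / n = rayOne n a k by
      rw [rayOne_eq hn, rayOne_eq hn]; simp] at this
  · have := key _ _ h₂
    rwa [show rayTwo n a 0 + 2 * k * Real.pi / n = rayTwo n a k by
      rw [rayTwo_eq hn, rayTwo_eq hn]; simp] at this

variable {N : ℕ} {v : Fin N → ℕ}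

theorem datumIntegrand_eq (qo : ℝ → ℂ) (t : ℝ) (j : Fin N) (k : ℕ) (ξ : ℂ) :
    datumIntegrand n a v qo t j k ξ = (∑ i : Fin N, weight n v j (rho n ^ (n - N - k)) i * n *
      halfLineTransform qo (rho n ^ (n - N - k + i) * ξ)) * (Complex.I * ξ) ^ v j *
        Complex.exp (-(symbol n a ξ * t)) := rfl

/-- The homogeneity of the weights, the monomial and `dξ` contribute `ρ^{k(n-1-v_j)}`, `ρ^{k v_j}`
and `ρ^k`, whose product is `ρ^{kn} = 1`. -/
theorem datumIntegrand_rho_pow_mul (hn : n ≠ 0) (hv : ∀ l, v l < n) (hinj : Function.Injective v)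
    (qo : ℝ → ℂ) (t : ℝ) (j : Fin N) {k : ℕ} (hk : k < n - N) (ξ : ℂ) :
    datumIntegrand n a v qo t j k (rho n ^ k * ξ) * rho n ^ k = datumIntegrand n a v qo t j 0 ξ := by
  have hρ := rho_ne_zero n
  rw [datumIntegrand_eq, datumIntegrand_eq, symbol_rho_pow_mul hn, mul_left_comm Complex.I, mul_pow]
  have hw : ∀ i : Fin N, weight n v j (rho n ^ (n - N - k)) i =
      (rho n ^ k) ^ (n - 1 - v j) * weight n v j (rho n ^ (n - N)) i := fun i => by
    rw [← weight_mul_left hv hinj (pow_ne_zero k hρ) (pow_ne_zero (n - N - k) hρ) j i, ← pow_add,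
      show k + (n - N - k) = n - N by omega]
  have hsum : ∑ i : Fin N, weight n v j (rho n ^ (n - N - k)) i * n *
      halfLineTransform qo (rho n ^ (n - N - k + i) * (rho n ^ k * ξ)) =
      (rho n ^ k) ^ (n - 1 - v j) * ∑ i : Fin N, weight n v j (rho n ^ (n - N)) i * n *
        halfLineTransform qo (rho n ^ (n - N + i) * ξ) := by
    rw [Finset.mul_sum]
    refine Finset.sum_congr rfl fun i _ => ?_
    rw [hw, ← mul_assoc (rho n ^ (n - N - k + i)), ← pow_add,
      show n - N - k + (i : ℕ) + k = n - N + i by omega]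
    ring
  have h1 : (rho n ^ k) ^ (n - 1 - v j) * (rho n ^ k) ^ v j * rho n ^ k = 1 := by
    have := hv j
    rw [← pow_add, ← pow_succ, show n - 1 - v j + v j + 1 = n by omega, ← pow_mul, mul_comm k,
      pow_mul, (isPrimitiveRoot_rho hn).pow_eq_one, one_pow]
  rw [hsum, Nat.sub_zero]
  linear_combination (∑ i : Fin N, weight n v j (rho n ^ (n - N)) i * n *
    halfLineTransform qo (rho n ^ (n - N + i) * ξ)) * (Complex.I * ξ) ^ v j *
      Complex.exp (-(symbol n a ξ * t)) * h1

/-- The homogeneity of degree `v_j - u_l` compensates the factor `ρ^{k(v_j-u_l-1)}` of the monomial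
and the factor `ρ^k` of `dξ`. -/
theorem cornerIntegrand_rho_pow_mul (hn : n ≠ 0) (hv : ∀ l, v l < n)
    (hinj : Function.Injective v) {M : ℕ} (u : Fin M → ℕ) (qo : ℝ → ℂ) (t : ℝ) (j : Fin N) {k : ℕ}
    (hk : k < n - N) (ξ : ℂ) :
    cornerIntegrand n a v u qo t j k (rho n ^ k * ξ) * rho n ^ k =
      cornerIntegrand n a v u qo t j 0 ξ := by
  have hρ := rho_ne_zero n
  unfold cornerIntegrand
  rw [symbol_rho_pow_mul hn, mul_right_comm, Finset.sum_mul]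
  congr 1
  refine Finset.sum_congr rfl fun l hl => ?_
  have hl := (Finset.mem_filter.mp hl).2
  have hvj := hv j
  have h := replaceQuot_mul_left hv hinj (pow_ne_zero k hρ) (pow_ne_zero (n - N - k) hρ) j (u l)
  rw [← pow_add, show k + (n - N - k) = n - N by omega,
    show n - 1 - u l = n - 1 - v j + (v j - u l - 1 + 1) by omega, pow_add, mul_assoc] at h
  have h := mul_left_cancel₀ (pow_ne_zero _ (pow_ne_zero k hρ)) h
  rw [Nat.sub_zero, mul_left_comm Complex.I, mul_pow, h, pow_succ]
  ring

end Sectors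

section Indices

variable {n N : ℕ} {u : Fin (n - N) → ℕ} {v : Fin N → ℕ}

/-- The `n` indices cover a set of `n` elements, so counting gives injectivity of `u` and `v` and
disjointness of their ranges. -/
theorem elim_injective_of_range (hN : N ≤ n) (huv : range u ∪ range v = Iio n) :
    Function.Injective (Sum.elim u v) ∧ Finset.univ.image (Sum.elim u v) = Finset.range n := by
  have him : Finset.univ.image (Sum.elim u v) = Finset.range n := by
    ext m
    have : m ∈ range u ∪ range v ↔ m ∈ Iio n := by rw [huv]
    simpa using this
  refine ⟨?_, him⟩
  have hc : (Finset.univ.image (Sum.elim u v)).card =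
      (Finset.univ : Finset (Fin (n - N) ⊕ Fin N)).card := by
    rw [him, Finset.card_range, Finset.card_univ, Fintype.card_sum, Fintype.card_fin,
      Fintype.card_fin]
    omega
  have := Finset.card_image_iff.mp hc
  rwa [Finset.coe_univ, injOn_univ] at this

theorem sum_range_eq_add (hN : N ≤ n) (huv : range u ∪ range v = Iio n) (F : ℕ → ℂ) :
    ∑ m ∈ Finset.range n, F m = ∑ l, F (u l) + ∑ j, F (v j) := by
  obtain ⟨h1, h2⟩ := elim_injective_of_range hN huv
  rw [← h2, Finset.sum_image fun _ _ _ _ h => h1 h, Fintype.sum_sum_type]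
  rfl

end Indices

/-! ### Contour integrals over the boundary of the first sector -/

/-- The functions `h` on the closed sector of half-angle `π / (2n)` around the ray of argument `θ`
for which `∫ h(ξ) e^{-ω(ξ)t} dξ` over the boundary rays converges and the Laplace transform in `t`
is given by a residue. -/
structure SectorAdmissible (n : ℕ) (θ : ℝ) (h : ℂ → ℂ) : Prop where
  continuousOn : ContinuousOn (fun w => h (Complex.exp w))
    {w | w.im ∈ Icc (θ - Real.pi / (2 * n)) (θ + Real.pi / (2 * n))}
  differentiableOn : DifferentiableOn ℂ (fun w => h (Complex.exp w))
    {w | w.im ∈ Ioo (θ - Real.pi / (2 * n)) (θ + Real.pi / (2 * n))}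
  growth : ∃ C : ℝ, ∀ w : ℂ, w.im ∈ Icc (θ - Real.pi / (2 * n)) (θ + Real.pi / (2 * n)) →
    ‖h (Complex.exp w)‖ ≤ C * (1 + Real.exp w.re) ^ (n - 2)
  admissible : ∀ α ∈ Icc (θ - Real.pi / (2 * n)) (θ + Real.pi / (2 * n)),
    Admissible n fun r : ℝ => h (r * Complex.exp (α * Complex.I))

theorem SectorAdmissible.const_mul {n : ℕ} {θ : ℝ} {h : ℂ → ℂ} (hh : SectorAdmissible n θ h)
    (b : ℂ) : SectorAdmissible n θ fun ξ => b * h ξ := by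
  obtain ⟨C, hC⟩ := hh.growth
  refine ⟨hh.continuousOn.const_mul b, hh.differentiableOn.const_mul b, ⟨‖b‖ * C, fun w hw => ?_⟩,
    fun α hα => (hh.admissible α hα).const_mul b⟩
  rw [norm_mul, mul_assoc]
  exact mul_le_mul_of_nonneg_left (hC w hw) (norm_nonneg b)

theorem SectorAdmissible.sum {n : ℕ} {θ : ℝ} {ι : Type*} (s : Finset ι) {h : ι → ℂ → ℂ}
    (hh : ∀ i ∈ s, SectorAdmissible n θ (h i)) : SectorAdmissible n θ fun ξ => ∑ i ∈ s, h i ξ := by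
  have hg : ∀ i, ∃ C : ℝ, i ∈ s → ∀ w : ℂ,
      w.im ∈ Icc (θ - Real.pi / (2 * n)) (θ + Real.pi / (2 * n)) →
        ‖h i (Complex.exp w)‖ ≤ C * (1 + Real.exp w.re) ^ (n - 2) := fun i => by
    by_cases hi : i ∈ s
    · obtain ⟨C, hC⟩ := (hh i hi).growth
      exact ⟨C, fun _ => hC⟩
    · exact ⟨0, fun h => absurd h hi⟩
  choose C hC using hg
  refine ⟨continuousOn_finsetSum s fun i hi => (hh i hi).continuousOn,
    DifferentiableOn.fun_sum fun i hi => (hh i hi).differentiableOn,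
    ⟨∑ i ∈ s, C i, fun w hw => ?_⟩,
    fun α hα => Admissible.sum s fun i hi => (hh i hi).admissible α hα⟩
  rw [Finset.sum_mul]
  exact (norm_sum_le _ _).trans (Finset.sum_le_sum fun i hi => hC i hi w hw)

theorem sectorAdmissible_pow {n p : ℕ} (θ : ℝ) (hp : p + 2 ≤ n) :
    SectorAdmissible n θ fun ξ => ξ ^ p := by
  refine ⟨by fun_prop, by fun_prop, ⟨1, fun w _ => ?_⟩, fun α _ => ?_⟩
  · rw [norm_pow, Complex.norm_exp, one_mul]
    have h0 := Real.exp_pos w.re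
    calc Real.exp w.re ^ p ≤ (1 + Real.exp w.re) ^ p := by gcongr; linarith
      _ ≤ _ := pow_le_pow_right₀ (by linarith) (by omega)
  · refine Eq.mp ?_ ((admissible_pow hp).const_mul (Complex.exp (α * Complex.I) ^ p))
    congr 1
    ext r
    rw [mul_pow, mul_comm]

theorem IsInitialDatum.sectorAdmissible {n : ℕ} {a : ℂ} (hn : 2 ≤ n) {qo : ℝ → ℂ}
    (h : IsInitialDatum n qo) {v : ℕ} (hv : v < n) {k : ℕ}
    (hk : Real.pi ≤ rayOne n a k ∧ rayTwo n a k ≤ 2 * Real.pi) :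
    SectorAdmissible n (midRay n a) fun ξ => ξ ^ v * halfLineTransform qo (rho n ^ k * ξ) := by
  have hn0 : n ≠ 0 := by omega
  have hexp : ∀ w : ℂ, rho n ^ k * Complex.exp w =
      (Real.exp w.re : ℂ) * (rho n ^ k * Complex.exp (w.im * Complex.I)) := fun w => by
    conv_lhs => rw [← Complex.re_add_im w, Complex.exp_add]
    rw [Complex.ofReal_exp]
    ring
  have him : ∀ w : ℂ, w.im ∈ Icc (midRay n a - Real.pi / (2 * n))
      (midRay n a + Real.pi / (2 * n)) → (rho n ^ k * Complex.exp w).im ≤ 0 := fun w hw => by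
    rw [hexp, Complex.im_ofReal_mul]
    exact mul_nonpos_of_nonneg_of_nonpos (Real.exp_pos _).le (im_rho_pow_mul_exp_nonpos hn0 hk hw)
  have hnorm : ∀ w : ℂ, ‖rho n ^ k * Complex.exp w‖ = Real.exp w.re := fun w => by
    rw [norm_mul, norm_rho_pow, one_mul, Complex.norm_exp]
  obtain ⟨C, hC, hb⟩ := h.norm_pow_mul_transform_le hn
  refine ⟨?_, ?_, ⟨C, fun w hw => ?_⟩, fun α hα => ?_⟩
  · refine ContinuousOn.mul (by fun_prop) ?_
    exact (continuousOn_halfLineTransform h.integrableOn).comp (by fun_prop) him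
  · refine DifferentiableOn.mul (by fun_prop) ?_
    refine (differentiableOn_halfLineTransform h.integrableOn).comp (by fun_prop) fun w hw => ?_
    show (rho n ^ k * Complex.exp w).im < 0
    rw [hexp, Complex.im_ofReal_mul]
    exact mul_neg_of_pos_of_neg (Real.exp_pos _) (im_rho_pow_mul_exp_neg hn0 hk hw)
  · have := hb v hv _ (him w hw)
    rw [hnorm] at this
    rwa [norm_mul, norm_pow, Complex.norm_exp]
  · have hη : ‖rho n ^ k * Complex.exp (α * Complex.I)‖ = 1 := by
      rw [norm_mul, norm_rho_pow, Complex.norm_exp_ofReal_mul_I, one_mul]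
    refine Eq.mp ?_ ((h.admissible hn hv hη (im_rho_pow_mul_exp_nonpos hn0 hk hα)).const_mul
      (Complex.exp (α * Complex.I) ^ v))
    congr 1
    ext r
    rw [mul_pow, mul_left_comm (rho n ^ k), mul_comm (r : ℂ) (_ * _)]
    ring

/-- The point of the bisector of the first sector where `ω(ξ) = -s`. -/
def pole (n : ℕ) (a : ℂ) (s : ℝ) : ℂ :=
  Complex.exp ((Real.log s / n : ℝ) + midRay n a * Complex.I)

theorem pole_ne_zero (n : ℕ) (a : ℂ) (s : ℝ) : pole n a s ≠ 0 := Complex.exp_ne_zero _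

section Rays

variable {n : ℕ} {a : ℂ}

/-- The offset `β` is measured from the bisector: `β = 0` gives `ω = -rⁿ`, and `β = ∓π/2` gives the
boundary rays, where `ω = ±i rⁿ` and the exponential only oscillates. -/
theorem symbol_mul_exp (hn : n ≠ 0) (ha : ‖a‖ = 1) (r β : ℝ) :
    symbol n a (r * Complex.exp ((midRay n a + β / n : ℝ) * Complex.I)) =
      -((r : ℂ) ^ n * Complex.exp (β * Complex.I)) := by
  have hnC : (n : ℂ) ≠ 0 := by exact_mod_cast hn
  have ha' : a = Complex.exp (Complex.arg a * Complex.I) := by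
    have := Complex.norm_mul_exp_arg_mul_I a
    rw [ha] at this
    simpa using this.symm
  rw [symbol, mul_pow, mul_left_comm, ← mul_neg]
  congr 1
  rw [show a * Complex.exp ((midRay n a + β / n : ℝ) * Complex.I) ^ n =
      Complex.exp (Complex.arg a * Complex.I) *
        Complex.exp ((midRay n a + β / n : ℝ) * Complex.I) ^ n by rw [← ha'],
    ← Complex.exp_nat_mul, ← Complex.exp_add, neg_eq_neg_one_mul, ← Complex.exp_pi_mul_I,
    ← Complex.exp_add]
  congr 1
  rw [midRay]
  push_cast
  field_simp
  ring

theorem symbol_pole (hn : n ≠ 0) (ha : ‖a‖ = 1) {s : ℝ} (hs : 0 < s) :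
    symbol n a (pole n a s) = -s := by
  have h := symbol_mul_exp hn ha (Real.exp (Real.log s / n)) 0
  rw [zero_div, add_zero, ← Complex.ofReal_pow, ← Real.exp_nat_mul,
    mul_div_cancel₀ _ (by exact_mod_cast hn : (n : ℝ) ≠ 0), Real.exp_log hs] at h
  rw [pole, Complex.exp_add, ← Complex.ofReal_exp, h]
  simp

theorem exp_symbol_lower (hn : n ≠ 0) (ha : ‖a‖ = 1) (t r : ℝ) :
    Complex.exp (-(symbol n a (r * Complex.exp ((midRay n a - Real.pi / (2 * n) : ℝ) *
      Complex.I)) * t)) = phase n (-1) t r := by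
  have h := symbol_mul_exp hn ha r (-(Real.pi / 2))
  rw [show midRay n a + -(Real.pi / 2) / n = midRay n a - Real.pi / (2 * n) by
    field_simp; ring] at h
  have e : Complex.exp ((-(Real.pi / 2) : ℝ) * Complex.I) = -Complex.I := by
    rw [Complex.exp_mul_I, ← Complex.ofReal_cos, ← Complex.ofReal_sin, Real.cos_neg, Real.sin_neg,
      Real.cos_pi_div_two, Real.sin_pi_div_two]
    simp
  rw [h, e, phase]
  congr 1
  push_cast
  ring

theorem exp_symbol_upper (hn : n ≠ 0) (ha : ‖a‖ = 1) (t r : ℝ) :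
    Complex.exp (-(symbol n a (r * Complex.exp ((midRay n a + Real.pi / (2 * n) : ℝ) *
      Complex.I)) * t)) = phase n 1 t r := by
  have h := symbol_mul_exp hn ha r (Real.pi / 2)
  rw [show midRay n a + Real.pi / 2 / n = midRay n a + Real.pi / (2 * n) by
    field_simp] at h
  have e : Complex.exp ((Real.pi / 2 : ℝ) * Complex.I) = Complex.I := by
    rw [Complex.exp_mul_I, ← Complex.ofReal_cos, ← Complex.ofReal_sin,
      Real.cos_pi_div_two, Real.sin_pi_div_two]
    simp
  rw [h, e, phase]
  congr 1
  push_cast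
  ring

/-- The two rays have transforms with denominators `s + i rⁿ` and `s - i rⁿ`, the values of `s +
ω(ξ)` there. Their difference is a contour integral that Cauchy's formula reduces to the residue at
`pole n a s`. -/
theorem SectorAdmissible.exists_contourIntegral (hn : 2 ≤ n) (ha : ‖a‖ = 1) {h : ℂ → ℂ}
    (hh : SectorAdmissible n (midRay n a) h) :
    ∃ A : ℝ → ℂ, ContinuousOn A (Ioi 0) ∧
      (∀ t, 0 ≤ t → IntervalIntegrable A volume 0 t) ∧
      (∀ t : ℝ, 0 < t →
        HasContourIntegral n a 0 (fun ξ => h ξ * Complex.exp (-(symbol n a ξ * t))) (A t)) ∧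
      ∀ t, 0 ≤ t → ∃ K, ∀ s : ℝ, 1 ≤ s →
        ‖(∫ τ in (0 : ℝ)..t, (Real.exp (-(s * τ)) : ℂ) * A τ) -
          -(2 * Real.pi * Complex.I * (h (pole n a s) * pole n a s / (n * s)))‖ ≤
          K * Real.exp (-(s * t)) := by
  have hn0 : n ≠ 0 := by omega
  have hpi : 0 ≤ Real.pi / (2 * n) := by positivity
  set e₁ := Complex.exp ((midRay n a - Real.pi / (2 * n) : ℝ) * Complex.I) with he₁
  set e₂ := Complex.exp ((midRay n a + Real.pi / (2 * n) : ℝ) * Complex.I) with he₂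
  have ad₁ : Admissible n fun r : ℝ => h (r * e₁) * e₁ := by
    simpa only [mul_comm e₁] using
      (hh.admissible _ (left_mem_Icc.mpr (by linarith))).const_mul e₁
  have ad₂ : Admissible n fun r : ℝ => h (r * e₂) * e₂ := by
    simpa only [mul_comm e₂] using
      (hh.admissible _ (right_mem_Icc.mpr (by linarith))).const_mul e₂
  have c₁ : |(-1 : ℝ)| = 1 := by simp
  have c₂ : |(1 : ℝ)| = 1 := by simp
  refine ⟨fun t => improperInt n (-1) (fun r : ℝ => h (r * e₁) * e₁) t -
    improperInt n 1 (fun r : ℝ => h (r * e₂) * e₂) t,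
    (ad₁.continuousOn_improperInt c₁).sub (ad₂.continuousOn_improperInt c₂),
    fun t ht => (ad₁.intervalIntegrable_improperInt hn c₁ ht).sub
      (ad₂.intervalIntegrable_improperInt hn c₂ ht), fun t ht => ?_, fun t ht => ?_⟩
  · refine ⟨_, _, ?_, ?_, rfl⟩
    · refine (ad₁.tendsto_truncInt c₁ ht).congr fun R => ?_
      rw [truncInt]
      congr 1
      ext r
      rw [show rayOne n a 0 = midRay n a - Real.pi / (2 * n) by rw [rayOne_eq hn0]; simp]
      beta_reduce
      rw [exp_symbol_lower hn0 ha]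
      ring
    · refine (ad₂.tendsto_truncInt c₂ ht).congr fun R => ?_
      rw [truncInt]
      congr 1
      ext r
      rw [show rayTwo n a 0 = midRay n a + Real.pi / (2 * n) by rw [rayTwo_eq hn0]; simp]
      beta_reduce
      rw [exp_symbol_upper hn0 ha]
      ring
  · obtain ⟨K₁, h₁⟩ := ad₁.laplace_improperInt hn c₁ ht
    obtain ⟨K₂, h₂⟩ := ad₂.laplace_improperInt hn c₂ ht
    obtain ⟨C, hC⟩ := hh.growth
    refine ⟨K₁ + K₂, fun s hs => ?_⟩
    have hsec := sector_integral_sub hn (midRay n a) hh.continuousOn hh.differentiableOn hC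
      (by linarith : 0 < s)
    have hexp : ContinuousOn (fun τ : ℝ => (Real.exp (-(s * τ)) : ℂ)) (uIcc 0 t) := by fun_prop
    simp_rw [mul_sub]
    rw [intervalIntegral.integral_sub
      ((ad₁.intervalIntegrable_improperInt hn c₁ ht).continuousOn_mul hexp)
      ((ad₂.intervalIntegrable_improperInt hn c₂ ht).continuousOn_mul hexp), add_mul]
    refine le_trans (le_of_eq ?_) ((norm_sub_le _ _).trans (add_le_add (h₁ s hs) (h₂ s hs)))
    congr 1
    rw [pole, ← neg_mul, ← hsec]
    ring

end Rays

/-! ### Calculus of truncated Laplace transforms modulo exponentially small errors -/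

/-- `∫₀ᵗ e^{-sτ} f(τ) dτ`. -/
def truncLaplace (t : ℝ) (f : ℝ → ℂ) (s : ℝ) : ℂ :=
  ∫ τ in (0 : ℝ)..t, (Real.exp (-(s * τ)) : ℂ) * f τ

/-- `f` is continuous on `(0, t)` and integrable, and its Laplace transform truncated at `t` is
`F(s) + O(e^{-st})`. -/
structure LaplaceApprox (t : ℝ) (f F : ℝ → ℂ) : Prop where
  continuousOn : ContinuousOn f (Ioo 0 t)
  intervalIntegrable : IntervalIntegrable f volume 0 t
  bound : ∃ K, ∀ s : ℝ, 1 ≤ s → ‖truncLaplace t f s - F s‖ ≤ K * Real.exp (-(s * t))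

namespace LaplaceApprox

variable {t : ℝ} {f g F G : ℝ → ℂ}

theorem of_integrand (h : IntervalIntegrable f volume 0 t) (s : ℝ) :
    IntervalIntegrable (fun τ => (Real.exp (-(s * τ)) : ℂ) * f τ) volume 0 t :=
  h.continuousOn_mul (by fun_prop)

theorem congr_right (h : LaplaceApprox t f F) {K : ℝ}
    (hFG : ∀ s : ℝ, 1 ≤ s → ‖F s - G s‖ ≤ K * Real.exp (-(s * t))) : LaplaceApprox t f G := by
  obtain ⟨L, hL⟩ := h.bound
  refine ⟨h.continuousOn, h.intervalIntegrable, L + K, fun s hs => ?_⟩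
  rw [← sub_add_sub_cancel _ (F s), add_mul]
  exact (norm_add_le _ _).trans (add_le_add (hL s hs) (hFG s hs))

theorem congr_right_of_eq (h : LaplaceApprox t f F) (hFG : ∀ s : ℝ, 1 ≤ s → F s = G s) :
    LaplaceApprox t f G :=
  h.congr_right (K := 0) fun s hs => by rw [hFG s hs, sub_self, norm_zero, zero_mul]

theorem add (hf : LaplaceApprox t f F) (hg : LaplaceApprox t g G) :
    LaplaceApprox t (fun τ => f τ + g τ) fun s => F s + G s := by
  obtain ⟨K, hK⟩ := hf.bound
  obtain ⟨L, hL⟩ := hg.bound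
  refine ⟨hf.continuousOn.add hg.continuousOn, hf.intervalIntegrable.add hg.intervalIntegrable,
    K + L, fun s hs => ?_⟩
  have e : truncLaplace t (fun τ => f τ + g τ) s = truncLaplace t f s + truncLaplace t g s := by
    unfold truncLaplace
    simp_rw [mul_add]
    exact intervalIntegral.integral_add (of_integrand hf.intervalIntegrable s)
      (of_integrand hg.intervalIntegrable s)
  rw [e, add_sub_add_comm, add_mul]
  exact (norm_add_le _ _).trans (add_le_add (hK s hs) (hL s hs))

theorem const_mul (b : ℂ) (hf : LaplaceApprox t f F) :
    LaplaceApprox t (fun τ => b * f τ) fun s => b * F s := by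
  obtain ⟨K, hK⟩ := hf.bound
  refine ⟨hf.continuousOn.const_mul b, hf.intervalIntegrable.const_mul b, ‖b‖ * K,
    fun s hs => ?_⟩
  have e : truncLaplace t (fun τ => b * f τ) s = b * truncLaplace t f s := by
    unfold truncLaplace
    rw [← intervalIntegral.integral_const_mul]
    congr 1
    ext τ
    ring
  rw [e, ← mul_sub, norm_mul, mul_assoc]
  exact mul_le_mul_of_nonneg_left (hK s hs) (norm_nonneg b)

theorem zero (t : ℝ) : LaplaceApprox t (fun _ => 0) fun _ => 0 :=
  ⟨continuousOn_const, intervalIntegrable_const, 0, fun s _ => by simp [truncLaplace]⟩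

theorem sum {ι : Type*} (S : Finset ι) {f F : ι → ℝ → ℂ}
    (h : ∀ i ∈ S, LaplaceApprox t (f i) (F i)) :
    LaplaceApprox t (fun τ => ∑ i ∈ S, f i τ) fun s => ∑ i ∈ S, F i s := by
  classical
  induction S using Finset.induction_on with
  | empty => simpa using zero t
  | insert i S hi ih =>
    simp_rw [Finset.sum_insert hi]
    exact (h i (Finset.mem_insert_self i S)).add
      (ih fun k hk => h k (Finset.mem_insert_of_mem hk))

theorem of_continuousOn (ht : 0 ≤ t) (hf : ContinuousOn f (Icc 0 t)) :
    LaplaceApprox t f (truncLaplace t f) :=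
  ⟨hf.mono Ioo_subset_Icc_self, hf.intervalIntegrable_of_Icc ht, 0, fun s _ => by simp⟩

theorem eq_zero (h : LaplaceApprox t f fun _ => 0) {c : ℝ} (hc : c ∈ Ioo 0 t) : f c = 0 := by
  obtain ⟨K, hK⟩ := h.bound
  refine eq_zero_of_laplace_le h.intervalIntegrable h.continuousOn (K := K) (fun s hs => ?_) hc
  simpa [truncLaplace] using hK s hs

end LaplaceApprox

theorem exists_bounded_extension {T : ℝ} (hT : 0 ≤ T) {f : ℝ → ℂ} (hf : ContinuousOn f (Icc 0 T)) :
    ∃ F : ℝ → ℂ, Continuous F ∧ (∃ M, ∀ x, ‖F x‖ ≤ M) ∧ ∀ τ ∈ Icc 0 T, F τ = f τ := by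
  obtain ⟨M, hM⟩ := isCompact_Icc.exists_bound_of_continuousOn hf
  refine ⟨IccExtend hT ((Icc 0 T).domRestrict f), hf.domRestrict.Icc_extend', ⟨M, fun x => ?_⟩,
    fun τ hτ => ?_⟩
  · exact hM _ (projIcc 0 T hT x).2
  · rw [IccExtend_of_mem hT _ hτ]
    rfl

/-- Times up to `t` involve the density on `[0, t]` only, so it may be replaced by a bounded
continuous extension. -/
theorem LaplaceApprox.abel {α : ℝ} (hα0 : 0 ≤ α) (hα : α < 1) {t : ℝ} (ht : 0 ≤ t) {f : ℝ → ℂ}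
    (hf : ContinuousOn f (Icc 0 t)) : LaplaceApprox t (abel α f) fun s =>
      ((Real.Gamma (1 - α) * s ^ (α - 1) : ℝ) : ℂ) * truncLaplace t f s := by
  obtain ⟨F, hF, ⟨M, hM⟩, hFf⟩ := exists_bounded_extension ht hf
  have e : ∀ τ ∈ Icc 0 t, HalfLine.abel α f τ = HalfLine.abel α F τ := fun τ hτ =>
    abel_congr hτ.1 (fun σ hσ => (hFf σ ⟨hσ.1.le, hσ.2.le.trans hτ.2⟩).symm) α
  have hc : ContinuousOn (HalfLine.abel α f) (Icc 0 t) :=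
    ((continuousOn_abel hα hF hM).mono Icc_subset_Ici_self).congr e
  obtain ⟨K, hK⟩ := laplace_abel hα0 hα hF hM ht
  refine ⟨hc.mono Ioo_subset_Icc_self, hc.intervalIntegrable_of_Icc ht, K, fun s hs => ?_⟩
  have e1 : truncLaplace t (HalfLine.abel α f) s = truncLaplace t (HalfLine.abel α F) s :=
    intervalIntegral.integral_congr fun τ hτ => by
      rw [uIcc_of_le ht] at hτ
      simp only [e τ hτ]
  have e2 : truncLaplace t f s = truncLaplace t F s :=
    intervalIntegral.integral_congr fun τ hτ => by
      rw [uIcc_of_le ht] at hτ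
      simp only [hFf τ hτ]
  rw [e1, e2]
  exact hK s hs

/-- Integration by parts: the endpoint `t` falls into the error, while the value at `0` has to be
cancelled by the corner integral. -/
theorem truncLaplace_derivWithin {T : ℝ} {g : ℝ → ℂ} (hg : ContDiffOn ℝ 1 g (Icc 0 T)) {t : ℝ}
    (ht0 : 0 < t) (ht : t < T) (s : ℝ) :
    truncLaplace t (derivWithin g (Icc 0 T)) s =
      s * truncLaplace t g s - g 0 + (Real.exp (-(s * t)) : ℂ) * g t := by
  have hT : 0 < T := ht0.trans ht
  have hsub : Icc 0 t ⊆ Icc 0 T := Icc_subset_Icc_right ht.le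
  have hgc : ContinuousOn g (Icc 0 t) := hg.continuousOn.mono hsub
  have hdc : ContinuousOn (derivWithin g (Icc 0 T)) (Icc 0 t) :=
    (hg.continuousOn_derivWithin (uniqueDiffOn_Icc hT) le_rfl).mono hsub
  have hgi : IntervalIntegrable g volume 0 t := hgc.intervalIntegrable_of_Icc ht0.le
  have hdi : IntervalIntegrable (derivWithin g (Icc 0 T)) volume 0 t :=
    hdc.intervalIntegrable_of_Icc ht0.le
  have hexp : ∀ τ : ℝ, HasDerivAt (fun τ : ℝ => (Real.exp (-(s * τ)) : ℂ))
      (-s * (Real.exp (-(s * τ)) : ℂ)) τ := fun τ => by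
    have : HasDerivAt (fun τ : ℝ => Real.exp (-(s * τ))) (Real.exp (-(s * τ)) * -(s * 1)) τ :=
      ((hasDerivAt_id τ).const_mul s).neg.exp
    refine this.ofReal_comp.congr_deriv ?_
    push_cast
    ring
  have hd : ∀ τ ∈ Ioo 0 t, HasDerivAt (fun τ => (Real.exp (-(s * τ)) : ℂ) * g τ)
      (-s * ((Real.exp (-(s * τ)) : ℂ) * g τ) +
        (Real.exp (-(s * τ)) : ℂ) * derivWithin g (Icc 0 T) τ) τ := fun τ hτ => by
    have hτT : Icc 0 T ∈ 𝓝 τ := Icc_mem_nhds hτ.1 (hτ.2.trans ht)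
    have h := ((hg.differentiableOn one_ne_zero) τ (mem_of_mem_nhds hτT)).hasDerivWithinAt.hasDerivAt hτT
    refine ((hexp τ).mul h).congr_deriv ?_
    ring
  have h := intervalIntegral.integral_eq_sub_of_hasDerivAt_of_le ht0.le
    (ContinuousOn.mul (by fun_prop) hgc) hd
    (((LaplaceApprox.of_integrand hgi s).const_mul _).add (LaplaceApprox.of_integrand hdi s))
  rw [intervalIntegral.integral_add ((LaplaceApprox.of_integrand hgi s).const_mul _)
    (LaplaceApprox.of_integrand hdi s), intervalIntegral.integral_const_mul] at h
  unfold truncLaplace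
  simp only [Pi.mul_apply, mul_zero, neg_zero, Real.exp_zero] at h
  push_cast at h ⊢
  linear_combination h

/-! ### Matching the Abel coefficients with the residues -/

section Pole

variable {n : ℕ} {a : ℂ}

theorem norm_pole (s : ℝ) : ‖pole n a s‖ = Real.exp (Real.log s / n) := by
  rw [pole, Complex.norm_exp]
  congr 1
  simp

/-- The modulus of the pole is `s^{1/n}`, so division by `s` keeps powers up to `n` bounded and
errors of size `e^{-st}` keep their form. -/
theorem norm_pole_pow_le (hn : n ≠ 0) {m : ℕ} (hm : m ≤ n) {s : ℝ} (hs : 1 ≤ s) :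
    ‖pole n a s‖ ^ m ≤ s := by
  have h1 : 1 ≤ ‖pole n a s‖ := by
    rw [norm_pole]
    exact Real.one_le_exp (div_nonneg (Real.log_nonneg hs) (Nat.cast_nonneg n))
  refine (pow_le_pow_right₀ h1 hm).trans (le_of_eq ?_)
  rw [norm_pole, ← Real.exp_nat_mul, mul_div_cancel₀ _ (by exact_mod_cast hn : (n : ℝ) ≠ 0),
    Real.exp_log (by linarith)]

theorem I_mul_pole_zpow {s : ℝ} (hs : 0 < s) (d : ℤ) :
    (Complex.I * pole n a s) ^ d =
      Complex.I ^ d * ((s ^ ((d : ℝ) / n) : ℝ) : ℂ) * Complex.exp (d * (midRay n a * Complex.I)) := by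
  rw [mul_zpow, pole, ← Complex.exp_int_mul, mul_assoc, Real.rpow_def_of_pos hs, Complex.ofReal_exp,
    ← Complex.exp_add]
  congr 2
  push_cast
  ring

variable {N : ℕ} {v : Fin N → ℕ}

/-- With `x = (v_j - u)/n` in `(0, 1)`, the sine in `I_mul_Lam` is cancelled by `Γ(x) Γ(1-x) = π /
sin(πx)`, and `s^x` supplies the modulus of the power of the pole. -/
theorem abel_coeff_of_lt (hN : N < n) (hv : ∀ l, v l < n) (hinj : Function.Injective v) (a : ℂ)
    (j : Fin N) {u : ℕ} (hu : u < v j) {s : ℝ} (hs : 0 < s) :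
    Complex.I ^ ((v j : ℤ) - u + 1) * Lam n a v j u * Real.Gamma (((v j : ℝ) - u) / n) *
      ((Real.Gamma (1 - ((v j : ℝ) - u) / n) * s ^ (((v j : ℝ) - u) / n - 1) : ℝ) : ℂ) =
    2 * Real.pi * (replaceQuot n v j u (rho n ^ (n - N)) *
      (Complex.I * pole n a s) ^ ((v j : ℤ) - u)) / s := by
  have hn : (0 : ℝ) < n := by exact_mod_cast (by omega : 0 < n)
  have hL := I_mul_Lam hN hv hinj a j (hu.trans (hv j))
  rw [I_mul_pole_zpow hs, zpow_add_one₀ Complex.I_ne_zero]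
  push_cast
  set x := ((v j : ℝ) - u) / n with hx
  have hx0 : 0 < x := div_pos (sub_pos.mpr (by exact_mod_cast hu)) hn
  have hx1 : x < 1 := by
    rw [hx, div_lt_one hn]
    have : (v j : ℝ) < n := by exact_mod_cast hv j
    have : (0 : ℝ) ≤ u := Nat.cast_nonneg u
    linarith
  have hsin : Real.sin (Real.pi * x) ≠ 0 :=
    (Real.sin_pos_of_pos_of_lt_pi (by positivity) (by nlinarith [Real.pi_pos])).ne'
  have hG : (Real.Gamma x : ℂ) * Real.Gamma (1 - x) * Real.sin (Real.pi * x) = Real.pi := by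
    rw [← Complex.ofReal_mul, Real.Gamma_mul_Gamma_one_sub, ← Complex.ofReal_mul,
      div_mul_cancel₀ _ hsin]
  have hsx : ((s ^ (x - 1) : ℝ) : ℂ) = ((s ^ x : ℝ) : ℂ) / s := by
    rw [Real.rpow_sub_one hs.ne', Complex.ofReal_div]
  rw [hsx]
  linear_combination Complex.I ^ ((v j : ℤ) - u) * (Real.Gamma x * Real.Gamma (1 - x)) *
    (((s ^ x : ℝ) : ℂ) / s) * hL + 2 * Complex.I ^ ((v j : ℤ) - u) *
      replaceQuot n v j u (rho n ^ (n - N)) * (((s ^ x : ℝ) : ℂ) / s) *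
        Complex.exp (((v j : ℂ) - u) * (midRay n a * Complex.I)) * hG

/-- Now `x = (v_j - u)/n` lies in `(-1, 0)` and the reflection formula is used at `x + 1`; the minus
sign comes from `sin(π(x+1)) = -sin(πx)`. -/
theorem abel_coeff_of_gt (hN : N < n) (hv : ∀ l, v l < n) (hinj : Function.Injective v) (a : ℂ)
    (j : Fin N) {u : ℕ} (hu : v j < u) (hun : u < n) {s : ℝ} (hs : 0 < s) :
    Complex.I ^ ((v j : ℤ) - u + 1) * Lam n a v j u * Real.Gamma (((v j : ℝ) - u + n) / n) *
      ((Real.Gamma (1 - ((v j : ℝ) - u + n) / n) * s ^ (((v j : ℝ) - u + n) / n - 1) : ℝ) : ℂ) =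
    -(2 * Real.pi * (replaceQuot n v j u (rho n ^ (n - N)) *
      (Complex.I * pole n a s) ^ ((v j : ℤ) - u))) := by
  have hn : (0 : ℝ) < n := by exact_mod_cast (by omega : 0 < n)
  have hL := I_mul_Lam hN hv hinj a j hun
  rw [I_mul_pole_zpow hs, zpow_add_one₀ Complex.I_ne_zero]
  push_cast
  have hy : ((v j : ℝ) - u + n) / n = ((v j : ℝ) - u) / n + 1 := by
    rw [add_div, div_self hn.ne']
  rw [hy]
  set x := ((v j : ℝ) - u) / n with hx
  have hx0 : x < 0 := div_neg_of_neg_of_pos (sub_neg.mpr (by exact_mod_cast hu)) hn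
  have hx1 : -1 < x := by
    rw [hx, lt_div_iff₀ hn]
    have : (u : ℝ) < n := by exact_mod_cast hun
    have : (0 : ℝ) ≤ v j := Nat.cast_nonneg _
    linarith
  have hsin : Real.sin (Real.pi * x) ≠ 0 :=
    (Real.sin_neg_of_neg_of_neg_pi_lt (by nlinarith [Real.pi_pos]) (by nlinarith [Real.pi_pos])).ne
  have hG : (Real.Gamma (x + 1) : ℂ) * Real.Gamma (1 - (x + 1)) * Real.sin (Real.pi * x) =
      -Real.pi := by
    rw [← Complex.ofReal_mul, Real.Gamma_mul_Gamma_one_sub, ← Complex.ofReal_mul,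
      mul_add, mul_one, Real.sin_add_pi, div_neg, neg_mul, div_mul_cancel₀ _ hsin,
      Complex.ofReal_neg]
  rw [add_sub_cancel_right]
  linear_combination Complex.I ^ ((v j : ℤ) - u) * (Real.Gamma (x + 1) * Real.Gamma (1 - (x + 1))) *
    ((s ^ x : ℝ) : ℂ) * hL + 2 * Complex.I ^ ((v j : ℤ) - u) *
      replaceQuot n v j u (rho n ^ (n - N)) * ((s ^ x : ℝ) : ℂ) *
        Complex.exp (((v j : ℂ) - u) * (midRay n a * Complex.I)) * hG

end Pole

/-! ### Elimination of the unknown boundary values -/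

section Assembly

variable {n N : ℕ} {a : ℂ} {v : Fin N → ℕ}

theorem im_rho_pow_mul_pole_nonpos (hn : n ≠ 0) {k : ℕ}
    (h : Real.pi ≤ rayOne n a k ∧ rayTwo n a k ≤ 2 * Real.pi) (s : ℝ) :
    (rho n ^ k * pole n a s).im ≤ 0 := by
  have hpi : 0 ≤ Real.pi / (2 * n) := by positivity
  rw [pole, Complex.exp_add, ← Complex.ofReal_exp, mul_left_comm, Complex.im_ofReal_mul]
  exact mul_nonpos_of_nonneg_of_nonpos (Real.exp_pos _).le
    (im_rho_pow_mul_exp_nonpos hn h ⟨by linarith, by linarith⟩)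

/-- The factor `n` in the integrand cancels the `1 / n` of the residue, since `ω'(ξ) = n ω(ξ) / ξ`.
-/
theorem exists_datumIntegral (hn : 2 ≤ n) (ha : ‖a‖ = 1) (hv : ∀ l, v l < n)
    (hray : ∀ i : Fin N, Real.pi ≤ rayOne n a (n - N + i) ∧ rayTwo n a (n - N + i) ≤ 2 * Real.pi)
    {qo : ℝ → ℂ} (hqo : IsInitialDatum n qo) (j : Fin N) :
    ∃ A : ℝ → ℂ,
      (∀ t, 0 < t → HasContourIntegral n a 0 (datumIntegrand n a v qo t j 0) (A t)) ∧
      ∀ t, 0 ≤ t → LaplaceApprox t A fun s => -(2 * Real.pi * Complex.I *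
        ((∑ i : Fin N, weight n v j (rho n ^ (n - N)) i *
          halfLineTransform qo (rho n ^ (n - N + i) * pole n a s)) *
            (Complex.I * pole n a s) ^ v j * pole n a s / s)) := by
  have hnC : (n : ℂ) ≠ 0 := by exact_mod_cast (by omega : n ≠ 0)
  have hH := SectorAdmissible.sum Finset.univ fun (i : Fin N) _ =>
    (hqo.sectorAdmissible hn (hv j) (hray i)).const_mul
      (weight n v j (rho n ^ (n - N)) i * n * Complex.I ^ v j)
  obtain ⟨A, hAc, hAi, hA, hAL⟩ := hH.exists_contourIntegral hn ha
  have e : ∀ ξ : ℂ, ∑ i : Fin N, weight n v j (rho n ^ (n - N)) i * n * Complex.I ^ v j *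
      (ξ ^ v j * halfLineTransform qo (rho n ^ (n - N + i) * ξ)) =
      (∑ i : Fin N, weight n v j (rho n ^ (n - N)) i * n *
        halfLineTransform qo (rho n ^ (n - N + i) * ξ)) * (Complex.I * ξ) ^ v j := fun ξ => by
    rw [Finset.sum_mul]
    refine Finset.sum_congr rfl fun i _ => ?_
    rw [mul_pow]
    ring
  refine ⟨A, fun t ht => ?_, fun t ht => ?_⟩
  · have := hA t ht
    simp only [e] at this
    exact this
  · have h : LaplaceApprox t A _ := ⟨hAc.mono fun τ hτ => hτ.1, hAi t ht, hAL t ht⟩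
    refine h.congr_right_of_eq fun s _ => ?_
    have e' : ∑ i : Fin N, weight n v j (rho n ^ (n - N)) i * n *
        halfLineTransform qo (rho n ^ (n - N + i) * pole n a s) =
        n * ∑ i : Fin N, weight n v j (rho n ^ (n - N)) i *
          halfLineTransform qo (rho n ^ (n - N + i) * pole n a s) := by
      rw [Finset.mul_sum]
      exact Finset.sum_congr rfl fun i _ => by ring
    rw [e, e', mul_assoc (n : ℂ), mul_assoc (n : ℂ), mul_div_mul_left _ _ hnC]

theorem exists_cornerIntegral (hn : 2 ≤ n) (ha : ‖a‖ = 1) (hv : ∀ l, v l < n) {M : ℕ}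
    (u : Fin M → ℕ) (qo : ℝ → ℂ) (j : Fin N) :
    ∃ B : ℝ → ℂ,
      (∀ t, 0 < t → HasContourIntegral n a 0 (cornerIntegrand n a v u qo t j 0) (B t)) ∧
      ∀ t, 0 ≤ t → LaplaceApprox t B fun s => ∑ l with u l < v j,
        -(2 * Real.pi * (replaceQuot n v j (u l) (rho n ^ (n - N)) *
          (Complex.I * pole n a s) ^ ((v j : ℤ) - u l)) / s * dx (u l) qo 0) := by
  have hnC : (n : ℂ) ≠ 0 := by exact_mod_cast (by omega : n ≠ 0)
  have hH := SectorAdmissible.sum (n := n) (θ := midRay n a)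
    (h := fun l ξ => (replaceQuot n v j (u l) (rho n ^ (n - N)) * n * dx (u l) qo 0 *
      Complex.I ^ (v j - u l - 1)) * ξ ^ (v j - u l - 1))
    (Finset.univ.filter fun l => u l < v j) fun l hl =>
      (sectorAdmissible_pow _ (by have := hv j; have := (Finset.mem_filter.mp hl).2; omega)).const_mul _
  obtain ⟨B, hBc, hBi, hB, hBL⟩ := hH.exists_contourIntegral hn ha
  have e : ∀ ξ : ℂ, ∑ l with u l < v j, replaceQuot n v j (u l) (rho n ^ (n - N)) * n *
      dx (u l) qo 0 * Complex.I ^ (v j - u l - 1) * ξ ^ (v j - u l - 1) =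
      ∑ l with u l < v j, replaceQuot n v j (u l) (rho n ^ (n - N)) * n *
        dx (u l) qo 0 * (Complex.I * ξ) ^ (v j - u l - 1) := fun ξ =>
    Finset.sum_congr rfl fun l _ => by rw [mul_pow]; ring
  refine ⟨B, fun t ht => ?_, fun t ht => ?_⟩
  · have := hB t ht
    simp only [e] at this
    exact this
  · have h : LaplaceApprox t B _ := ⟨hBc.mono fun τ hτ => hτ.1, hBi t ht, hBL t ht⟩
    refine h.congr_right_of_eq fun s hs => ?_
    have hsC : (s : ℂ) ≠ 0 := by exact_mod_cast (by linarith : s ≠ 0)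
    rw [e, Finset.sum_neg_distrib, Finset.sum_mul, Finset.sum_div, Finset.mul_sum]
    congr 1
    refine Finset.sum_congr rfl fun l hl => ?_
    have hl := (Finset.mem_filter.mp hl).2
    have hz : (Complex.I * pole n a s) ^ ((v j : ℤ) - u l) =
        (Complex.I * pole n a s) ^ (v j - u l - 1) * (Complex.I * pole n a s) := by
      rw [← pow_succ, ← zpow_natCast]
      congr 1
      omega
    rw [hz]
    field_simp

/-- All rotated poles satisfy `ω = -s`, so the same truncated Laplace transforms occur in the `N`
global relations and the weights act on powers of `ρ` alone. -/
theorem sum_weight_mul_transform (hn : n ≠ 0) (hN : N ≤ n) (ha : ‖a‖ = 1) {u : Fin (n - N) → ℕ}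
    (huv : range u ∪ range v = Iio n)
    (hray : ∀ i : Fin N, Real.pi ≤ rayOne n a (n - N + i) ∧ rayTwo n a (n - N + i) ≤ 2 * Real.pi)
    {T : ℝ} {q : ℝ → ℝ → ℂ} (hq : IsSolution n a T q) (j : Fin N) {t : ℝ} (ht0 : 0 < t) (ht : t < T)
    {s : ℝ} (hs : 0 < s) :
    ∑ i : Fin N, weight n v j (rho n ^ (n - N)) i * ((Real.exp (-(s * t)) : ℂ) *
        halfLineTransform (q t) (rho n ^ (n - N + i) * pole n a s) -
      halfLineTransform (q 0) (rho n ^ (n - N + i) * pole n a s)) =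
    a * (-Complex.I) ^ n * (∑ l, (Complex.I * pole n a s) ^ (n - 1 - u l) *
        replaceQuot n v j (u l) (rho n ^ (n - N)) * truncLaplace t (fun τ => dx (u l) (q τ) 0) s +
      (Complex.I * pole n a s) ^ (n - 1 - v j) * truncLaplace t (fun τ => dx (v j) (q τ) 0) s) := by
  have hv : ∀ l, v l < n := fun l => by
    have : v l ∈ Iio n := huv ▸ Or.inr (mem_range_self l)
    exact this
  have hinj : Function.Injective v := fun k l h =>
    Sum.inr_injective ((elim_injective_of_range hN huv).1 (a₁ := Sum.inr k) (a₂ := Sum.inr l) h)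
  have hζ : rho n ^ (n - N) ≠ 0 := pow_ne_zero _ (rho_ne_zero n)
  have hG : ∀ i : Fin N, (Real.exp (-(s * t)) : ℂ) *
        halfLineTransform (q t) (rho n ^ (n - N + i) * pole n a s) -
      halfLineTransform (q 0) (rho n ^ (n - N + i) * pole n a s) =
      a * (-Complex.I) ^ n * ∑ m ∈ Finset.range n,
        (Complex.I * (rho n ^ (n - N + i) * pole n a s)) ^ (n - 1 - m) *
          truncLaplace t (fun τ => dx m (q τ) 0) s := fun i => by
    have h := hq.global_relation (Nat.pos_of_ne_zero hn)
      (im_rho_pow_mul_pole_nonpos hn (hray i) s) ht0 ht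
    have hsym : ∀ τ : ℝ, Complex.exp (symbol n a (rho n ^ (n - N + i) * pole n a s) * τ) =
        (Real.exp (-(s * τ)) : ℂ) := fun τ => by
      rw [symbol_rho_pow_mul hn, symbol_pole hn ha hs]
      push_cast
      ring_nf
    simp only [hsym] at h
    exact h
  have hswap : ∑ i : Fin N, weight n v j (rho n ^ (n - N)) i * (a * (-Complex.I) ^ n *
      ∑ m ∈ Finset.range n, (Complex.I * (rho n ^ (n - N + i) * pole n a s)) ^ (n - 1 - m) *
        truncLaplace t (fun τ => dx m (q τ) 0) s) =
      a * (-Complex.I) ^ n * ∑ m ∈ Finset.range n, (Complex.I * pole n a s) ^ (n - 1 - m) *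
        (∑ i : Fin N, weight n v j (rho n ^ (n - N)) i *
          (rho n ^ (n - N) * rho n ^ (i : ℕ)) ^ (n - 1 - m)) *
            truncLaplace t (fun τ => dx m (q τ) 0) s := by
    simp_rw [Finset.mul_sum, Finset.sum_mul, Finset.mul_sum]
    rw [Finset.sum_comm]
    refine Finset.sum_congr rfl fun m _ => Finset.sum_congr rfl fun i _ => ?_
    rw [pow_add, mul_pow Complex.I, mul_pow (_ * _) (pole n a s), mul_pow Complex.I]
    ring
  simp_rw [hG]
  rw [hswap, sum_range_eq_add hN huv]
  congr 2
  · simp_rw [sum_weight_mul_replace]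
  · simp_rw [sum_weight_mul_vand hv hinj hζ]
    simp

/-- The residue of the datum integral is rewritten by the eliminated global relation. The transform
of `q(t, ·)` is bounded in the lower half-plane and comes with `e^{-st}`, so it is absorbed in the
error. -/
theorem LaplaceApprox.datum (hn : n ≠ 0) (hN : N ≤ n) (ha : ‖a‖ = 1) {u : Fin (n - N) → ℕ}
    (huv : range u ∪ range v = Iio n)
    (hray : ∀ i : Fin N, Real.pi ≤ rayOne n a (n - N + i) ∧ rayTwo n a (n - N + i) ≤ 2 * Real.pi)
    {T : ℝ} {q : ℝ → ℝ → ℂ} (hq : IsSolution n a T q) (j : Fin N) {t : ℝ} (ht0 : 0 < t) (ht : t < T)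
    {A : ℝ → ℂ} (hA : LaplaceApprox t A fun s => -(2 * Real.pi * Complex.I *
        ((∑ i : Fin N, weight n v j (rho n ^ (n - N)) i *
          halfLineTransform (q 0) (rho n ^ (n - N + i) * pole n a s)) *
            (Complex.I * pole n a s) ^ v j * pole n a s / s))) :
    LaplaceApprox t A fun s => -(2 * Real.pi * (truncLaplace t (fun τ => dx (v j) (q τ) 0) s +
      ∑ l, replaceQuot n v j (u l) (rho n ^ (n - N)) *
        (Complex.I * pole n a s) ^ ((v j : ℤ) - u l) *
          truncLaplace t (fun τ => dx (u l) (q τ) 0) s)) := by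
  have hlt : ∀ m ∈ range u ∪ range v, m < n := fun m hm => by rwa [huv] at hm
  have hvj : v j < n := hlt _ (Or.inr (mem_range_self j))
  refine hA.congr_right (K := 2 * Real.pi * ∑ i : Fin N, ‖weight n v j (rho n ^ (n - N)) i‖ *
    ∫ x in Ioi (0 : ℝ), ‖q t x‖) fun s hs => ?_
  have hs0 : 0 < s := by linarith
  have hsC : (s : ℂ) ≠ 0 := by exact_mod_cast hs0.ne'
  have hw0 : Complex.I * pole n a s ≠ 0 := mul_ne_zero Complex.I_ne_zero (pole_ne_zero n a s)
  -- Here `ω(ξ) = -s` at the pole enters: `a (-i)ⁿ (iξ)ⁿ / s = -1`, which leaves the power `v_j -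
  -- m`, possibly negative.
  have hpow : ∀ m < n, Complex.I * ((Complex.I * pole n a s) ^ v j * pole n a s / s) *
      (a * (-Complex.I) ^ n * (Complex.I * pole n a s) ^ (n - 1 - m)) =
      -(Complex.I * pole n a s) ^ ((v j : ℤ) - m) := fun m hm => by
    have h1 : (Complex.I * pole n a s) ^ (v j + 1) * (Complex.I * pole n a s) ^ (n - 1 - m) =
        (Complex.I * pole n a s) ^ n * (Complex.I * pole n a s) ^ ((v j : ℤ) - m) := by
      rw [← pow_add, ← zpow_natCast, ← zpow_natCast, ← zpow_add₀ hw0]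
      congr 1
      omega
    have h2 : a * (-Complex.I) ^ n * (Complex.I * pole n a s) ^ n = -s := by
      rw [← symbol_pole hn ha hs0, symbol, mul_assoc, ← mul_pow, ← mul_assoc, neg_mul,
        Complex.I_mul_I, neg_neg, one_mul]
    rw [pow_succ] at h1
    field_simp
    linear_combination a * (-Complex.I) ^ n * h1 +
      (Complex.I * pole n a s) ^ ((v j : ℤ) - m) * h2
  have hsum := sum_weight_mul_transform hn hN ha huv hray hq j ht0 ht hs0
  simp_rw [mul_sub, Finset.sum_sub_distrib] at hsum
  set E := ∑ i : Fin N, weight n v j (rho n ^ (n - N)) i * ((Real.exp (-(s * t)) : ℂ) *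
    halfLineTransform (q t) (rho n ^ (n - N + i) * pole n a s)) with hE
  have hX : Complex.I * ((Complex.I * pole n a s) ^ v j * pole n a s / s) * (a * (-Complex.I) ^ n *
      ∑ l, (Complex.I * pole n a s) ^ (n - 1 - u l) *
        replaceQuot n v j (u l) (rho n ^ (n - N)) * truncLaplace t (fun τ => dx (u l) (q τ) 0) s) =
      -∑ l, replaceQuot n v j (u l) (rho n ^ (n - N)) *
        (Complex.I * pole n a s) ^ ((v j : ℤ) - u l) *
          truncLaplace t (fun τ => dx (u l) (q τ) 0) s := by
    rw [Finset.mul_sum, Finset.mul_sum, ← Finset.sum_neg_distrib]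
    refine Finset.sum_congr rfl fun l _ => ?_
    linear_combination replaceQuot n v j (u l) (rho n ^ (n - N)) *
      truncLaplace t (fun τ => dx (u l) (q τ) 0) s * hpow (u l) (hlt _ (Or.inl (mem_range_self l)))
  have hV := hpow (v j) hvj
  rw [sub_self, zpow_zero] at hV
  have hdiff : -(2 * Real.pi * Complex.I *
        ((∑ i : Fin N, weight n v j (rho n ^ (n - N)) i *
          halfLineTransform (q 0) (rho n ^ (n - N + i) * pole n a s)) *
            (Complex.I * pole n a s) ^ v j * pole n a s / s)) -
      -(2 * Real.pi * (truncLaplace t (fun τ => dx (v j) (q τ) 0) s +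
      ∑ l, replaceQuot n v j (u l) (rho n ^ (n - N)) *
        (Complex.I * pole n a s) ^ ((v j : ℤ) - u l) *
          truncLaplace t (fun τ => dx (u l) (q τ) 0) s)) =
      -(2 * Real.pi * Complex.I * ((Complex.I * pole n a s) ^ v j * pole n a s / s) * E) := by
    linear_combination 2 * Real.pi * Complex.I *
      ((Complex.I * pole n a s) ^ v j * pole n a s / s) * hsum + 2 * Real.pi * hX +
        2 * Real.pi * truncLaplace t (fun τ => dx (v j) (q τ) 0) s * hV
  have hEn : ‖E‖ ≤ (∑ i : Fin N, ‖weight n v j (rho n ^ (n - N)) i‖ *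
      ∫ x in Ioi (0 : ℝ), ‖q t x‖) * Real.exp (-(s * t)) := by
    rw [Finset.sum_mul]
    refine (norm_sum_le _ _).trans (Finset.sum_le_sum fun i _ => ?_)
    rw [norm_mul, norm_mul, Complex.norm_real, Real.norm_of_nonneg (Real.exp_pos _).le, mul_assoc,
      mul_comm (Real.exp _)]
    gcongr
    exact norm_halfLineTransform_le (im_rho_pow_mul_pole_nonpos hn (hray i) s)
      (hq.integrable t ⟨ht0.le, ht.le⟩)
  have hc : ‖2 * Real.pi * Complex.I * ((Complex.I * pole n a s) ^ v j * pole n a s / s)‖ ≤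
      2 * Real.pi := by
    have h := norm_pole_pow_le (a := a) hn (Nat.succ_le_of_lt hvj) hs
    rw [pow_succ] at h
    have h1 : ‖pole n a s‖ ^ v j * ‖pole n a s‖ / s ≤ 1 := by rwa [div_le_one hs0]
    rw [norm_mul, norm_div, norm_mul, norm_mul, norm_mul, norm_pow, norm_mul, Complex.norm_I,
      one_mul, mul_one, Complex.norm_real, Complex.norm_real, Real.norm_of_nonneg Real.pi_pos.le,
      Real.norm_of_nonneg hs0.le, Complex.norm_ofNat]
    exact mul_le_of_le_one_right (by positivity) h1
  rw [hdiff, norm_neg, norm_mul, mul_assoc (2 * Real.pi)]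
  exact mul_le_mul hc hEn (norm_nonneg _) (by positivity)

end Assembly

/-! ### Abel integrals of the boundary data -/

section BoundaryTerms

variable {n N : ℕ} {v : Fin N → ℕ}

theorem LaplaceApprox.abel_of_gt (hN : N < n) (hv : ∀ l, v l < n) (hinj : Function.Injective v)
    (a : ℂ) (j : Fin N) {u : ℕ} (hu : v j < u) (hun : u < n) {t : ℝ} (ht : 0 ≤ t) {g : ℝ → ℂ}
    (hg : ContinuousOn g (Icc 0 t)) :
    LaplaceApprox t (fun τ => Complex.I ^ ((v j : ℤ) - u + 1) * Lam n a v j u *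
        Real.Gamma (((v j : ℝ) - u + n) / n) * HalfLine.abel (((v j : ℝ) - u + n) / n) g τ)
      fun s => -(2 * Real.pi * (replaceQuot n v j u (rho n ^ (n - N)) *
        (Complex.I * pole n a s) ^ ((v j : ℤ) - u) * truncLaplace t g s)) := by
  have hn : (0 : ℝ) < n := by exact_mod_cast (by omega : 0 < n)
  have h1 : (u : ℝ) < n := by exact_mod_cast hun
  have h2 : (v j : ℝ) < u := by exact_mod_cast hu
  have h3 : (0 : ℝ) ≤ v j := Nat.cast_nonneg _
  have hα0 : 0 ≤ ((v j : ℝ) - u + n) / n := div_nonneg (by linarith) hn.le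
  have hα1 : ((v j : ℝ) - u + n) / n < 1 := by rw [div_lt_one hn]; linarith
  refine ((LaplaceApprox.abel hα0 hα1 ht hg).const_mul _).congr_right_of_eq fun s hs => ?_
  rw [← mul_assoc, abel_coeff_of_gt hN hv hinj a j hu hun (by linarith)]
  ring

/-- Here the power `v_j - u` of the pole is positive and an Abel integral of `g` itself would need
exponent greater than one. Using `ġ` supplies a factor `s`, at the price of a term with `g 0`. -/
theorem LaplaceApprox.abel_of_lt (hN : N < n) (hv : ∀ l, v l < n) (hinj : Function.Injective v)
    (a : ℂ) (j : Fin N) {u : ℕ} (hu : u < v j) {T t : ℝ} (ht0 : 0 < t) (ht : t < T) {g : ℝ → ℂ}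
    (hg : ContDiffOn ℝ 1 g (Icc 0 T)) :
    LaplaceApprox t (fun τ => Complex.I ^ ((v j : ℤ) - u + 1) * Lam n a v j u *
        Real.Gamma (((v j : ℝ) - u) / n) *
          HalfLine.abel (((v j : ℝ) - u) / n) (derivWithin g (Icc 0 T)) τ)
      fun s => 2 * Real.pi * (replaceQuot n v j u (rho n ^ (n - N)) *
        (Complex.I * pole n a s) ^ ((v j : ℤ) - u) * truncLaplace t g s) -
        2 * Real.pi * (replaceQuot n v j u (rho n ^ (n - N)) *
          (Complex.I * pole n a s) ^ ((v j : ℤ) - u)) / s * g 0 := by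
  have hvj := hv j
  have hn : (0 : ℝ) < n := by exact_mod_cast (by omega : 0 < n)
  have h1 : (v j : ℝ) < n := by exact_mod_cast hvj
  have h2 : (u : ℝ) < v j := by exact_mod_cast hu
  have h3 : (0 : ℝ) ≤ u := Nat.cast_nonneg _
  have hα0 : 0 ≤ ((v j : ℝ) - u) / n := div_nonneg (by linarith) hn.le
  have hα1 : ((v j : ℝ) - u) / n < 1 := by rw [div_lt_one hn]; linarith
  have hdc : ContinuousOn (derivWithin g (Icc 0 T)) (Icc 0 t) :=
    (hg.continuousOn_derivWithin (uniqueDiffOn_Icc (ht0.trans ht)) le_rfl).mono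
      (Icc_subset_Icc_right ht.le)
  refine ((LaplaceApprox.abel hα0 hα1 ht0.le hdc).const_mul _).congr_right
    (K := 2 * Real.pi * ‖replaceQuot n v j u (rho n ^ (n - N))‖ * ‖g t‖) fun s hs => ?_
  have hs0 : 0 < s := by linarith
  have hsC : (s : ℂ) ≠ 0 := by exact_mod_cast hs0.ne'
  rw [← mul_assoc, abel_coeff_of_lt hN hv hinj a j hu hs0, truncLaplace_derivWithin hg ht0 ht]
  have e : 2 * Real.pi * (replaceQuot n v j u (rho n ^ (n - N)) *
        (Complex.I * pole n a s) ^ ((v j : ℤ) - u)) / s *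
          (s * truncLaplace t g s - g 0 + (Real.exp (-(s * t)) : ℂ) * g t) -
      (2 * Real.pi * (replaceQuot n v j u (rho n ^ (n - N)) *
        (Complex.I * pole n a s) ^ ((v j : ℤ) - u) * truncLaplace t g s) -
        2 * Real.pi * (replaceQuot n v j u (rho n ^ (n - N)) *
          (Complex.I * pole n a s) ^ ((v j : ℤ) - u)) / s * g 0) =
      2 * Real.pi * replaceQuot n v j u (rho n ^ (n - N)) * g t *
        ((Complex.I * pole n a s) ^ (v j - u) / s) * (Real.exp (-(s * t)) : ℂ) := by
    rw [← zpow_natCast (Complex.I * pole n a s), Nat.cast_sub hu.le]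
    field_simp
    ring
  have h4 := norm_pole_pow_le (a := a) (by omega : n ≠ 0) (by omega : v j - u ≤ n) hs
  have h5 : ‖(Complex.I * pole n a s) ^ (v j - u) / s‖ ≤ 1 := by
    rwa [norm_div, norm_pow, norm_mul, Complex.norm_I, one_mul, Complex.norm_real,
      Real.norm_of_nonneg hs0.le, div_le_one hs0]
  rw [e, norm_mul, Complex.norm_real, Real.norm_of_nonneg (Real.exp_pos _).le]
  refine mul_le_mul_of_nonneg_right ?_ (Real.exp_pos _).le
  rw [norm_mul]
  refine (mul_le_of_le_one_right (norm_nonneg _) h5).trans (le_of_eq ?_)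
  rw [norm_mul, norm_mul, norm_mul, Complex.norm_real, Real.norm_of_nonneg Real.pi_pos.le,
    Complex.norm_ofNat]

end BoundaryTerms

/-! ### Boundary and initial values up to the corner -/

section Compatibility

variable {n : ℕ} {a : ℂ} {T : ℝ} {q : ℝ → ℝ → ℂ}

theorem IsSolution.continuousOn_dx_zero (hq : IsSolution n a T q) {m : ℕ} (hm : m < n) :
    ContinuousOn (fun τ => dx m (q τ) 0) (Icc 0 T) :=
  (hq.continuousOn m hm).comp (f := fun τ : ℝ => (τ, (0 : ℝ))) (by fun_prop)
    fun _ hτ => ⟨hτ, mem_Ici.mpr le_rfl⟩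

theorem eqOn_Ici_of_eqOn_Ioi {f g : ℝ → ℂ} (hf : ContinuousOn f (Ici 0))
    (hg : ContinuousOn g (Ici 0)) (h : ∀ x, 0 < x → f x = g x) : EqOn f g (Ici 0) :=
  EqOn.of_subset_closure (s := Ioi 0) h hf hg Ioi_subset_Ici_self (by rw [closure_Ioi])

/-- The data are prescribed on the open interval; continuity extends the equality to `t = 0`, where
it yields the corner relation between `g` and the initial datum. -/
theorem IsSolution.eqOn_boundary (hq : IsSolution n a T q) (hT : 0 < T) {m : ℕ} (hm : m < n)
    {g : ℝ → ℂ} (hg : ContinuousOn g (Icc 0 T)) (h : ∀ t ∈ Ioo 0 T, dx m (q t) 0 = g t) :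
    EqOn (fun τ => dx m (q τ) 0) g (Icc 0 T) :=
  EqOn.of_subset_closure (s := Ioo 0 T) h (hq.continuousOn_dx_zero hm) hg Ioo_subset_Icc_self
    (by rw [closure_Ioo hT.ne])

end Compatibility

end HalfLine

end

/-! ### The representation formula -/

theorem mainTheorem1 (n : ℕ) (hn : 2 ≤ n) (a : ℂ) (ha : ‖a‖ = 1)
    (ha_even : Even n → 0 ≤ a.re) (ha_odd : Odd n → a.re = 0)
    (N : ℕ) (hN : N = HalfLine.lowerCount n a)
    (u : Fin (n - N) → ℕ) (v : Fin N → ℕ) (huv : range u ∪ range v = Iio n)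
    (T : ℝ) (q : ℝ → ℝ → ℂ) (hq : HalfLine.IsSolution n a T q)
    (qo : ℝ → ℂ) (hqo : HalfLine.IsInitialDatum n qo) (hinit : ∀ x, 0 < x → q 0 x = qo x)
    (g : Fin (n - N) → ℝ → ℂ) (hg : ∀ l, ContDiffOn ℝ 1 (g l) (Icc 0 T))
    (hbdry : ∀ l, ∀ t ∈ Ioo 0 T, HalfLine.dx (u l) (q t) 0 = g l t)
    (j : Fin N) (t : ℝ) (ht : t ∈ Ioo 0 T) :
    ∃ A B : Fin (n - N) → ℂ,
      (∀ k : Fin (n - N), HalfLine.HasContourIntegral n a k (HalfLine.datumIntegrand n a v qo t j k) (A k)) ∧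
      (∀ k : Fin (n - N), HalfLine.HasContourIntegral n a k (HalfLine.cornerIntegrand n a v u qo t j k) (B k)) ∧
      2 * Real.pi * HalfLine.dx (v j) (q t) 0 =
        -(1 / ((n : ℂ) - N)) * ∑ k, A k + 1 / ((n : ℂ) - N) * ∑ k, B k
        + ∑ l with v j < u l,
            Complex.I ^ ((v j : ℤ) - u l + 1) * HalfLine.Lam n a v j (u l) *
              Real.Gamma (((v j : ℝ) - u l + n) / n) *
              HalfLine.abel (((v j : ℝ) - u l + n) / n) (g l) t
        - ∑ l with u l < v j,
            Complex.I ^ ((v j : ℤ) - u l + 1) * HalfLine.Lam n a v j (u l) *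
              Real.Gamma (((v j : ℝ) - u l) / n) *
              HalfLine.abel (((v j : ℝ) - u l) / n) (deriv (g l)) t := by
  open HalfLine in
  have hn0 : n ≠ 0 := by omega
  obtain ⟨hNn, hbounds⟩ := lowerCount_lt_and_ray_bounds hn ha ha_even ha_odd
  rw [← hN] at hNn hbounds
  have hray : ∀ i : Fin N,
      Real.pi ≤ rayOne n a (n - N + i) ∧ rayTwo n a (n - N + i) ≤ 2 * Real.pi := fun i =>
    hbounds _ (by omega) (by omega)
  have hlt : ∀ m ∈ range u ∪ range v, m < n := fun m hm => by rwa [huv] at hm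
  have hu : ∀ l, u l < n := fun l => hlt _ (Or.inl (mem_range_self l))
  have hv : ∀ l, v l < n := fun l => hlt _ (Or.inr (mem_range_self l))
  have helim := (elim_injective_of_range hNn.le huv).1
  have hinj : Function.Injective v := fun k l h =>
    Sum.inr_injective (helim (a₁ := Sum.inr k) (a₂ := Sum.inr l) h)
  have hne : ∀ l, u l ≠ v j := fun l h =>
    Sum.inl_ne_inr (helim (a₁ := Sum.inl l) (a₂ := Sum.inr j) h)
  have hT : 0 < T := ht.1.trans ht.2
  have h0T : (0 : ℝ) ∈ Icc 0 T := left_mem_Icc.mpr hT.le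
  -- Transforms are truncated at `t₁`: the global relation needs `t₁ < T`, and uniqueness gives
  -- information only at times strictly before `t₁`.
  obtain ⟨t₁, htt₁, ht₁T⟩ := exists_between ht.2
  have ht₁ : 0 < t₁ := ht.1.trans htt₁
  have hsub : Icc 0 t₁ ⊆ Icc 0 T := Icc_subset_Icc_right ht₁T.le
  have hinit' : EqOn (q 0) qo (Ici 0) :=
    eqOn_Ici_of_eqOn_Ioi (hq.contDiffOn 0 h0T).continuousOn hqo.contDiffOn.continuousOn hinit
  have hgb : ∀ l, EqOn (fun τ => dx (u l) (q τ) 0) (g l) (Icc 0 T) := fun l =>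
    hq.eqOn_boundary hT (hu l) (hg l).continuousOn (hbdry l)
  have hg0 : ∀ l, dx (u l) qo 0 = g l 0 := fun l => by
    rw [← hgb l h0T]
    exact (iteratedDerivWithin_congr hinit' self_mem_Ici).symm
  have htr : ∀ ξ, halfLineTransform qo ξ = halfLineTransform (q 0) ξ := fun ξ =>
    setIntegral_congr_fun measurableSet_Ioi fun x hx => by rw [hinit x hx]
  have hG : ∀ l s, truncLaplace t₁ (fun τ => dx (u l) (q τ) 0) s = truncLaplace t₁ (g l) s :=
    fun l s => intervalIntegral.integral_congr fun τ hτ => by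
      rw [uIcc_of_le ht₁.le] at hτ
      simp only [← hgb l (hsub hτ)]
  obtain ⟨A, hA, hAL⟩ := exists_datumIntegral hn ha hv hray hqo j
  obtain ⟨B, hB, hBL⟩ := exists_cornerIntegral hn ha hv u qo j
  have hAL := hAL t₁ ht₁.le
  simp only [htr] at hAL
  have hAL := LaplaceApprox.datum hn0 hNn.le ha huv hray hq j ht₁ ht₁T hAL
  have hC := LaplaceApprox.sum (Finset.univ.filter fun l => v j < u l) fun l hl =>
    LaplaceApprox.abel_of_gt hNn hv hinj a j (Finset.mem_filter.mp hl).2 (hu l) ht₁.le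
      ((hg l).continuousOn.mono hsub)
  have hD := LaplaceApprox.sum (Finset.univ.filter fun l => u l < v j) fun l hl =>
    LaplaceApprox.abel_of_lt hNn hv hinj a j (Finset.mem_filter.mp hl).2 ht₁ ht₁T (hg l)
  have hE := LaplaceApprox.of_continuousOn ht₁.le ((hq.continuousOn_dx_zero (hv j)).mono hsub)
  -- This is the right side of the formula minus the left, as a function of time. Its approximate
  -- transform is identically zero, so the function vanishes at `t`.
  have hS := (((hAL.const_mul (-1)).add (hBL t₁ ht₁.le)).add (hC.add (hD.const_mul (-1)))).add
    (hE.const_mul (-(2 * Real.pi)))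
  have hS0 := (hS.congr_right_of_eq (G := fun _ => 0) fun s _ => ?_).eq_zero ⟨ht.1, htt₁⟩
  · have hderiv : ∀ (α : ℝ) l, abel α (deriv (g l)) t =
        abel α (derivWithin (g l) (Icc 0 T)) t := fun α l =>
      abel_congr ht.1.le (fun τ hτ =>
        (derivWithin_of_mem_nhds (Icc_mem_nhds hτ.1 (hτ.2.trans ht.2))).symm) α
    -- The same values serve for every sector, so the averages over `k` reduce to the integrals over
    -- the first one.
    refine ⟨fun _ => A t, fun _ => B t, fun k => ?_, fun k => ?_, ?_⟩
    · exact (hA t ht.1).of_zero hn0 (datumIntegrand_rho_pow_mul hn0 hv hinj qo t j k.2)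
    · exact (hB t ht.1).of_zero hn0 (cornerIntegrand_rho_pow_mul hn0 hv hinj u qo t j k.2)
    · have hnN : (n : ℂ) - N ≠ 0 := by
        rw [sub_ne_zero]
        exact_mod_cast hNn.ne'
      simp only [hderiv, Finset.sum_const, Finset.card_univ, Fintype.card_fin, nsmul_eq_mul,
        Nat.cast_sub hNn.le]
      rw [← mul_assoc, ← mul_assoc, neg_mul, one_div_mul_cancel hnN]
      linear_combination -hS0
  -- The case `u_l = v_j` is excluded, so the two sums exhaust the known orders. For `u_l < v_j` the
  -- terms with `g_l(0)` from the derivative cancel the corner terms.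
  · have hsplit : ∀ F : Fin (n - N) → ℂ,
        ∑ l, F l = ∑ l with v j < u l, F l + ∑ l with u l < v j, F l := fun F => by
      rw [← Finset.sum_filter_add_sum_filter_not Finset.univ fun l => v j < u l]
      congr 1
      refine Finset.sum_congr (Finset.filter_congr fun l _ => ?_) fun _ _ => rfl
      have := hne l
      omega
    rw [hsplit]
    simp only [hG, hg0, Finset.sum_neg_distrib, Finset.sum_sub_distrib, ← Finset.mul_sum]
    ring
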